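/- Conventions. A $d$-dimensional tropical cycle in $\mathbb{R}^n$ is a finite, pure $d$-dimensional polyhedral complex with rational slopes (faces cut out by inequalities $\langle a,x\rangle\ge b$ with $a\in\mathbb{Z}^n$, $b\in\mathbb{R}$) and integer weights $\omega$ on its $d$-dimensional cells (facets), satisfying at every cell $\tau$ of codimension one the balancing condition $\sum_{\sigma>\tau}\omega(\sigma)\,v_{\sigma/\tau}=0$ in $\mathbb{R}^n/V_\tau$; two such complexes define the same cycle if they have a common refinement with the same weights (facets of weight zero being disregarded). Here $V_\sigma$ is the linear space parallel to $\sigma$, $\Lambda_\sigma=V_\sigma\cap\mathbb{Z}^n$, and $v_{\sigma/\tau}$ is the primitive integral generator of the ray that is the image of $\sigma$ in $\mathbb{R}^n/V_\tau$. The support $|X|$ is the union of the facets of non-zero weight; $Z$ is a subcycle of $X$ if $|Z|\subseteq|X|$; cycles of the same dimension are added by adding weights. The zero cycle is a cycle of every dimension. A rational function on a cycle $Y$ is a continuous $\varphi:|Y|\to\mathbb{R}$ that is affine with integral linear part on every cell of some polyhedral structure of $Y$. Its divisor $\varphi\cdot Y$ is the codimension one skeleton of this structure with weights $$\omega_{\varphi\cdot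 Y}(\tau)=\sum_{\sigma>\tau}\omega(\sigma)\,\varphi_\sigma(\tilde v_{\sigma/\tau})-\varphi_\tau\Big(\sum_{\sigma>\tau}\omega(\sigma)\,\tilde v_{\sigma/\tau}\Big),$$ where $\varphi_\sigma,\varphi_\tau$ are the linear parts and $\tilde v_{\sigma/\tau}$ represents $v_{\sigma/\tau}$. A morphism $f:Y\to X$ of cycles $Y\subseteq\mathbb{R}^m$, $X\subseteq\mathbb{R}^n$ is a map $x\mapsto Ax+a$ with $A\in\mathrm{Mat}(n\times m,\mathbb{Z})$, $a\in\mathbb{R}^n$, that maps $|Y|$ into $|X|$. The push-forward $f_*D$ of a $k$-dimensional subcycle $D$ of $Y$ has at a generic point $y$ the weight $\sum_\sigma|\Lambda_{f(\sigma)}/f(\Lambda_\sigma)|\,\omega_D(\sigma)$, summed over the facets $\sigma$ of $D$ with $\dim f(\sigma)=k$ and $y\in f(\sigma)$, where $f$ acts on lattice vectors by its linear part $A$. Let $X$ be a tropical cycle in $\mathbb{R}^n$ and $k\ge 0$. * Two $k$-dimensional subcycles $Z,Z'$ of $X$ are bounded rationally equivalent if there are a $(k+1)$-dimensional tropical cycle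 $Y$ in some $\mathbb{R}^m$, a morphism $f:Y\to X$ and a bounded rational function $\varphi$ on $Y$ with $f_*(\varphi\cdot Y)=Z-Z'$. * For a $(k+1)$-dimensional subcycle $F$ of $X\times\mathbb{R}$ and $p\in\mathbb{R}$, the fiber $F_p$ is the cycle $\max\{t,p\}\cdot F$, where $t$ is the coordinate of the factor $\mathbb{R}$, regarded as a subcycle of $X$ through $X\times\{p\}\cong X$. Rational equivalence over $\mathbb{R}$ is the equivalence relation on the $k$-dimensional subcycles of $X$ generated by identifying any two fibers $F_p$ and $F_q$ ($p,q\in\mathbb{R}$) of the same $F$. Proposition. For all $k$-dimensional subcycles $Z,Z'$ of $X$, the cycles $Z$ and $Z'$ are rationally equivalent over $\mathbb{R}$ if and only if they are bounded rationally equivalent. -/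

import Mathlib

noncomputable section

open scoped Classical

namespace TropCycle

/-! ### Rational polyhedra and their lattices -/

/-- The inclusion of the lattice `ℤⁿ` into `ℝⁿ`. -/
def castVec (n : ℕ) : (Fin n → ℤ) →+ (Fin n → ℝ) := (Int.castAddHom ℝ).compLeft (Fin n)

/-- A non-empty polyhedron in `ℝⁿ` with rational slopes: finitely many inequalities
`∑ aᵢ xᵢ ≥ b` with `a ∈ ℤⁿ` and `b ∈ ℝ`. -/
def IsRationalPolyhedron {n : ℕ} (σ : Set (Fin n → ℝ)) : Prop :=
  σ.Nonempty ∧ ∃ S : Finset ((Fin n → ℤ) × ℝ),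
    σ = {x | ∀ c ∈ S, c.2 ≤ ∑ i, (c.1 i : ℝ) * x i}

/-- `τ` is a (non-empty, possibly improper) face of `σ`. -/
def IsFace {n : ℕ} (τ σ : Set (Fin n → ℝ)) : Prop := τ.Nonempty ∧ IsExposed ℝ σ τ

/-- The dimension of a polyhedron `σ`: the dimension of its linear space
`V_σ = vectorSpan ℝ σ`. -/
def cellDim {n : ℕ} (σ : Set (Fin n → ℝ)) : ℕ := Module.finrank ℝ (vectorSpan ℝ σ)

/-- The lattice `Λ_σ = V_σ ∩ ℤⁿ`. -/
def cellLattice {n : ℕ} (σ : Set (Fin n → ℝ)) : AddSubgroup (Fin n → ℤ) :=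
  (vectorSpan ℝ σ).toAddSubgroup.comap (castVec n)

/-- `v ∈ ℤⁿ` represents the primitive generator `v_{σ/τ}`: it lies in `Λ_σ`, generates `Λ_σ`
modulo `Λ_τ`, and points from `τ` into `σ`. -/
def IsPrimitiveVector {n : ℕ} (τ σ : Set (Fin n → ℝ)) (v : Fin n → ℤ) : Prop :=
  v ∈ cellLattice σ ∧ (∀ w ∈ cellLattice σ, ∃ k : ℤ, w - k • v ∈ cellLattice τ) ∧
    ∃ p ∈ τ, ∃ ε : ℝ, 0 < ε ∧ p + ε • castVec n v ∈ σ

/-- An integral representative of `v_{σ/τ}` (which is unique modulo `Λ_τ`). -/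
def primitiveVector {n : ℕ} (τ σ : Set (Fin n → ℝ)) : Fin n → ℤ :=
  Classical.epsilon (IsPrimitiveVector τ σ)

/-! ### Weighted polyhedral complexes -/

/-- A finite rational polyhedral complex in `ℝⁿ` of dimension at most `d`, with integer weights.
Only the weights of the `d`-dimensional cells matter. -/
structure WeightedComplex (n d : ℕ) where
  cells : Finset (Set (Fin n → ℝ))
  isPolyhedron : ∀ σ ∈ cells, IsRationalPolyhedron σ
  face_mem : ∀ σ ∈ cells, ∀ τ, IsFace τ σ → τ ∈ cells
  inter_face : ∀ σ ∈ cells, ∀ τ ∈ cells, (σ ∩ τ).Nonempty → IsFace (σ ∩ τ) σ ∧ IsFace (σ ∩ τ) τ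
  dim_le : ∀ σ ∈ cells, cellDim σ ≤ d
  weight : Set (Fin n → ℝ) → ℤ

namespace WeightedComplex

variable {n d : ℕ}

/-- The `d`-dimensional cells. -/
def facets (K : WeightedComplex n d) : Finset (Set (Fin n → ℝ)) :=
  K.cells.filter fun σ => cellDim σ = d

/-- The cells of codimension one. -/
def ridges (K : WeightedComplex n d) : Finset (Set (Fin n → ℝ)) :=
  K.cells.filter fun τ => cellDim τ + 1 = d

/-- The facets around the cell `τ`. -/
def facetsAround (K : WeightedComplex n d) (τ : Set (Fin n → ℝ)) : Finset (Set (Fin n → ℝ)) :=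
  K.facets.filter fun σ => τ ⊆ σ

/-- The union of all facets of non-zero weight. -/
def support (K : WeightedComplex n d) : Set (Fin n → ℝ) :=
  {x | ∃ σ ∈ K.facets, K.weight σ ≠ 0 ∧ x ∈ σ}

/-- Every cell is contained in a facet. -/
def IsPure (K : WeightedComplex n d) : Prop := ∀ τ ∈ K.cells, ∃ σ ∈ K.facets, τ ⊆ σ

/-- The balancing condition: around each ridge `τ`, the weighted sum of the primitive vectors
vanishes modulo `V_τ`. -/
def IsBalanced (K : WeightedComplex n d) : Prop :=
  ∀ τ ∈ K.ridges, ∑ σ ∈ K.facetsAround τ, K.weight σ • primitiveVector τ σ ∈ cellLattice τ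

/-- A tropical polyhedral complex: pure-dimensional and balanced. -/
def IsTropical (K : WeightedComplex n d) : Prop := K.IsPure ∧ K.IsBalanced

/-- All facets have non-zero weight, so that the support of a pure complex is the union of all
its cells. -/
def IsReduced (K : WeightedComplex n d) : Prop := ∀ σ ∈ K.facets, K.weight σ ≠ 0

end WeightedComplex

/-! ### Tropical cycles

Two tropical complexes of dimension `d` have a common refinement with the same induced weights
(facets of weight zero being disregarded) if and only if they have the same weight at each
generic point, that is, away from a finite union of affine subspaces of dimension `< d`. A
tropical cycle is therefore modelled by the class of its weight function on generic points. -/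

/-- Integer valued functions on `ℝⁿ` that vanish outside of a finite union of affine subspaces
of dimension `< d`. -/
def negligible (n d : ℕ) : AddSubgroup ((Fin n → ℝ) → ℤ) where
  carrier := {w | ∃ T : Finset (AffineSubspace ℝ (Fin n → ℝ)),
    (∀ H ∈ T, Module.finrank ℝ H.direction < d) ∧ ∀ x, w x ≠ 0 → ∃ H ∈ T, x ∈ H}
  zero_mem' := ⟨∅, by simp, by simp⟩
  add_mem' := by
    rintro a b ⟨S, hS, hS'⟩ ⟨T, hT, hT'⟩
    refine ⟨S ∪ T, fun H hH => ?_, fun x hx => ?_⟩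
    · rcases Finset.mem_union.1 hH with h | h
      exacts [hS H h, hT H h]
    · by_cases ha : a x = 0
      · have hb : b x ≠ 0 := fun hb => hx (by simp [ha, hb])
        obtain ⟨H, hH, hxH⟩ := hT' x hb
        exact ⟨H, Finset.mem_union_right _ hH, hxH⟩
      · obtain ⟨H, hH, hxH⟩ := hS' x ha
        exact ⟨H, Finset.mem_union_left _ hH, hxH⟩
  neg_mem' := by
    rintro a ⟨S, hS, hS'⟩
    exact ⟨S, hS, fun x hx => hS' x (by simpa using hx)⟩

/-- Weight functions on `ℝⁿ` up to their values at non-generic points; addition is the addition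
of weights. -/
abbrev WeightClass (n d : ℕ) : Type := ((Fin n → ℝ) → ℤ) ⧸ negligible n d

/-- The class of the weight function of a weighted complex: a point in the relative interior of
a facet gets the weight of that facet, all other points get weight zero. -/
def WeightedComplex.toClass {n d : ℕ} (K : WeightedComplex n d) : WeightClass n d :=
  QuotientAddGroup.mk fun x =>
    ∑ σ ∈ K.facets, if x ∈ intrinsicInterior ℝ σ then K.weight σ else 0

/-- A `d`-dimensional tropical cycle in `ℝⁿ`. -/
def TropicalCycle (n d : ℕ) : Type :=
  {Z : WeightClass n d // ∃ K : WeightedComplex n d, K.IsTropical ∧ K.toClass = Z}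

/-- `K` is a polyhedral structure for the tropical cycle `X`. -/
def WeightedComplex.IsStructureOf {n d : ℕ} (K : WeightedComplex n d) (X : TropicalCycle n d) :
    Prop :=
  K.IsTropical ∧ K.toClass = X.1

/-- The support `|X|` of a tropical cycle (the same for all polyhedral structures). -/
def TropicalCycle.support {n d : ℕ} (X : TropicalCycle n d) : Set (Fin n → ℝ) :=
  {x | ∃ K : WeightedComplex n d, K.IsStructureOf X ∧ x ∈ K.support}

/-- The `k`-dimensional tropical subcycles of `X`. -/
def Subcycle {n r : ℕ} (X : TropicalCycle n r) (k : ℕ) : Type :=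
  {Z : TropicalCycle n k // Z.support ⊆ X.support}

/-! ### Rational functions and their divisors -/

/-- `A ∈ ℤⁿ` is the linear part of the integer affine function `φ` on `σ`. -/
def IsLinearPart {n : ℕ} (φ : (Fin n → ℝ) → ℝ) (σ : Set (Fin n → ℝ)) (A : Fin n → ℤ) : Prop :=
  ∃ c : ℝ, ∀ x ∈ σ, φ x = ∑ i, (A i : ℝ) * x i + c

/-- The linear part of `φ` on `σ` (uniquely determined on `V_σ`). -/
def linearPart {n : ℕ} (φ : (Fin n → ℝ) → ℝ) (σ : Set (Fin n → ℝ)) : Fin n → ℤ :=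
  Classical.epsilon (IsLinearPart φ σ)

namespace WeightedComplex

variable {n d : ℕ}

/-- `φ` is continuous on the support of `K` and integer affine on each cell of `K`, where `K`
has no facets of weight zero. Only the values of `φ` on the support matter. -/
def IsRational (K : WeightedComplex n d) (φ : (Fin n → ℝ) → ℝ) : Prop :=
  K.IsReduced ∧ ContinuousOn φ K.support ∧ ∀ σ ∈ K.cells, ∃ A, IsLinearPart φ σ A

/-- The weight of the ridge `τ` in the divisor of `φ`:
`∑ ω(σ) φ_σ(v_{σ/τ}) - φ_τ(∑ ω(σ) v_{σ/τ})`, the sums running over the facets `σ` around `τ`. -/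
def divisorWeight (K : WeightedComplex n d) (φ : (Fin n → ℝ) → ℝ) (τ : Set (Fin n → ℝ)) : ℤ :=
  ∑ σ ∈ K.facetsAround τ, K.weight σ * (linearPart φ σ ⬝ᵥ primitiveVector τ σ)
    - linearPart φ τ ⬝ᵥ ∑ σ ∈ K.facetsAround τ, K.weight σ • primitiveVector τ σ

/-- The divisor of `φ`: the codimension one skeleton with the weights `divisorWeight`. -/
def divisor (K : WeightedComplex n (d + 1)) (φ : (Fin n → ℝ) → ℝ) : WeightedComplex n d where
  cells := K.cells.filter fun σ => cellDim σ ≤ d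
  isPolyhedron σ hσ := K.isPolyhedron σ (Finset.mem_filter.1 hσ).1
  face_mem σ hσ τ hτ := by
    obtain ⟨h1, h2⟩ := Finset.mem_filter.1 hσ
    exact Finset.mem_filter.2 ⟨K.face_mem σ h1 τ hτ,
      (Submodule.finrank_mono (vectorSpan_mono ℝ hτ.2.subset)).trans h2⟩
  inter_face σ hσ τ hτ h :=
    K.inter_face σ (Finset.mem_filter.1 hσ).1 τ (Finset.mem_filter.1 hτ).1 h
  dim_le σ hσ := (Finset.mem_filter.1 hσ).2
  weight := K.divisorWeight φ

end WeightedComplex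

/-- `φ` is a rational function on the cycle `Y` and `D = φ · Y` is its divisor, computed in a
suitable polyhedral structure. -/
def IsDivisor {n d : ℕ} (φ : (Fin n → ℝ) → ℝ) (Y : TropicalCycle n (d + 1))
    (D : WeightClass n d) : Prop :=
  ∃ K : WeightedComplex n (d + 1), K.IsStructureOf Y ∧ K.IsRational φ ∧ (K.divisor φ).toClass = D

/-! ### Morphisms and push-forward -/

/-- An integer affine map `x ↦ A x + a` from `ℝᵐ` to `ℝⁿ`, `A` integral and `a` real. -/
structure IntAffineMap (m n : ℕ) where
  lin : Matrix (Fin n) (Fin m) ℤ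
  trans : Fin n → ℝ

/-- The map `x ↦ A x + a`. -/
def IntAffineMap.toFun {m n : ℕ} (f : IntAffineMap m n) (x : Fin m → ℝ) : Fin n → ℝ :=
  fun i => ∑ j, (f.lin i j : ℝ) * x j + f.trans i

/-- The index `|Λ_{f(σ)} / f(Λ_σ)|`, where `f` acts on lattice vectors by its linear part. -/
def IntAffineMap.latticeIndex {m n : ℕ} (f : IntAffineMap m n) (σ : Set (Fin m → ℝ)) : ℕ :=
  ((cellLattice σ).map f.lin.mulVecLin.toAddMonoidHom).relIndex (cellLattice (f.toFun '' σ))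

/-- The push-forward along `f` as a weight function: at a generic point `y`, it is the sum of
`|Λ_{f(σ)} / f(Λ_σ)| ω(σ)` over the facets `σ` whose image has dimension `d` and contains `y` in
its relative interior. -/
def WeightedComplex.pushforward {m n d : ℕ} (K : WeightedComplex m d) (f : IntAffineMap m n) :
    WeightClass n d :=
  QuotientAddGroup.mk fun y =>
    ∑ σ ∈ K.facets.filter fun σ => cellDim (f.toFun '' σ) = d,
      if y ∈ intrinsicInterior ℝ (f.toFun '' σ) then (f.latticeIndex σ : ℤ) * K.weight σ else 0

/-- `W = f_* D`, computed in a suitable polyhedral structure of `D`. -/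
def IsPushforward {m n d : ℕ} (f : IntAffineMap m n) (D : WeightClass m d) (W : WeightClass n d) :
    Prop :=
  ∃ K : WeightedComplex m d, K.toClass = D ∧ K.pushforward f = W

/-! ### Bounded rational equivalence -/

/-- `Z = f_*(φ · Y)` for a morphism `f : Y → X` and a bounded rational function `φ` on `Y`. -/
def IsBoundedRatEquivZero {n r k : ℕ} (X : TropicalCycle n r) (Z : WeightClass n k) : Prop :=
  ∃ (m : ℕ) (Y : TropicalCycle m (k + 1)) (f : IntAffineMap m n) (φ : (Fin m → ℝ) → ℝ)
    (D : WeightClass m k),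
    Set.MapsTo f.toFun Y.support X.support ∧
    (∃ C : ℝ, ∀ x ∈ Y.support, |φ x| ≤ C) ∧
    IsDivisor φ Y D ∧ IsPushforward f D Z

/-- Bounded rational equivalence of subcycles of `X`. -/
def BoundedRatEquiv {n r k : ℕ} (X : TropicalCycle n r) (Z Z' : Subcycle X k) : Prop :=
  IsBoundedRatEquivZero X (Z.1.1 - Z'.1.1)

/-! ### Rational equivalence over `ℝ` -/

/-- The projection `ℝⁿ × ℝ → ℝⁿ`, the last coordinate of `ℝⁿ⁺¹` being the second factor. -/
def projInit (n : ℕ) : IntAffineMap (n + 1) n where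
  lin := fun i j => if j = i.castSucc then 1 else 0
  trans := 0

/-- `Z` is the fiber `F_p`: the divisor of `max{t, p}` on `F`, where `t` is the last coordinate,
carried from `ℝⁿ × {p}` to `ℝⁿ` by the projection. -/
def IsFiber {n k : ℕ} (F : TropicalCycle (n + 1) (k + 1)) (p : ℝ) (Z : WeightClass n k) : Prop :=
  ∃ D : WeightClass (n + 1) k,
    IsDivisor (fun x => max (x (Fin.last n)) p) F D ∧ IsPushforward (projInit n) D Z

/-- `Z` and `Z'` are two fibers of the same family `F ⊆ X × ℝ`. -/
def AreFibers {n r k : ℕ} (X : TropicalCycle n r) (Z Z' : Subcycle X k) : Prop :=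
  ∃ (F : TropicalCycle (n + 1) (k + 1)) (p q : ℝ),
    (∀ x ∈ F.support, Fin.init x ∈ X.support) ∧ IsFiber F p Z.1.1 ∧ IsFiber F q Z'.1.1

/-- Rational equivalence over `ℝ`: the equivalence relation on the `k`-dimensional subcycles of
`X` generated by identifying any two fibers of the same family. -/
def RatEquivOverReals {n r k : ℕ} (X : TropicalCycle n r) : Subcycle X k → Subcycle X k → Prop :=
  Relation.EqvGen (AreFibers X)

end TropCycle

end

/-!
Both equivalence relations are compared with the relation that `W = Z - Z'` *bounds* over `X`
(`TropCycle.Bounds`): there is a balanced family of polyhedra in `X × ℝ` that is a cylinder over a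
representative of `W` at low heights and empty at great heights. The classes that bound form a
subgroup, so that this relation is an equivalence relation.

* If `W = f_*(φ · Y)` with `φ` bounded, then `W` bounds. The modification of `Y` along `φ` consists of
  the graph of `φ` and of the downward cells `{x ∈ τ, t ≤ φ(x)}` over the ridges `τ`, with the weights
  of the divisor of `φ` (`TropCycle.WeightedComplex.modification`). It is balanced at the graph by the
  definition of the divisor, and below the graph because divisors are balanced
  (`TropCycle.WeightedComplex.isBalanced_divisor`). Its push-forward under `f × id` is the cylinder
  over `f_*(φ · Y)` below the infimum of `φ`, and empty above the supremum.
* If `Z - Z'` bounds, then adding the cylinder over `Z'` to the family gives a family with fibers `Z`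
  and `Z'` (`TropCycle.areFibers_of_bounds`).
* If `Z` and `Z'` are the fibers of `F` at `p` and `q`, then `max {t, p} - max {t, q}` is a bounded
  rational function on `F`, and the projection to `X` takes its divisor to `Z - Z'`
  (`TropCycle.boundedRatEquiv_of_areFibers`).

Cycles are handled as *chains*, formal integer combinations of polyhedra of one dimension without
any incidence condition. A chain has a weight function, and at each point `y` and for each subspace
`L` a divergence: the sum of the primitive vectors of its polyhedra with lineality space `L` at `y`.
A chain is balanced if these divergences lie in `L` at generic points. The cells of a hyperplane
arrangement that contains all defining inequalities turn a balanced chain into a tropical complex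
with the same weight function (`TropCycle.Chain.isTropical_cpx`). The reason is the local computation
`TropCycle.sum_primitiveVector_sub_mem`: around a ridge of the arrangement, the primitive vectors of
the cells in a polyhedron `Q` add up to the one of `Q` if the ridge lies in the boundary of `Q`, and
cancel if it passes through the interior of `Q`. Sums, cylinders, modifications and push-forwards can
therefore be formed polyhedron by polyhedron. The push-forward respects weight classes and balancing
(`TropCycle.IntAffineMap.cls_push_congr`, `TropCycle.IntAffineMap.bal_push`), and the divisor of
`max {t, p}` only depends on the weight function near the height `p`
(`TropCycle.WeightedComplex.toClass_divisor_maxLast`, `TropCycle.Chain.mk_ht_trunc_congr`).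

The divisor of a rational function is balanced at a cell `κ` because the facets around `κ` can be
treated one at a time: a facet `σ` has exactly two ridges `τ` around `κ`, and the lattice bases
`(v_{τ/κ}, v_{σ/τ})` of `σ` modulo `κ` that they define have opposite orientations
(`TropCycle.WeightedComplex.sum_ridges_mem`).
-/

noncomputable section

open scoped Classical

open Filter Topology

namespace TropCycle

/-! ### Rational polyhedra through their defining inequalities -/

/-- The linear form `x ↦ ∑ aᵢ xᵢ` on `ℝⁿ` given by an integer vector `a`. -/
def intForm {n : ℕ} (a : Fin n → ℤ) : (Fin n → ℝ) →ₗ[ℝ] ℝ :=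
  ∑ i, (a i : ℝ) • LinearMap.proj i

theorem intForm_apply {n : ℕ} (a : Fin n → ℤ) (x : Fin n → ℝ) :
    intForm a x = ∑ i, (a i : ℝ) * x i := by
  simp [intForm]

theorem continuous_intForm {n : ℕ} (a : Fin n → ℤ) : Continuous (intForm a) :=
  LinearMap.continuous_of_finiteDimensional _

theorem intForm_neg {n : ℕ} (a : Fin n → ℤ) (x : Fin n → ℝ) :
    intForm (-a) x = -intForm a x := by
  simp [intForm_apply]

theorem intForm_castVec {n : ℕ} (a v : Fin n → ℤ) :
    intForm a (castVec n v) = ((a ⬝ᵥ v : ℤ) : ℝ) := by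
  simp [intForm_apply, castVec, dotProduct]

/-- The slack `∑ aᵢ xᵢ - b` of the inequality `∑ aᵢ xᵢ ≥ b` at `x`. -/
def gap {n : ℕ} (c : (Fin n → ℤ) × ℝ) (x : Fin n → ℝ) : ℝ := intForm c.1 x - c.2

theorem gap_add_smul {n : ℕ} (c : (Fin n → ℤ) × ℝ) (x v : Fin n → ℝ) (s : ℝ) :
    gap c (x + s • v) = gap c x + s * intForm c.1 v := by
  simp [gap]; ring

theorem gap_add {n : ℕ} (c : (Fin n → ℤ) × ℝ) (x v : Fin n → ℝ) :
    gap c (x + v) = gap c x + intForm c.1 v := by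
  simp [gap]; ring

theorem intForm_sub_eq_gap {n : ℕ} (c : (Fin n → ℤ) × ℝ) (x y : Fin n → ℝ) :
    intForm c.1 (x - y) = gap c x - gap c y := by
  simp [gap]

theorem continuous_gap {n : ℕ} (c : (Fin n → ℤ) × ℝ) : Continuous (gap c) :=
  (continuous_intForm c.1).sub continuous_const

/-- The solution set of a finite system of inequalities. -/
def poly {n : ℕ} (S : Finset ((Fin n → ℤ) × ℝ)) : Set (Fin n → ℝ) := {x | ∀ c ∈ S, 0 ≤ gap c x}

theorem isRationalPolyhedron_iff {n : ℕ} {σ : Set (Fin n → ℝ)} :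
    IsRationalPolyhedron σ ↔ σ.Nonempty ∧ ∃ S, σ = poly S := by
  simp [IsRationalPolyhedron, poly, gap, intForm_apply]

theorem convex_poly {n : ℕ} (S : Finset ((Fin n → ℤ) × ℝ)) : Convex ℝ (poly S) := by
  intro x hx y hy a b ha hb hab c hc
  have : gap c (a • x + b • y) = a * gap c x + b * gap c y := by
    simp only [gap, map_add, map_smul, smul_eq_mul]
    linear_combination (-c.2) * (-hab)
  rw [this]
  exact add_nonneg (mul_nonneg ha (hx c hc)) (mul_nonneg hb (hy c hc))

theorem isClosed_poly {n : ℕ} (S : Finset ((Fin n → ℤ) × ℝ)) : IsClosed (poly S) := by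
  have : poly S = ⋂ c ∈ S, {x | 0 ≤ gap c x} := by ext; simp [poly]
  rw [this]
  exact isClosed_biInter fun c _ => isClosed_le continuous_const (continuous_gap c)

theorem IsRationalPolyhedron.convex {n : ℕ} {σ : Set (Fin n → ℝ)} (h : IsRationalPolyhedron σ) :
    Convex ℝ σ := by
  obtain ⟨-, S, rfl⟩ := isRationalPolyhedron_iff.1 h
  exact convex_poly S

theorem IsRationalPolyhedron.isClosed {n : ℕ} {σ : Set (Fin n → ℝ)}
    (h : IsRationalPolyhedron σ) : IsClosed σ := by
  obtain ⟨-, S, rfl⟩ := isRationalPolyhedron_iff.1 h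
  exact isClosed_poly S

/-- The common kernel of the linear parts of the inequalities of `S` that are equalities at
`x`. -/
def kerAt {n : ℕ} (S : Finset ((Fin n → ℤ) × ℝ)) (x : Fin n → ℝ) : Submodule ℝ (Fin n → ℝ) where
  carrier := {v | ∀ c ∈ S, gap c x = 0 → intForm c.1 v = 0}
  zero_mem' := by simp
  add_mem' := fun ha hb c hc h => by simp [ha c hc h, hb c hc h]
  smul_mem' := fun r v hv c hc h => by simp [hv c hc h]

theorem mem_kerAt {n : ℕ} {S : Finset ((Fin n → ℤ) × ℝ)} {x v : Fin n → ℝ} :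
    v ∈ kerAt S x ↔ ∀ c ∈ S, gap c x = 0 → intForm c.1 v = 0 := Iff.rfl

theorem kerAt_anti {n : ℕ} {S T : Finset ((Fin n → ℤ) × ℝ)} (h : S ⊆ T) (x : Fin n → ℝ) :
    kerAt T x ≤ kerAt S x := fun _ hv c hc => hv c (h hc)

/-- The lineality space of a convex set `Q` at `y`: the span of the directions in which one can
move both ways from `y` within `Q`. -/
def lineality {n : ℕ} (Q : Set (Fin n → ℝ)) (y : Fin n → ℝ) : Submodule ℝ (Fin n → ℝ) :=
  Submodule.span ℝ {v | y + v ∈ Q ∧ y - v ∈ Q}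

theorem lineality_le_vectorSpan {n : ℕ} {Q : Set (Fin n → ℝ)} {y : Fin n → ℝ} (hy : y ∈ Q) :
    lineality Q y ≤ vectorSpan ℝ Q := by
  rw [lineality, Submodule.span_le]
  rintro v ⟨h, -⟩
  simpa using vsub_mem_vectorSpan ℝ h hy

theorem lineality_mono {n : ℕ} {Q R : Set (Fin n → ℝ)} (h : Q ⊆ R) (y : Fin n → ℝ) :
    lineality Q y ≤ lineality R y :=
  Submodule.span_mono fun _ hv => ⟨h hv.1, h hv.2⟩

theorem eventually_pos_gap {n : ℕ} (c : (Fin n → ℤ) × ℝ) (y v : Fin n → ℝ) (h : 0 < gap c y) :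
    ∀ᶠ s in 𝓝[>] (0 : ℝ), 0 < gap c (y + s • v) := by
  have hc : Continuous fun s : ℝ => gap c (y + s • v) := (continuous_gap c).comp (by fun_prop)
  have : ∀ᶠ s in 𝓝 (0 : ℝ), 0 < gap c (y + s • v) :=
    hc.continuousAt.eventually (lt_mem_nhds (by simpa using h))
  exact nhdsWithin_le_nhds this

theorem eventually_mem_poly {n : ℕ} {S : Finset ((Fin n → ℤ) × ℝ)} {y v : Fin n → ℝ}
    (hy : y ∈ poly S) (hv : ∀ c ∈ S, gap c y = 0 → 0 ≤ intForm c.1 v) :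
    ∀ᶠ s in 𝓝[>] (0 : ℝ), y + s • v ∈ poly S := by
  refine (eventually_all_finset S).2 fun c hc => ?_
  rcases (hy c hc).lt_or_eq with h | h
  · exact (eventually_pos_gap c y v h).mono fun s hs => hs.le
  · filter_upwards [self_mem_nhdsWithin] with s hs
    rw [gap_add_smul, ← h, zero_add]
    exact mul_nonneg (le_of_lt hs) (hv c hc h.symm)

theorem intForm_nonneg_of_mem_poly {n : ℕ} {S : Finset ((Fin n → ℤ) × ℝ)} {y v : Fin n → ℝ}
    {s : ℝ} (hs : 0 < s) (h : y + s • v ∈ poly S) : ∀ c ∈ S, gap c y = 0 → 0 ≤ intForm c.1 v := by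
  intro c hc h0
  have := h c hc
  rw [gap_add_smul, h0, zero_add] at this
  exact nonneg_of_mul_nonneg_right this hs

theorem lineality_poly {n : ℕ} {S : Finset ((Fin n → ℤ) × ℝ)} {y : Fin n → ℝ}
    (hy : y ∈ poly S) : lineality (poly S) y = kerAt S y := by
  apply le_antisymm
  · rw [lineality, Submodule.span_le]
    rintro v ⟨h1, h2⟩ c hc h0
    have a1 := h1 c hc
    have a2 := h2 c hc
    rw [gap_add, h0] at a1
    rw [sub_eq_add_neg, gap_add, h0, map_neg] at a2
    linarith
  · intro v hv
    have h1 := eventually_mem_poly (v := v) hy fun c hc h => (hv c hc h).ge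
    have h2 := eventually_mem_poly (v := -v) hy fun c hc h => by simp [hv c hc h]
    obtain ⟨s, ⟨h1, h2⟩, hs⟩ := ((h1.and h2).and self_mem_nhdsWithin).exists
    have hs0 : s ≠ 0 := (ne_of_gt hs)
    have : s • v ∈ lineality (poly S) y :=
      Submodule.subset_span ⟨h1, by simpa [sub_eq_add_neg] using h2⟩
    simpa [smul_smul, hs0] using Submodule.smul_mem _ s⁻¹ this

/-- A point of a rational polyhedron lies in the relative interior if and only if one can move
both ways in each direction of the polyhedron. -/
theorem mem_intrinsicInterior_iff {n : ℕ} {Q : Set (Fin n → ℝ)} (hQ : IsRationalPolyhedron Q)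
    {y : Fin n → ℝ} :
    y ∈ intrinsicInterior ℝ Q ↔ y ∈ Q ∧ lineality Q y = vectorSpan ℝ Q := by
  obtain ⟨-, S, rfl⟩ := isRationalPolyhedron_iff.1 hQ
  constructor
  · intro h
    have hy : y ∈ poly S := intrinsicInterior_subset h
    refine ⟨hy, (lineality_le_vectorSpan hy).antisymm ?_⟩
    obtain ⟨⟨y', hy'⟩, hint, rfl⟩ := mem_intrinsicInterior.1 h
    rw [vectorSpan_eq_span_vsub_set_right ℝ hy, Submodule.span_le]
    rintro _ ⟨z, hz, rfl⟩
    rw [mem_interior_iff_mem_nhds, nhds_subtype_eq_comap] at hint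
    obtain ⟨U, hU, hUS⟩ := hint
    rw [lineality_poly hy]
    have hc : Continuous fun s : ℝ => y' + s • (y' - z) := by fun_prop
    have h1 : ∀ᶠ s in 𝓝[>] (0 : ℝ), y' + s • (y' - z) ∈ U :=
      nhdsWithin_le_nhds (hc.continuousAt.eventually (by simpa using hU))
    obtain ⟨s, h1, hs⟩ := (h1.and self_mem_nhdsWithin).exists
    have hmem : y' + s • (y' - z) ∈ affineSpan ℝ (poly S) := by
      have := AffineMap.lineMap_mem (-s) hy' (subset_affineSpan ℝ _ hz)
      rw [AffineMap.lineMap_apply] at this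
      convert this using 1
      simp only [vsub_eq_sub, vadd_eq_add, neg_smul, smul_sub]
      abel
    have h2 : y' + s • (y' - z) ∈ poly S := hUS (a := ⟨_, hmem⟩) h1
    intro c hc h0
    have a1 := intForm_nonneg_of_mem_poly hs h2 c hc h0
    have a2 := hz c hc
    simp only [vsub_eq_sub, intForm_sub_eq_gap, h0] at a1 ⊢
    linarith
  · rintro ⟨hy, h⟩
    rw [lineality_poly hy] at h
    refine mem_intrinsicInterior.2 ⟨⟨y, subset_affineSpan ℝ _ hy⟩, ?_, rfl⟩
    rw [mem_interior_iff_mem_nhds, nhds_subtype_eq_comap]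
    have hU : ∀ᶠ z in 𝓝 y, ∀ c ∈ S, 0 < gap c y → 0 < gap c z := by
      refine (eventually_all_finset S).2 fun c _ => ?_
      by_cases h0 : 0 < gap c y
      · exact ((continuous_gap c).continuousAt.eventually (lt_mem_nhds h0)).mono fun z hz _ => hz
      · exact Eventually.of_forall fun z hz => absurd hz h0
    refine ⟨_, hU, ?_⟩
    rintro ⟨z, hz⟩ hzU c hc
    rcases (hy c hc).lt_or_eq with h0 | h0
    · exact (hzU c hc h0).le
    · have : z - y ∈ vectorSpan ℝ (poly S) := by
        rw [← direction_affineSpan]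
        exact AffineSubspace.vsub_mem_direction hz (subset_affineSpan ℝ _ hy)
      rw [← h] at this
      have h1 := this c hc h0.symm
      rw [intForm_sub_eq_gap, ← h0] at h1
      simp only at h1 ⊢
      linarith

theorem exists_mem_intrinsicInterior {n : ℕ} {Q : Set (Fin n → ℝ)} (hQ : IsRationalPolyhedron Q) :
    ∃ y, y ∈ intrinsicInterior ℝ Q := hQ.1.intrinsicInterior hQ.convex

/-- The system of inequalities that expresses that no inequality changes its sign, compared to
`x`. -/
def signForms {n : ℕ} (S : Finset ((Fin n → ℤ) × ℝ)) (x : Fin n → ℝ) :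
    Finset ((Fin n → ℤ) × ℝ) :=
  S.filter (fun c => 0 ≤ gap c x) ∪ (S.filter fun c => gap c x ≤ 0).image fun c => -c

/-- The closed cell of `x` in the hyperplane arrangement of `S`. -/
def signCell {n : ℕ} (S : Finset ((Fin n → ℤ) × ℝ)) (x : Fin n → ℝ) : Set (Fin n → ℝ) :=
  poly (signForms S x)

theorem gap_neg {n : ℕ} (c : (Fin n → ℤ) × ℝ) (x : Fin n → ℝ) : gap (-c) x = -gap c x := by
  simp [gap, intForm_neg]; ring

theorem mem_signCell {n : ℕ} {S : Finset ((Fin n → ℤ) × ℝ)} {x y : Fin n → ℝ} :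
    y ∈ signCell S x ↔
      ∀ c ∈ S, (0 ≤ gap c x → 0 ≤ gap c y) ∧ (gap c x ≤ 0 → gap c y ≤ 0) := by
  constructor
  · intro h c hc
    refine ⟨fun h0 => h c ?_, fun h0 => ?_⟩
    · exact Finset.mem_union_left _ (Finset.mem_filter.2 ⟨hc, h0⟩)
    · have := h (-c) (Finset.mem_union_right _
        (Finset.mem_image_of_mem _ (Finset.mem_filter.2 ⟨hc, h0⟩)))
      rw [gap_neg] at this
      linarith
  · intro h c hc
    rcases Finset.mem_union.1 hc with hc | hc
    · obtain ⟨h1, h2⟩ := Finset.mem_filter.1 hc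
      exact (h c h1).1 h2
    · obtain ⟨c, hc', rfl⟩ := Finset.mem_image.1 hc
      obtain ⟨h1, h2⟩ := Finset.mem_filter.1 hc'
      have := (h c h1).2 h2
      rw [gap_neg]
      linarith

theorem self_mem_signCell {n : ℕ} (S : Finset ((Fin n → ℤ) × ℝ)) (x : Fin n → ℝ) :
    x ∈ signCell S x := mem_signCell.2 fun _ _ => ⟨id, id⟩

theorem signCell_subset {n : ℕ} {S : Finset ((Fin n → ℤ) × ℝ)} {x y : Fin n → ℝ}
    (h : y ∈ signCell S x) : signCell S y ⊆ signCell S x := by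
  intro z hz
  rw [mem_signCell] at h hz ⊢
  intro c hc
  exact ⟨fun h0 => (hz c hc).1 ((h c hc).1 h0), fun h0 => (hz c hc).2 ((h c hc).2 h0)⟩

theorem signCell_subset_iff {n : ℕ} {S : Finset ((Fin n → ℤ) × ℝ)} {x y : Fin n → ℝ} :
    signCell S y ⊆ signCell S x ↔ y ∈ signCell S x :=
  ⟨fun h => h (self_mem_signCell S y), signCell_subset⟩

theorem isRationalPolyhedron_signCell {n : ℕ} (S : Finset ((Fin n → ℤ) × ℝ)) (x : Fin n → ℝ) :
    IsRationalPolyhedron (signCell S x) :=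
  isRationalPolyhedron_iff.2 ⟨⟨x, self_mem_signCell S x⟩, _, rfl⟩

theorem lineality_signCell {n : ℕ} {S : Finset ((Fin n → ℤ) × ℝ)} {x y : Fin n → ℝ}
    (h : y ∈ signCell S x) : lineality (signCell S x) y = kerAt S y := by
  rw [signCell, lineality_poly h]
  ext v
  simp only [mem_kerAt, signForms, Finset.mem_union, Finset.mem_filter, Finset.mem_image]
  constructor
  · intro hv c hc h0
    rcases le_total 0 (gap c x) with h1 | h1
    · exact hv c (Or.inl ⟨hc, h1⟩) h0
    · have := hv (-c) (Or.inr ⟨c, ⟨hc, h1⟩, rfl⟩) (by rw [gap_neg, h0, neg_zero])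
      simpa [intForm_neg] using this
  · rintro hv c (⟨hc, -⟩ | ⟨c, ⟨hc, -⟩, rfl⟩) h0
    · exact hv c hc h0
    · rw [gap_neg, neg_eq_zero] at h0
      simpa [intForm_neg] using hv c hc h0

theorem vectorSpan_signCell {n : ℕ} (S : Finset ((Fin n → ℤ) × ℝ)) (x : Fin n → ℝ) :
    vectorSpan ℝ (signCell S x) = kerAt S x := by
  apply le_antisymm
  · rw [vectorSpan_eq_span_vsub_set_right ℝ (self_mem_signCell S x), Submodule.span_le]
    rintro _ ⟨z, hz, rfl⟩ c hc h0
    have := mem_signCell.1 hz c hc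
    have h1 : gap c z = 0 := le_antisymm (this.2 h0.le) (this.1 h0.ge)
    simp [intForm_sub_eq_gap, h0, h1]
  · rw [← lineality_signCell (self_mem_signCell S x)]
    exact lineality_le_vectorSpan (self_mem_signCell S x)

theorem signCell_subset_poly {n : ℕ} {S T : Finset ((Fin n → ℤ) × ℝ)} (h : T ⊆ S)
    {x : Fin n → ℝ} (hx : x ∈ poly T) : signCell S x ⊆ poly T :=
  fun _ hy c hc => (mem_signCell.1 hy c (h hc)).1 (hx c hc)

/-- A convex set without sign conflicts that contains the closed cell of each of its points is
itself a closed cell. -/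
theorem exists_eq_signCell {n : ℕ} {S : Finset ((Fin n → ℤ) × ℝ)} {A : Set (Fin n → ℝ)}
    (hne : A.Nonempty) (hconv : Convex ℝ A) (hA : ∀ y ∈ A, signCell S y ⊆ A)
    (hs : ∀ c ∈ S, (∀ y ∈ A, 0 ≤ gap c y) ∨ (∀ y ∈ A, gap c y ≤ 0)) :
    ∃ y ∈ A, A = signCell S y := by
  -- a point with as few active inequalities as possible
  obtain ⟨y, hy, hmin⟩ : ∃ y ∈ A, ∀ z ∈ A, (S.filter fun c => gap c y = 0).card ≤
      (S.filter fun c => gap c z = 0).card := by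
    obtain ⟨y, hy, h⟩ := exists_minimalFor_of_wellFoundedLT (fun z => z ∈ A)
      (fun z => (S.filter fun c => gap c z = 0).card) hne
    exact ⟨y, hy, fun z hz => (le_total _ _).elim id (h hz)⟩
  refine ⟨y, hy, (hA y hy).antisymm' fun z hz => ?_⟩
  have hw : (1 / 2 : ℝ) • y + (1 / 2 : ℝ) • z ∈ A :=
    hconv hy hz (by norm_num) (by norm_num) (by norm_num)
  have hgap : ∀ c : (Fin n → ℤ) × ℝ, gap c ((1 / 2 : ℝ) • y + (1 / 2 : ℝ) • z)
      = (gap c y + gap c z) / 2 := fun c => by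
    simp only [gap, map_add, map_smul, smul_eq_mul]; ring
  have hsub : (S.filter fun c => gap c ((1 / 2 : ℝ) • y + (1 / 2 : ℝ) • z) = 0) ⊆
      S.filter fun c => gap c y = 0 := by
    intro c hc
    obtain ⟨hc, h0⟩ := Finset.mem_filter.1 hc
    refine Finset.mem_filter.2 ⟨hc, ?_⟩
    rw [hgap] at h0
    rcases hs c hc with h | h
    · linarith [h y hy, h z hz]
    · linarith [h y hy, h z hz]
  have heq := Finset.eq_of_subset_of_card_le hsub (hmin _ hw)
  have hz0 : ∀ c ∈ S, gap c y = 0 → gap c z = 0 := by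
    intro c hc h0
    have : c ∈ S.filter fun c => gap c y = 0 := Finset.mem_filter.2 ⟨hc, h0⟩
    rw [← heq] at this
    have := (Finset.mem_filter.1 this).2
    rw [hgap, h0] at this
    linarith
  refine mem_signCell.2 fun c hc => ⟨fun h => ?_, fun h => ?_⟩
  · rcases h.lt_or_eq with h | h
    · rcases hs c hc with h' | h'
      · exact h' z hz
      · linarith [h' y hy]
    · exact (hz0 c hc h.symm).ge
  · rcases h.lt_or_eq with h | h
    · rcases hs c hc with h' | h'
      · linarith [h' y hy]
      · exact h' z hz
    · exact (hz0 c hc h).le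

theorem exists_poly_eq_signCell {n : ℕ} {S : Finset ((Fin n → ℤ) × ℝ)} (h : (poly S).Nonempty) :
    ∃ y ∈ poly S, poly S = signCell S y :=
  exists_eq_signCell h (convex_poly S)
    (fun _ hy => signCell_subset_poly (Finset.Subset.refl S) hy)
    fun c hc => Or.inl fun _ hy => hy c hc

/-- The faces of a cell of a hyperplane arrangement are the cells contained in it. -/
theorem isFace_signCell_iff {n : ℕ} {S : Finset ((Fin n → ℤ) × ℝ)} {x : Fin n → ℝ}
    {τ : Set (Fin n → ℝ)} :
    IsFace τ (signCell S x) ↔ ∃ y ∈ signCell S x, τ = signCell S y := by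
  constructor
  · rintro ⟨hne, hexp⟩
    have hsub := hexp.subset
    obtain ⟨l, hl⟩ := hexp hne
    have hs : ∀ c ∈ S, (∀ y ∈ τ, 0 ≤ gap c y) ∨ (∀ y ∈ τ, gap c y ≤ 0) := by
      intro c hc
      rcases le_total 0 (gap c x) with h | h
      · exact Or.inl fun y hy => (mem_signCell.1 (hsub hy) c hc).1 h
      · exact Or.inr fun y hy => (mem_signCell.1 (hsub hy) c hc).2 h
    have hA : ∀ y ∈ τ, signCell S y ⊆ τ := by
      intro y hy z hz
      -- the functional cannot decrease from `y` to `z`, as one can also move the other way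
      have hzx := signCell_subset (hsub hy) hz
      rw [hl] at hy ⊢
      refine ⟨hzx, fun w hw => (hy.2 w hw).trans ?_⟩
      have hz' : z - y ∈ lineality (signCell S x) y := by
        rw [lineality_signCell hy.1, ← vectorSpan_signCell]
        exact vsub_mem_vectorSpan ℝ hz (self_mem_signCell S y)
      rw [lineality, signCell] at hz'
      have hv : z - y ∈ LinearMap.ker (l : (Fin n → ℝ) →ₗ[ℝ] ℝ) := by
        refine Submodule.span_le.2 ?_ hz'
        rintro v ⟨h1, h2⟩
        have a1 := hy.2 _ h1
        have a2 := hy.2 _ h2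
        simp only [map_add, map_sub] at a1 a2
        simp only [SetLike.mem_coe, LinearMap.mem_ker, ContinuousLinearMap.coe_coe]
        linarith
      have : l (z - y) = 0 := hv
      rw [map_sub] at this
      linarith
    obtain ⟨y, hy, h⟩ := exists_eq_signCell hne
      (hexp.convex (isRationalPolyhedron_signCell S x).convex) hA hs
    exact ⟨y, hsub hy, h⟩
  · rintro ⟨y, hy, rfl⟩
    refine ⟨⟨y, self_mem_signCell S y⟩, fun _ => ?_⟩
    -- minus the sum of all inequalities that become active at `y`
    let L : (Fin n → ℝ) →ₗ[ℝ] ℝ :=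
      -∑ c ∈ (signForms S x).filter (fun c => gap c y = 0), intForm c.1
    refine ⟨LinearMap.toContinuousLinearMap L, ?_⟩
    have hL : ∀ z, L z - L y =
        -∑ c ∈ (signForms S x).filter (fun c => gap c y = 0), gap c z := by
      intro z
      have : ∀ c ∈ (signForms S x).filter (fun c => gap c y = 0),
          gap c z = intForm c.1 z - intForm c.1 y := by
        intro c hc
        rw [← map_sub, intForm_sub_eq_gap, (Finset.mem_filter.1 hc).2, sub_zero]
      rw [Finset.sum_congr rfl this]
      simp [L, LinearMap.sum_apply]; ring
    have hpos : ∀ z ∈ signCell S x, ∀ c ∈ (signForms S x).filter (fun c => gap c y = 0),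
        0 ≤ gap c z := fun z hz c hc => hz c (Finset.mem_filter.1 hc).1
    ext z
    simp only [Set.mem_ofPred_eq, LinearMap.coe_toContinuousLinearMap']
    constructor
    · intro hz
      refine ⟨signCell_subset hy hz, fun w hw => ?_⟩
      have h1 : ∑ c ∈ (signForms S x).filter (fun c => gap c y = 0), gap c z = 0 := by
        refine Finset.sum_eq_zero fun c hc => ?_
        obtain ⟨hc, h0⟩ := Finset.mem_filter.1 hc
        rcases Finset.mem_union.1 hc with hc | hc
        · have := mem_signCell.1 hz c (Finset.mem_filter.1 hc).1
          exact le_antisymm (this.2 h0.le) (this.1 h0.ge)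
        · obtain ⟨c, hc', rfl⟩ := Finset.mem_image.1 hc
          have := mem_signCell.1 hz c (Finset.mem_filter.1 hc').1
          rw [gap_neg, neg_eq_zero] at *
          exact le_antisymm (this.2 h0.le) (this.1 h0.ge)
      have h2 := hL z
      have h3 := hL w
      have h4 := Finset.sum_nonneg (hpos w hw)
      linarith
    · rintro ⟨hz, hmax⟩
      have h2 := hL z
      have h4 := Finset.sum_nonneg (hpos z hz)
      have h0 : ∑ c ∈ (signForms S x).filter (fun c => gap c y = 0), gap c z = 0 := by
        have := hmax y hy
        linarith
      rw [Finset.sum_eq_zero_iff_of_nonneg (hpos z hz)] at h0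
      refine mem_signCell.2 fun c hc => ?_
      have hyc := mem_signCell.1 hy c hc
      have hzc := mem_signCell.1 hz c hc
      have key : gap c y = 0 → gap c z = 0 := by
        intro hy0
        rcases le_total 0 (gap c x) with h | h
        · exact h0 c (Finset.mem_filter.2 ⟨Finset.mem_union_left _
            (Finset.mem_filter.2 ⟨hc, h⟩), hy0⟩)
        · have := h0 (-c) (Finset.mem_filter.2 ⟨Finset.mem_union_right _
            (Finset.mem_image_of_mem _ (Finset.mem_filter.2 ⟨hc, h⟩)),
              by rw [gap_neg, hy0, neg_zero]⟩)
          rwa [gap_neg, neg_eq_zero] at this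
      constructor
      · intro h
        rcases le_total 0 (gap c x) with h' | h'
        · exact hzc.1 h'
        · exact (key (le_antisymm (hyc.2 h') h)).ge
      · intro h
        rcases le_total 0 (gap c x) with h' | h'
        · exact (key (le_antisymm h (hyc.1 h'))).le
        · exact hzc.2 h'

/-! ### Rational subspaces and primitive vectors -/

theorem castVec_zsmul {n : ℕ} (k : ℤ) (v : Fin n → ℤ) :
    castVec n (k • v) = (k : ℝ) • castVec n v := by
  ext i; simp [castVec]

theorem castVec_apply {n : ℕ} (v : Fin n → ℤ) (i : Fin n) : castVec n v i = (v i : ℝ) := rfl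

/-- The lattice of integral points of a linear subspace. -/
def lat {n : ℕ} (V : Submodule ℝ (Fin n → ℝ)) : AddSubgroup (Fin n → ℤ) :=
  V.toAddSubgroup.comap (castVec n)

theorem mem_lat {n : ℕ} {V : Submodule ℝ (Fin n → ℝ)} {v : Fin n → ℤ} :
    v ∈ lat V ↔ castVec n v ∈ V := Iff.rfl

theorem lat_mono {n : ℕ} {V W : Submodule ℝ (Fin n → ℝ)} (h : V ≤ W) : lat V ≤ lat W :=
  fun _ hv => h hv

/-- Clearing denominators of a rational vector. -/
theorem exists_int_eq_prod_den_mul {n : ℕ} (q : Fin n → ℚ) :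
    ∃ w : Fin n → ℤ, ∀ i, (w i : ℝ) = ((∏ j, (q j).den : ℕ) : ℝ) * ((q i : ℚ) : ℝ) := by
  have h : ∀ i, ∃ w : ℤ, (w : ℝ) = ((∏ j, (q j).den : ℕ) : ℝ) * ((q i : ℚ) : ℝ) := by
    intro i
    refine ⟨(∏ j ∈ Finset.univ.erase i, ((q j).den : ℤ)) * (q i).num, ?_⟩
    rw [← Finset.mul_prod_erase _ _ (Finset.mem_univ i)]
    have h3 : ((q i).den : ℝ) * ((q i : ℚ) : ℝ) = ((q i).num : ℝ) := by
      have := Rat.den_mul_eq_num (q i)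
      exact_mod_cast congrArg (fun r : ℚ => (r : ℝ)) this
    push_cast at h3 ⊢
    rw [← h3]; ring
  choose w hw using h
  exact ⟨w, hw⟩

/-- A subspace cut out by integral linear forms is spanned by its integral points: write the
coordinates of a point in a basis of `ℝ` over `ℚ`. -/
theorem le_span_lat {n : ℕ} {V : Submodule ℝ (Fin n → ℝ)} {A : Set (Fin n → ℤ)}
    (hV : ∀ v, v ∈ V ↔ ∀ a ∈ A, intForm a v = 0) :
    V ≤ Submodule.span ℝ (castVec n '' (lat V : Set (Fin n → ℤ))) := by
  intro v hv
  let b := Module.Basis.ofVectorSpace ℚ ℝ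
  -- the rational coefficient vectors of `v` satisfy the same integral equations as `v`
  let q : _ → Fin n → ℚ := fun j i => b.repr (v i) j
  have hq : ∀ j, (fun i => ((q j i : ℚ) : ℝ)) ∈ V := by
    intro j
    rw [hV]
    intro a ha
    have h0 := (hV v).1 hv a ha
    have h1 : b.repr (∑ i, (a i : ℝ) * v i) j = 0 := by
      rw [← intForm_apply, h0]; simp
    have h2 : ∑ i, (a i : ℝ) * v i = ∑ i, (a i : ℚ) • v i :=
      Finset.sum_congr rfl fun i _ => by rw [Rat.smul_def]; norm_cast
    rw [h2] at h1
    simp only [map_sum, map_smul, Finsupp.finsetSum_apply, Finsupp.smul_apply, smul_eq_mul] at h1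
    rw [intForm_apply]
    have := congrArg (fun r : ℚ => (r : ℝ)) h1
    push_cast at this
    exact this
  have hq' : ∀ j, (fun i => ((q j i : ℚ) : ℝ)) ∈
      Submodule.span ℝ (castVec n '' (lat V : Set (Fin n → ℤ))) := by
    intro j
    obtain ⟨w, hw⟩ := exists_int_eq_prod_den_mul (q j)
    set D : ℕ := ∏ i, (q j i).den with hD
    have hD0 : (D : ℝ) ≠ 0 := by
      exact_mod_cast (Finset.prod_pos fun i _ => (q j i).den_pos).ne'
    have hwD : castVec n w = (D : ℝ) • fun i => ((q j i : ℚ) : ℝ) := by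
      ext i; simpa [castVec_apply] using hw i
    have hwm : castVec n w ∈ Submodule.span ℝ (castVec n '' (lat V : Set (Fin n → ℤ))) := by
      refine Submodule.subset_span ⟨w, ?_, rfl⟩
      change castVec n w ∈ V
      rw [hwD]
      exact V.smul_mem _ (hq j)
    rw [hwD] at hwm
    simpa [smul_smul, hD0] using Submodule.smul_mem _ (D : ℝ)⁻¹ hwm
  have hsum : v = ∑ j ∈ Finset.univ.biUnion (fun i => (b.repr (v i)).support),
      b j • (fun i => ((q j i : ℚ) : ℝ)) := by
    ext i
    rw [Finset.sum_apply]
    conv_lhs => rw [← b.linearCombination_repr (v i)]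
    rw [Finsupp.linearCombination_apply, Finsupp.sum_of_support_subset (s := Finset.univ.biUnion
      (fun i => (b.repr (v i)).support)) _ (Finset.subset_biUnion_of_mem
        (fun i => (b.repr (v i)).support) (Finset.mem_univ i)) _ (by simp)]
    refine Finset.sum_congr rfl fun j _ => ?_
    simp [q, Rat.smul_def, mul_comm]
  rw [hsum]
  exact Submodule.sum_mem _ fun j _ => Submodule.smul_mem _ _ (hq' j)

theorem kerAt_le_span_lat {n : ℕ} (S : Finset ((Fin n → ℤ) × ℝ)) (x : Fin n → ℝ) :
    kerAt S x ≤ Submodule.span ℝ (castVec n '' (lat (kerAt S x) : Set (Fin n → ℤ))) :=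
  le_span_lat (A := {a | ∃ c ∈ S, gap c x = 0 ∧ c.1 = a}) fun v =>
    ⟨by rintro hv _ ⟨c, hc, h0, rfl⟩; exact hv c hc h0, fun hv c hc h0 => hv _ ⟨c, hc, h0, rfl⟩⟩

/-- The linear space of a rational polyhedron is spanned by its integral points. -/
theorem IsRationalPolyhedron.vectorSpan_le_span_lat {n : ℕ} {Q : Set (Fin n → ℝ)}
    (hQ : IsRationalPolyhedron Q) : vectorSpan ℝ Q ≤
      Submodule.span ℝ (castVec n '' (lat (vectorSpan ℝ Q) : Set (Fin n → ℤ))) := by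
  obtain ⟨y, hy⟩ := exists_mem_intrinsicInterior hQ
  obtain ⟨hy, h⟩ := (mem_intrinsicInterior_iff hQ).1 hy
  obtain ⟨-, S, rfl⟩ := isRationalPolyhedron_iff.1 hQ
  rw [← h, lineality_poly hy]
  exact kerAt_le_span_lat S y

/-- Near a point where the lineality space has codimension one, a polyhedron is a half-space of
its affine span. -/
theorem exists_facetForm {n : ℕ} {Q : Set (Fin n → ℝ)} (hQ : IsRationalPolyhedron Q)
    {y : Fin n → ℝ} (hy : y ∈ Q) (hd : Module.finrank ℝ (lineality Q y) + 1 = cellDim Q) :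
    ∃ a : Fin n → ℤ, (∀ v ∈ vectorSpan ℝ Q, v ∈ lineality Q y ↔ intForm a v = 0) ∧
      (∀ z ∈ Q, 0 ≤ intForm a (z - y)) ∧
      (∀ v ∈ vectorSpan ℝ Q, 0 ≤ intForm a v → ∀ᶠ s in 𝓝[>] (0 : ℝ), y + s • v ∈ Q) := by
  have hle := lineality_le_vectorSpan hy
  obtain ⟨-, S, rfl⟩ := isRationalPolyhedron_iff.1 hQ
  -- an inequality that is active at `y` and not constant on the polyhedron
  obtain ⟨c, hc, h0, v₀, hv₀, hcv⟩ : ∃ c ∈ S, gap c y = 0 ∧ ∃ v ∈ vectorSpan ℝ (poly S),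
      intForm c.1 v ≠ 0 := by
    by_contra! hcon
    have : vectorSpan ℝ (poly S) ≤ lineality (poly S) y := by
      rw [lineality_poly hy]
      exact fun v hv c hc h0 => hcon c hc h0 v hv
    have := Submodule.finrank_mono this
    unfold cellDim at hd
    omega
  have hiff : ∀ v ∈ vectorSpan ℝ (poly S), v ∈ lineality (poly S) y ↔ intForm c.1 v = 0 := by
    have h1 : lineality (poly S) y ≤ vectorSpan ℝ (poly S) ⊓ LinearMap.ker (intForm c.1) :=
      le_inf hle fun v hv => by
        rw [lineality_poly hy] at hv
        exact hv c hc h0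
    have h2 : vectorSpan ℝ (poly S) ⊓ LinearMap.ker (intForm c.1) < vectorSpan ℝ (poly S) :=
      lt_of_le_of_ne inf_le_left fun h => hcv (by
        rw [← h] at hv₀
        exact hv₀.2)
    have h3 := Submodule.finrank_lt_finrank_of_lt h2
    have h4 := Submodule.finrank_mono h1
    have h5 := Submodule.eq_of_le_of_finrank_eq h1 (by unfold cellDim at hd; omega)
    intro v hv
    rw [h5]
    exact ⟨fun h => h.2, fun h => ⟨hv, h⟩⟩
  have hnonneg : ∀ z ∈ poly S, 0 ≤ intForm c.1 (z - y) := fun z hz => by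
    rw [intForm_sub_eq_gap, h0, sub_zero]
    exact hz c hc
  refine ⟨c.1, hiff, hnonneg, fun v hv hv0 => ?_⟩
  -- modulo the lineality space, `v` is a non-negative multiple of `z - y` for a point `z` of `Q`
  obtain ⟨z, hz, hpos⟩ : ∃ z ∈ poly S, 0 < intForm c.1 (z - y) := by
    by_contra! hcon
    have : vectorSpan ℝ (poly S) ≤ LinearMap.ker (intForm c.1) := by
      rw [vectorSpan_eq_span_vsub_set_right ℝ hy, Submodule.span_le]
      rintro _ ⟨z, hz, rfl⟩
      exact le_antisymm (hcon z hz) (hnonneg z hz)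
    exact hcv (this hv₀)
  refine eventually_mem_poly hy fun c' hc' h0' => ?_
  set t := intForm c.1 v / intForm c.1 (z - y)
  have hl : v - t • (z - y) ∈ lineality (poly S) y := by
    have hm : v - t • (z - y) ∈ vectorSpan ℝ (poly S) :=
      Submodule.sub_mem _ hv (Submodule.smul_mem _ _ (vsub_mem_vectorSpan ℝ hz hy))
    rw [hiff _ hm, map_sub, map_smul, smul_eq_mul, div_mul_cancel₀ _ hpos.ne', sub_self]
  rw [lineality_poly hy] at hl
  have h6 := hl c' hc' h0'
  rw [map_sub, map_smul, smul_eq_mul, sub_eq_zero] at h6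
  rw [h6, intForm_sub_eq_gap, h0', sub_zero]
  exact mul_nonneg (div_nonneg hv0 hpos.le) (hz c' hc')

/-- `v` is a primitive integral vector of the polyhedron `Q` modulo its lineality space at the
point `y`, and points from `y` into `Q`. -/
def IsPrimAt {n : ℕ} (Q : Set (Fin n → ℝ)) (y : Fin n → ℝ) (v : Fin n → ℤ) : Prop :=
  v ∈ lat (vectorSpan ℝ Q) ∧
    (∀ w ∈ lat (vectorSpan ℝ Q), ∃ k : ℤ, w - k • v ∈ lat (lineality Q y)) ∧
    ∃ ε : ℝ, 0 < ε ∧ y + ε • castVec n v ∈ Q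

/-- A choice of a primitive vector of `Q` at `y`; it is unique modulo the lineality space when
that has codimension one. -/
def pv {n : ℕ} (Q : Set (Fin n → ℝ)) (y : Fin n → ℝ) : Fin n → ℤ :=
  Classical.epsilon (IsPrimAt Q y)

/-- A form as in `exists_facetForm` takes the lattice of `Q` to a cyclic subgroup of `ℤ`; a lattice
point over its non-negative generator is a primitive vector. -/
theorem exists_isPrimAt {n : ℕ} {Q : Set (Fin n → ℝ)} (hQ : IsRationalPolyhedron Q)
    {y : Fin n → ℝ} (hy : y ∈ Q) (hd : Module.finrank ℝ (lineality Q y) + 1 = cellDim Q) :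
    ∃ v, IsPrimAt Q y v := by
  obtain ⟨a, hiff, -, hdir⟩ := exists_facetForm hQ hy hd
  let α : (Fin n → ℤ) →+ ℤ :=
    { toFun := fun v => a ⬝ᵥ v, map_zero' := by simp, map_add' := by simp [dotProduct_add] }
  obtain ⟨g, hg⟩ := Int.subgroup_cyclic ((lat (vectorSpan ℝ Q)).map α)
  rw [← AddSubgroup.zmultiples_eq_closure] at hg
  have hmem : ∀ w ∈ lat (vectorSpan ℝ Q), ∃ k : ℤ, a ⬝ᵥ w = k * g := by
    intro w hw
    have : a ⬝ᵥ w ∈ AddSubgroup.zmultiples g := hg ▸ ⟨w, hw, rfl⟩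
    obtain ⟨k, hk⟩ := AddSubgroup.mem_zmultiples_iff.1 this
    exact ⟨k, by rw [← hk, smul_eq_mul]⟩
  obtain ⟨v, hv, hvg⟩ : g ∈ (lat (vectorSpan ℝ Q)).map α :=
    hg ▸ AddSubgroup.mem_zmultiples g
  change a ⬝ᵥ v = g at hvg
  have key : ∀ u ∈ lat (vectorSpan ℝ Q), 0 ≤ a ⬝ᵥ u →
      (∀ w ∈ lat (vectorSpan ℝ Q), ∃ k : ℤ, a ⬝ᵥ w = k * (a ⬝ᵥ u)) → IsPrimAt Q y u := by
    intro u hu hu0 hgen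
    refine ⟨hu, fun w hw => ?_, ?_⟩
    · obtain ⟨k, hk⟩ := hgen w hw
      refine ⟨k, ?_⟩
      have hm : w - k • u ∈ lat (vectorSpan ℝ Q) :=
        AddSubgroup.sub_mem _ hw (AddSubgroup.zsmul_mem _ hu k)
      rw [mem_lat, hiff _ hm, intForm_castVec, dotProduct_sub, dotProduct_smul, hk, smul_eq_mul,
        sub_self, Int.cast_zero]
    · have := hdir _ hu (by rw [intForm_castVec]; exact_mod_cast hu0)
      obtain ⟨s, h, hs⟩ := (this.and self_mem_nhdsWithin).exists
      exact ⟨s, hs, h⟩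
  rcases le_total 0 g with h | h
  · exact ⟨v, key v hv (hvg ▸ h) (by simpa [hvg] using hmem)⟩
  · refine ⟨-v, key (-v) (AddSubgroup.neg_mem _ hv) (by simp [hvg, h]) fun w hw => ?_⟩
    obtain ⟨k, hk⟩ := hmem w hw
    exact ⟨-k, by simp [hvg, hk]⟩

theorem pv_spec {n : ℕ} {Q : Set (Fin n → ℝ)} (hQ : IsRationalPolyhedron Q)
    {y : Fin n → ℝ} (hy : y ∈ Q) (hd : Module.finrank ℝ (lineality Q y) + 1 = cellDim Q) :
    IsPrimAt Q y (pv Q y) := Classical.epsilon_spec (exists_isPrimAt hQ hy hd)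

theorem IsPrimAt.notMem {n : ℕ} {Q : Set (Fin n → ℝ)} (hQ : IsRationalPolyhedron Q)
    {y : Fin n → ℝ} (hd : Module.finrank ℝ (lineality Q y) + 1 = cellDim Q)
    {v : Fin n → ℤ} (h : IsPrimAt Q y v) : castVec n v ∉ lineality Q y := by
  intro hv
  have : vectorSpan ℝ Q ≤ lineality Q y := by
    refine hQ.vectorSpan_le_span_lat.trans (Submodule.span_le.2 ?_)
    rintro _ ⟨w, hw, rfl⟩
    obtain ⟨k, hk⟩ := h.2.1 w hw
    have := (lat (lineality Q y)).add_mem hk ((lat (lineality Q y)).zsmul_mem hv k)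
    rw [sub_add_cancel] at this
    exact this
  have := Submodule.finrank_mono this
  unfold cellDim at hd
  omega

theorem IsPrimAt.pos {n : ℕ} {Q : Set (Fin n → ℝ)} (hQ : IsRationalPolyhedron Q)
    {y : Fin n → ℝ} (hd : Module.finrank ℝ (lineality Q y) + 1 = cellDim Q)
    {v : Fin n → ℤ} (h : IsPrimAt Q y v) {a : Fin n → ℤ}
    (hiff : ∀ v ∈ vectorSpan ℝ Q, v ∈ lineality Q y ↔ intForm a v = 0)
    (hpos : ∀ z ∈ Q, 0 ≤ intForm a (z - y)) : 0 < a ⬝ᵥ v := by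
  have h1 : intForm a (castVec n v) ≠ 0 := fun h0 => h.notMem hQ hd ((hiff _ h.1).2 h0)
  obtain ⟨ε, hε, hm⟩ := h.2.2
  have h2 := hpos _ hm
  rw [add_sub_cancel_left, map_smul, smul_eq_mul] at h2
  have h3 := lt_of_le_of_ne (nonneg_of_mul_nonneg_right h2 hε) h1.symm
  rw [intForm_castVec] at h3
  exact_mod_cast h3

theorem IsPrimAt.sub_mem {n : ℕ} {Q : Set (Fin n → ℝ)} (hQ : IsRationalPolyhedron Q)
    {y : Fin n → ℝ} (hy : y ∈ Q) (hd : Module.finrank ℝ (lineality Q y) + 1 = cellDim Q)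
    {v w : Fin n → ℤ} (hv : IsPrimAt Q y v) (hw : IsPrimAt Q y w) :
    v - w ∈ lat (lineality Q y) := by
  obtain ⟨a, hiff, hpos, -⟩ := exists_facetForm hQ hy hd
  have h1 := hv.pos hQ hd hiff hpos
  have h2 := hw.pos hQ hd hiff hpos
  -- each of two primitive vectors is a multiple of the other one modulo the lineality space
  have key : ∀ u u' : Fin n → ℤ, IsPrimAt Q y u → IsPrimAt Q y u' → 0 < a ⬝ᵥ u →
      0 < a ⬝ᵥ u' → a ⬝ᵥ u ≤ a ⬝ᵥ u' := by
    intro u u' hu hu' h h'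
    obtain ⟨k, hk⟩ := hu.2.1 u' hu'.1
    have := (hiff _ (AddSubgroup.sub_mem _ hu'.1 (AddSubgroup.zsmul_mem _ hu.1 k))).1 hk
    rw [intForm_castVec] at this
    have h3 : a ⬝ᵥ u' = k * (a ⬝ᵥ u) := by
      have : a ⬝ᵥ (u' - k • u) = 0 := by exact_mod_cast this
      rwa [dotProduct_sub, dotProduct_smul, smul_eq_mul, sub_eq_zero] at this
    exact Int.le_of_dvd h' ⟨k, by rw [h3]; ring⟩
  have heq := le_antisymm (key v w hv hw h1 h2) (key w v hw hv h2 h1)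
  rw [mem_lat, hiff _ (AddSubgroup.sub_mem _ hv.1 hw.1), intForm_castVec, dotProduct_sub, heq]
  simp

/-- Primitive vectors of a face only depend on the polyhedron near one point of the face. -/
theorem isPrimitiveVector_iff {n : ℕ} {τ σ : Set (Fin n → ℝ)} (hσ : IsRationalPolyhedron σ)
    {y : Fin n → ℝ} (hy : y ∈ τ) (hτσ : τ ⊆ σ) (h : vectorSpan ℝ τ = lineality σ y)
    {v : Fin n → ℤ} : IsPrimitiveVector τ σ v ↔ IsPrimAt σ y v := by
  unfold IsPrimitiveVector IsPrimAt
  refine and_congr Iff.rfl (and_congr ?_ ⟨?_, fun ⟨ε, hε, hm⟩ => ⟨y, hy, ε, hε, hm⟩⟩)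
  · rw [← h]; rfl
  · rintro ⟨p, hp, ε, hε, hm⟩
    obtain ⟨-, S, rfl⟩ := isRationalPolyhedron_iff.1 hσ
    have hpy : p - y ∈ lineality (poly S) y := h ▸ vsub_mem_vectorSpan ℝ hp hy
    rw [lineality_poly (hτσ hy)] at hpy
    have hgp : ∀ c ∈ S, gap c y = 0 → gap c p = 0 := fun c hc h0 => by
      have := hpy c hc h0
      rwa [intForm_sub_eq_gap, h0, sub_zero] at this
    have := eventually_mem_poly (v := castVec n v) (hτσ hy) fun c hc h0 =>
      intForm_nonneg_of_mem_poly hε hm c hc (hgp c hc h0)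
    obtain ⟨s, h, hs⟩ := (this.and self_mem_nhdsWithin).exists
    exact ⟨s, hs, h⟩

/-! ### Integral linear maps and lattice indices -/

/-- The linear part of an integer affine map, on `ℝᵐ`. -/
def IntAffineMap.linMap {m n : ℕ} (f : IntAffineMap m n) : (Fin m → ℝ) →ₗ[ℝ] (Fin n → ℝ) :=
  (f.lin.map (Int.cast : ℤ → ℝ)).mulVecLin

theorem IntAffineMap.linMap_apply {m n : ℕ} (f : IntAffineMap m n) (x : Fin m → ℝ) (i : Fin n) :
    f.linMap x i = ∑ j, (f.lin i j : ℝ) * x j := by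
  simp [IntAffineMap.linMap, Matrix.mulVec, dotProduct]

theorem IntAffineMap.toFun_eq {m n : ℕ} (f : IntAffineMap m n) (x : Fin m → ℝ) :
    f.toFun x = f.linMap x + f.trans := by
  ext i; simp [IntAffineMap.toFun, f.linMap_apply]

theorem IntAffineMap.toFun_add {m n : ℕ} (f : IntAffineMap m n) (x v : Fin m → ℝ) :
    f.toFun (x + v) = f.toFun x + f.linMap v := by
  rw [f.toFun_eq, f.toFun_eq, map_add]; abel

theorem IntAffineMap.toFun_sub_toFun {m n : ℕ} (f : IntAffineMap m n) (x y : Fin m → ℝ) :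
    f.toFun x - f.toFun y = f.linMap (x - y) := by
  rw [f.toFun_eq, f.toFun_eq, map_sub]; abel

theorem IntAffineMap.linMap_castVec {m n : ℕ} (f : IntAffineMap m n) (v : Fin m → ℤ) :
    f.linMap (castVec m v) = castVec n (f.lin.mulVec v) := by
  ext i; simp [f.linMap_apply, castVec_apply, Matrix.mulVec, dotProduct]

theorem IntAffineMap.vectorSpan_image {m n : ℕ} (f : IntAffineMap m n) (Q : Set (Fin m → ℝ)) :
    vectorSpan ℝ (f.toFun '' Q) = (vectorSpan ℝ Q).map f.linMap := by
  let g : (Fin m → ℝ) →ᵃ[ℝ] (Fin n → ℝ) :=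
    { toFun := f.toFun, linear := f.linMap,
      map_vadd' := fun p v => by simp only [vadd_eq_add, add_comm v p, f.toFun_add, add_comm] }
  exact (AffineMap.map_vectorSpan g).symm

/-- The index of the image of the lattice of `V` in the lattice of the image of `V`. -/
def IntAffineMap.idx {m n : ℕ} (f : IntAffineMap m n) (V : Submodule ℝ (Fin m → ℝ)) : ℕ :=
  ((lat V).map f.lin.mulVecLin.toAddMonoidHom).relIndex (lat (V.map f.linMap))

theorem IntAffineMap.latticeIndex_eq {m n : ℕ} (f : IntAffineMap m n) (σ : Set (Fin m → ℝ)) :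
    f.latticeIndex σ = f.idx (vectorSpan ℝ σ) := by
  unfold IntAffineMap.latticeIndex IntAffineMap.idx
  rw [← f.vectorSpan_image]
  rfl

/-- The index of lattices is multiplicative for the kernel and the image of an integral
functional. -/
theorem relIndex_eq_mul_of_le {G : Type*} [AddCommGroup G] {A B : AddSubgroup G} (h : B ≤ A)
    (α : G →+ ℤ) :
    B.relIndex A = (B ⊓ α.ker).relIndex (A ⊓ α.ker) * (B.map α).relIndex (A.map α) := by
  have h1 := AddSubgroup.relIndex_mul_relIndex B (B ⊔ (α.ker ⊓ A)) A le_sup_left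
    (sup_le h inf_le_right)
  have h2 : B.relIndex (B ⊔ (α.ker ⊓ A)) = (B ⊓ α.ker).relIndex (A ⊓ α.ker) := by
    rw [AddSubgroup.relIndex_sup_left, ← AddSubgroup.inf_relIndex_right]
    congr 1
    · rw [inf_comm α.ker A, ← inf_assoc, inf_eq_left.2 h]
    · rw [inf_comm]
  have h3 : (B ⊔ (α.ker ⊓ A)).relIndex A = (B.map α).relIndex (A.map α) := by
    rw [AddSubgroup.relIndex_map_map]
    have h4 : (B ⊔ α.ker) ⊓ A = B ⊔ (α.ker ⊓ A) := sup_inf_assoc_of_le _ h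
    have : A ⊔ α.ker = A ⊔ (B ⊔ α.ker) := by rw [← sup_assoc, sup_eq_left.2 h]
    rw [this, AddSubgroup.relIndex_sup_right, ← h4, AddSubgroup.inf_relIndex_right]
  rw [← h1, h2, h3]

theorem relIndex_zmultiples_mul (c g : ℤ) (hg : g ≠ 0) :
    (AddSubgroup.zmultiples (c * g)).relIndex (AddSubgroup.zmultiples g) = c.natAbs := by
  let μ : ℤ →+ ℤ := AddMonoidHom.mulRight g
  have hμ : Function.Injective μ := fun a b h => mul_right_cancel₀ hg h
  have h1 : AddSubgroup.zmultiples (c * g) = (AddSubgroup.zmultiples c).map μ := by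
    rw [AddMonoidHom.map_zmultiples]; rfl
  have h2 : AddSubgroup.zmultiples g = (⊤ : AddSubgroup ℤ).map μ := by
    have : (⊤ : AddSubgroup ℤ) = AddSubgroup.zmultiples 1 := by
      ext x; simp
    rw [this, AddMonoidHom.map_zmultiples]; simp [μ]
  rw [h1, h2, AddSubgroup.relIndex_map_map_of_injective _ _ hμ, AddSubgroup.relIndex_top_right,
    Int.index_zmultiples]

/-- The comparison of lattice indices in codimension one: if `v` generates the lattice of `V`
modulo `L`, and `v'` that of the image of `V` modulo the image of `L`, then
`[Λ_{fV} : fΛ_V] v' ≡ [Λ_{fL} : fΛ_L] f(v)`. -/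
theorem IntAffineMap.idx_smul_sub_mem {m n : ℕ} (f : IntAffineMap m n)
    {L V : Submodule ℝ (Fin m → ℝ)} (hLV : L ≤ V) (hinj : ∀ x ∈ V, f.linMap x = 0 → x = 0)
    {v : Fin m → ℤ} (hv : v ∈ lat V) (hgen : ∀ w ∈ lat V, ∃ k : ℤ, w - k • v ∈ lat L)
    {v' : Fin n → ℤ} (hv' : v' ∈ lat (V.map f.linMap))
    (hgen' : ∀ w ∈ lat (V.map f.linMap), ∃ k : ℤ, w - k • v' ∈ lat (L.map f.linMap))
    {b : Fin n → ℤ} (hb : ∀ x ∈ V.map f.linMap, x ∈ L.map f.linMap ↔ intForm b x = 0)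
    (h1 : 0 < b ⬝ᵥ v') (h2 : 0 < b ⬝ᵥ (f.lin.mulVec v)) :
    (f.idx V : ℤ) • v' - (f.idx L : ℤ) • f.lin.mulVec v ∈ lat (L.map f.linMap) := by
  have hfmem : ∀ w ∈ lat V, f.lin.mulVec w ∈ lat (V.map f.linMap) := fun w hw =>
    ⟨castVec m w, hw, f.linMap_castVec w⟩
  have hfL : ∀ w ∈ lat L, f.lin.mulVec w ∈ lat (L.map f.linMap) := fun w hw =>
    ⟨castVec m w, hw, f.linMap_castVec w⟩
  let β : (Fin n → ℤ) →+ ℤ :=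
    { toFun := fun v => b ⬝ᵥ v, map_zero' := by simp, map_add' := by simp [dotProduct_add] }
  have hβ : ∀ w ∈ lat (V.map f.linMap), w ∈ lat (L.map f.linMap) ↔ b ⬝ᵥ w = 0 := by
    intro w hw
    rw [mem_lat, hb _ hw, intForm_castVec]
    exact Int.cast_eq_zero
  -- the index on the quotients by `L` is the factor `c` with `f(v) ≡ c v'`
  obtain ⟨c, hc⟩ := hgen' _ (hfmem v hv)
  have hcb : b ⬝ᵥ (f.lin.mulVec v) = c * (b ⬝ᵥ v') := by
    have := (hβ _ (AddSubgroup.sub_mem _ (hfmem v hv) (AddSubgroup.zsmul_mem _ hv' c))).1 hc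
    rwa [dotProduct_sub, dotProduct_smul, smul_eq_mul, sub_eq_zero] at this
  have hc0 : 0 < c := by
    rw [hcb] at h2
    exact pos_of_mul_pos_left h2 h1.le
  set A := lat (V.map f.linMap) with hA
  set B := (lat V).map f.lin.mulVecLin.toAddMonoidHom with hB
  have hBA : B ≤ A := by
    rintro _ ⟨w, hw, rfl⟩
    exact hfmem w hw
  have hA0 : A ⊓ β.ker = lat (L.map f.linMap) := by
    ext w
    constructor
    · rintro ⟨h, h'⟩
      exact (hβ w h).2 h'
    · intro h
      have : w ∈ A := lat_mono (Submodule.map_mono hLV) h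
      exact ⟨this, (hβ w this).1 h⟩
  have hB0 : B ⊓ β.ker = (lat L).map f.lin.mulVecLin.toAddMonoidHom := by
    ext u
    constructor
    · rintro ⟨⟨w, hw, rfl⟩, h'⟩
      refine ⟨w, ?_, rfl⟩
      obtain ⟨l, hl, hlw⟩ := (hβ _ (hfmem w hw)).2 h'
      rw [← f.linMap_castVec] at hlw
      have : l - castVec m w = 0 := hinj _ (V.sub_mem (hLV hl) hw) (by rw [map_sub, hlw, sub_self])
      rw [sub_eq_zero] at this
      rw [this] at hl
      exact hl
    · rintro ⟨w, hw, rfl⟩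
      exact ⟨⟨w, lat_mono hLV hw, rfl⟩,
        (hβ _ (hfmem w (lat_mono hLV hw))).1 (hfL w hw)⟩
  have hAβ : A.map β = AddSubgroup.zmultiples (b ⬝ᵥ v') := by
    ext t
    rw [AddSubgroup.mem_zmultiples_iff]
    constructor
    · rintro ⟨w, hw, rfl⟩
      obtain ⟨k, hk⟩ := hgen' w hw
      have := (hβ _ (AddSubgroup.sub_mem _ hw (AddSubgroup.zsmul_mem _ hv' k))).1 hk
      rw [dotProduct_sub, dotProduct_smul, sub_eq_zero] at this
      exact ⟨k, this.symm⟩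
    · rintro ⟨k, rfl⟩
      exact ⟨k • v', AddSubgroup.zsmul_mem _ hv' k, dotProduct_smul k b v'⟩
  have hBβ : B.map β = AddSubgroup.zmultiples (c * (b ⬝ᵥ v')) := by
    ext t
    rw [AddSubgroup.mem_zmultiples_iff, ← hcb]
    constructor
    · rintro ⟨_, ⟨w, hw, rfl⟩, rfl⟩
      obtain ⟨k, hk⟩ := hgen w hw
      have hm := hfL _ hk
      have := (hβ _ (lat_mono (Submodule.map_mono hLV) hm)).1 hm
      rw [Matrix.mulVec_sub, Matrix.mulVec_smul, dotProduct_sub, dotProduct_smul,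
        sub_eq_zero] at this
      exact ⟨k, this.symm⟩
    · rintro ⟨k, rfl⟩
      refine ⟨f.lin.mulVec (k • v), ⟨k • v, AddSubgroup.zsmul_mem _ hv k, rfl⟩, ?_⟩
      change b ⬝ᵥ f.lin.mulVec (k • v) = _
      rw [Matrix.mulVec_smul, dotProduct_smul]
  have hidx : f.idx V = f.idx L * c.natAbs := by
    have := relIndex_eq_mul_of_le hBA β
    rw [hA0, hB0, hAβ, hBβ, relIndex_zmultiples_mul _ _ h1.ne'] at this
    exact this
  have hcc : ((c.natAbs : ℕ) : ℤ) = c := Int.natAbs_of_nonneg hc0.le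
  have hfin : (f.idx V : ℤ) • v' - (f.idx L : ℤ) • f.lin.mulVec v
      = -((f.idx L : ℤ) • (f.lin.mulVec v - c • v')) := by
    rw [hidx, Nat.cast_mul, hcc, mul_smul, smul_sub]; abel
  rw [hfin]
  exact AddSubgroup.neg_mem _ (AddSubgroup.zsmul_mem _ hc _)

/-! ### Images of polyhedra -/

/-- Affine inequalities with rational linear parts define a rational polyhedron, if it is not
empty. -/
theorem exists_poly_of_rat {N : ℕ} {J : Type} [Fintype J] (q : J → Fin N → ℚ) (r : J → ℝ) :
    ∃ S, poly S = {y : Fin N → ℝ | ∀ j, 0 ≤ ∑ i, ((q j i : ℚ) : ℝ) * y i + r j} := by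
  let D : J → ℕ := fun j => ∏ i, (q j i).den
  have hD : ∀ j, 0 < D j := fun j => Finset.prod_pos fun i _ => (q j i).den_pos
  choose w hw using fun j => exists_int_eq_prod_den_mul (q j)
  refine ⟨Finset.univ.image fun j => (w j, -(D j * r j)), ?_⟩
  ext y
  simp only [poly, Finset.mem_image, Finset.mem_univ, true_and, forall_exists_index,
    forall_apply_eq_imp_iff, Set.mem_ofPred_eq]
  refine forall_congr' fun j => ?_
  have : gap (w j, -(D j * r j)) y = D j * (∑ i, ((q j i : ℚ) : ℝ) * y i + r j) := by
    simp only [gap, intForm_apply, hw, mul_add, Finset.mul_sum, mul_assoc, D]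
    ring
  rw [this]
  exact ⟨fun h => nonneg_of_mul_nonneg_right h (by exact_mod_cast hD j),
    fun h => mul_nonneg (by positivity) h⟩

/-- An integral linear map that is injective on a subspace spanned by integral points has a
rational left inverse there. -/
theorem IntAffineMap.exists_rat_leftInverse {m n : ℕ} (f : IntAffineMap m n)
    {V : Submodule ℝ (Fin m → ℝ)}
    (hV : V ≤ Submodule.span ℝ (castVec m '' (lat V : Set (Fin m → ℤ))))
    (hinj : ∀ x ∈ V, f.linMap x = 0 → x = 0) :
    ∃ H : Matrix (Fin m) (Fin n) ℚ,
      ∀ v ∈ V, (H.map (Rat.cast : ℚ → ℝ)).mulVec (f.linMap v) = v := by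
  let c : (Fin m → ℚ) →ₗ[ℚ] (Fin m → ℝ) :=
    { toFun := fun q i => (q i : ℝ), map_add' := fun a b => by ext; simp,
      map_smul' := fun r a => by ext; simp [Rat.smul_def] }
  let U : Submodule ℚ (Fin m → ℚ) := (V.restrictScalars ℚ).comap c
  let g : (Fin m → ℚ) →ₗ[ℚ] (Fin n → ℚ) := (f.lin.map (Int.cast : ℤ → ℚ)).mulVecLin
  have hg : ∀ q : Fin m → ℚ, f.linMap (c q) = fun i => ((g q i : ℚ) : ℝ) := by
    intro q
    ext i
    simp [f.linMap_apply, c, g, Matrix.mulVec, dotProduct]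
  have hker : (g ∘ₗ U.subtype).ker = ⊥ := by
    rw [LinearMap.ker_eq_bot']
    rintro ⟨q, hq⟩ h0
    have h0' : g q = 0 := h0
    have : c q = 0 := hinj _ hq (by rw [hg, h0']; ext; simp)
    ext i
    have := congrFun this i
    simpa [c] using this
  obtain ⟨h, hh⟩ := LinearMap.exists_leftInverse_of_injective _ hker
  refine ⟨LinearMap.toMatrix' (U.subtype ∘ₗ h), fun v hv => ?_⟩
  have hlin : ∀ w ∈ lat V, ((LinearMap.toMatrix' (U.subtype ∘ₗ h)).map
      (Rat.cast : ℚ → ℝ)).mulVec (f.linMap (castVec m w)) = castVec m w := by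
    intro w hw
    have hcw : castVec m w = c (fun i => (w i : ℚ)) := by ext i; simp [c, castVec_apply]
    have hwU : (fun i => (w i : ℚ)) ∈ U := by
      change c _ ∈ V
      rw [← hcw]; exact hw
    have h1 := LinearMap.congr_fun hh ⟨_, hwU⟩
    have h2 : (LinearMap.toMatrix' (U.subtype ∘ₗ h)).mulVec (g (fun i => (w i : ℚ)))
        = fun i => (w i : ℚ) := by
      rw [LinearMap.toMatrix'_mulVec]
      exact congrArg Subtype.val h1
    rw [hcw, hg]
    ext i
    have := congrArg (fun r : ℚ => (r : ℝ)) (congrFun h2 i)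
    simp only [Matrix.mulVec, dotProduct] at this
    push_cast at this
    simpa [Matrix.mulVec, dotProduct, c] using this
  have hle : Submodule.span ℝ (castVec m '' (lat V : Set (Fin m → ℤ))) ≤
      LinearMap.eqLocus (((LinearMap.toMatrix' (U.subtype ∘ₗ h)).map
        (Rat.cast : ℚ → ℝ)).mulVecLin ∘ₗ f.linMap) LinearMap.id := by
    rw [Submodule.span_le]
    rintro _ ⟨w, hw, rfl⟩
    exact hlin w hw
  exact hle (hV hv)

theorem IntAffineMap.eq_of_toFun_eq {m n : ℕ} {f : IntAffineMap m n} {Q : Set (Fin m → ℝ)}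
    (hinj : ∀ x ∈ vectorSpan ℝ Q, f.linMap x = 0 → x = 0) {x y : Fin m → ℝ} (hx : x ∈ Q)
    (hy : y ∈ Q) (h : f.toFun x = f.toFun y) : x = y := by
  have := hinj _ (vsub_mem_vectorSpan ℝ hx hy)
    (by rw [vsub_eq_sub, ← f.toFun_sub_toFun, h, sub_self])
  exact sub_eq_zero.1 this

/-- Injective images of rational polyhedra are rational polyhedra: pull the inequalities back along a
rational left inverse, and add the equations of the affine span of the image. -/
theorem IsRationalPolyhedron.image {m n : ℕ} {f : IntAffineMap m n} {Q : Set (Fin m → ℝ)}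
    (hQ : IsRationalPolyhedron Q) (hinj : ∀ x ∈ vectorSpan ℝ Q, f.linMap x = 0 → x = 0) :
    IsRationalPolyhedron (f.toFun '' Q) := by
  obtain ⟨H, hH⟩ := f.exists_rat_leftInverse hQ.vectorSpan_le_span_lat hinj
  obtain ⟨⟨x₀, hx₀⟩, S, hS⟩ := isRationalPolyhedron_iff.1 hQ
  set HR := (H.map (Rat.cast : ℚ → ℝ)).mulVecLin with hHR
  -- an affine left inverse of `f` on `Q`
  let g : (Fin n → ℝ) → (Fin m → ℝ) := fun y => x₀ + HR (y - f.toFun x₀)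
  have hgf : ∀ x ∈ Q, g (f.toFun x) = x := by
    intro x hx
    simp only [g, f.toFun_sub_toFun, hHR, Matrix.mulVecLin_apply]
    rw [← vsub_eq_sub x, hH _ (vsub_mem_vectorSpan ℝ hx hx₀), vsub_eq_sub, add_sub_cancel]
  have himg : f.toFun '' Q = {y | g y ∈ Q ∧ f.toFun (g y) = y} := by
    ext y
    constructor
    · rintro ⟨x, hx, rfl⟩
      exact ⟨by rw [hgf x hx]; exact hx, by rw [hgf x hx]⟩
    · rintro ⟨h1, h2⟩
      exact ⟨g y, h1, h2⟩
  refine isRationalPolyhedron_iff.2 ⟨⟨_, x₀, hx₀, rfl⟩, ?_⟩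
  let q₁ : S → Fin n → ℚ := fun c i => ∑ j, (c.1.1 j : ℚ) * H j i
  let M : Matrix (Fin n) (Fin n) ℚ := f.lin.map (Int.cast : ℤ → ℚ) * H - 1
  obtain ⟨T, hT⟩ := exists_poly_of_rat (J := S ⊕ (Fin n ⊕ Fin n))
    (Sum.elim q₁ (Sum.elim (fun i => M i) (fun i => -M i)))
    (Sum.elim (fun c => gap c.1 (g 0))
      (Sum.elim (fun i => f.toFun (g 0) i) (fun i => -f.toFun (g 0) i)))
  refine ⟨T, ?_⟩
  have hgy : ∀ y, g y = g 0 + HR y := by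
    intro y; simp only [g, map_sub, map_zero]; abel
  have e1 : ∀ (c : S) y, gap c.1 (g y) = ∑ i, ((q₁ c i : ℚ) : ℝ) * y i + gap c.1 (g 0) := by
    intro c y
    rw [hgy, gap_add, add_comm, intForm_apply]
    congr 1
    simp only [hHR, Matrix.mulVecLin_apply, Matrix.mulVec, dotProduct, Matrix.map_apply, q₁]
    push_cast
    simp only [Finset.mul_sum, Finset.sum_mul]
    rw [Finset.sum_comm]
    exact Finset.sum_congr rfl fun i _ => Finset.sum_congr rfl fun j _ => by ring
  have e2 : ∀ (i : Fin n) y, f.toFun (g y) i - y i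
      = ∑ j, ((M i j : ℚ) : ℝ) * y j + f.toFun (g 0) i := by
    intro i y
    rw [hgy, f.toFun_add, Pi.add_apply, add_comm (f.toFun _ _), add_sub_right_comm]
    congr 1
    have : f.linMap (HR y) = ((f.lin.map (Int.cast : ℤ → ℝ)) *
        (H.map (Rat.cast : ℚ → ℝ))).mulVec y := by
      rw [← Matrix.mulVec_mulVec]; rfl
    rw [this]
    have hy : y i = ∑ j, (1 : Matrix (Fin n) (Fin n) ℝ) i j * y j := by
      simp [Matrix.one_apply]
    conv_lhs => rw [hy]
    simp only [Matrix.mulVec, dotProduct]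
    rw [← Finset.sum_sub_distrib]
    refine Finset.sum_congr rfl fun j _ => ?_
    rw [← sub_mul]
    congr 1
    simp only [M, Matrix.sub_apply, Matrix.mul_apply, Matrix.map_apply, Matrix.one_apply]
    push_cast
    split_ifs <;> simp
  rw [himg, hT]
  ext y
  simp only [Set.mem_ofPred_eq, Sum.forall, Sum.elim_inl, Sum.elim_inr, ← e1, ← e2,
    Pi.neg_apply, Rat.cast_neg, neg_mul, Finset.sum_neg_distrib, ← neg_add]
  refine and_congr ?_ ?_
  · rw [hS]; exact ⟨fun h c => h c.1 c.2, fun h c hc => h ⟨c, hc⟩⟩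
  · constructor
    · intro h; simp [h]
    · rintro ⟨h1, h2⟩
      ext i
      linarith [h1 i, h2 i]

theorem IntAffineMap.lineality_image {m n : ℕ} {f : IntAffineMap m n} {Q : Set (Fin m → ℝ)}
    (hinj : ∀ x ∈ vectorSpan ℝ Q, f.linMap x = 0 → x = 0) {y : Fin m → ℝ} (hy : y ∈ Q) :
    lineality (f.toFun '' Q) (f.toFun y) = (lineality Q y).map f.linMap := by
  rw [lineality, lineality, Submodule.map_span]
  congr 1
  ext v
  constructor
  · rintro ⟨⟨a, ha, h1⟩, ⟨b, hb, h2⟩⟩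
    refine ⟨a - y, ⟨by simpa using ha, ?_⟩, by rw [← f.toFun_sub_toFun, h1]; abel⟩
    have : f.linMap ((a - y) + (b - y)) = 0 := by
      rw [map_add, ← f.toFun_sub_toFun, ← f.toFun_sub_toFun, h1, h2]; abel
    have := hinj _ (Submodule.add_mem _ (vsub_mem_vectorSpan ℝ ha hy)
      (vsub_mem_vectorSpan ℝ hb hy)) this
    have h3 : y - (a - y) = b := by
      rw [sub_eq_iff_eq_add, eq_comm, ← sub_eq_zero, ← this]; simp only [vsub_eq_sub]; abel
    rw [h3]; exact hb
  · rintro ⟨w, ⟨h1, h2⟩, rfl⟩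
    refine ⟨⟨_, h1, f.toFun_add _ _⟩, ⟨_, h2, ?_⟩⟩
    rw [sub_eq_add_neg, f.toFun_add, map_neg, ← sub_eq_add_neg]

theorem finrank_map_eq_iff {m n : ℕ} (g : (Fin m → ℝ) →ₗ[ℝ] (Fin n → ℝ))
    (V : Submodule ℝ (Fin m → ℝ)) :
    Module.finrank ℝ (V.map g) = Module.finrank ℝ V ↔ ∀ x ∈ V, g x = 0 → x = 0 := by
  have h := LinearMap.finrank_range_add_finrank_ker (g.domRestrict V)
  rw [LinearMap.range_domRestrict] at h
  have h2 : Module.finrank ℝ (V.map g) = Module.finrank ℝ V ↔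
      Module.finrank ℝ (g.domRestrict V).ker = 0 := by omega
  rw [h2, Submodule.finrank_eq_zero, LinearMap.ker_eq_bot']
  simp [Submodule.mk_eq_zero]

theorem IntAffineMap.cellDim_image_eq_iff {m n : ℕ} (f : IntAffineMap m n)
    (Q : Set (Fin m → ℝ)) : cellDim (f.toFun '' Q) = cellDim Q ↔
      ∀ x ∈ vectorSpan ℝ Q, f.linMap x = 0 → x = 0 := by
  unfold cellDim
  rw [f.vectorSpan_image, finrank_map_eq_iff]

theorem IntAffineMap.mem_intrinsicInterior_image {m n : ℕ} {f : IntAffineMap m n}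
    {Q : Set (Fin m → ℝ)} (hQ : IsRationalPolyhedron Q)
    (hinj : ∀ x ∈ vectorSpan ℝ Q, f.linMap x = 0 → x = 0) {y : Fin n → ℝ} :
    y ∈ intrinsicInterior ℝ (f.toFun '' Q) ↔
      ∃ x ∈ intrinsicInterior ℝ Q, f.toFun x = y := by
  rw [mem_intrinsicInterior_iff (hQ.image hinj)]
  have key : ∀ x ∈ Q, (lineality (f.toFun '' Q) (f.toFun x) = vectorSpan ℝ (f.toFun '' Q) ↔
      lineality Q x = vectorSpan ℝ Q) := by
    intro x hx
    rw [IntAffineMap.lineality_image hinj hx, f.vectorSpan_image]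
    refine ⟨fun h => (lineality_le_vectorSpan hx).antisymm fun v hv => ?_, fun h => by rw [h]⟩
    obtain ⟨w, hw, hwv⟩ : f.linMap v ∈ (lineality Q x).map f.linMap := h ▸ ⟨v, hv, rfl⟩
    have := hinj _ (Submodule.sub_mem _ (lineality_le_vectorSpan hx hw) hv)
      (by rw [map_sub, hwv, sub_self])
    rw [← sub_eq_zero.1 this]; exact hw
  constructor
  · rintro ⟨⟨x, hx, rfl⟩, h⟩
    exact ⟨x, (mem_intrinsicInterior_iff hQ).2 ⟨hx, (key x hx).1 h⟩, rfl⟩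
  · rintro ⟨x, hx, rfl⟩
    obtain ⟨hx, h⟩ := (mem_intrinsicInterior_iff hQ).1 hx
    exact ⟨⟨x, hx, rfl⟩, (key x hx).2 h⟩

/-! ### Generic points -/

/-- A finite union of affine subspaces of dimension less than that of `V` does not contain a
neighbourhood of `x` in `x + V`. -/
theorem exists_generic {n : ℕ} (V : Submodule ℝ (Fin n → ℝ)) (x : Fin n → ℝ)
    (T : Finset (AffineSubspace ℝ (Fin n → ℝ)))
    (hT : ∀ H ∈ T, Module.finrank ℝ H.direction < Module.finrank ℝ V)
    {U : Set (Fin n → ℝ)} (hU : U ∈ 𝓝 x) : ∃ v ∈ V, x + v ∈ U ∧ ∀ H ∈ T, x + v ∉ H := by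
  let g : V → (Fin n → ℝ) := fun v => x + v
  have hg : Continuous g := by fun_prop
  have hint : interior (⋃ H ∈ T, g ⁻¹' (H : Set (Fin n → ℝ))) = ∅ := by
    have : ∀ s : Finset (AffineSubspace ℝ (Fin n → ℝ)), s ⊆ T →
        IsClosed (⋃ H ∈ s, g ⁻¹' (H : Set (Fin n → ℝ))) ∧
        interior (⋃ H ∈ s, g ⁻¹' (H : Set (Fin n → ℝ))) = ∅ := by
      intro s
      induction s using Finset.induction_on with
      | empty => intro _; simp
      | insert H s _ ih =>
        intro hs
        obtain ⟨h1, h2⟩ := ih ((Finset.subset_insert _ _).trans hs)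
        have hH : IsClosed (g ⁻¹' (H : Set (Fin n → ℝ))) :=
          (AffineSubspace.closed_of_finiteDimensional H).preimage hg
        rw [Finset.set_biUnion_insert]
        refine ⟨hH.union h1, ?_⟩
        rw [interior_union_isClosed_of_interior_empty hH h2]
        by_contra hne
        obtain ⟨v, hv⟩ := Set.nonempty_iff_ne_empty.2 hne
        have hle : V ≤ H.direction := by
          intro w hw
          have hc : Continuous fun s : ℝ => v + s • (⟨w, hw⟩ : V) := by fun_prop
          have hev : ∀ᶠ s in 𝓝[>] (0 : ℝ), v + s • (⟨w, hw⟩ : V) ∈ g ⁻¹' (H : Set _) :=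
            nhdsWithin_le_nhds (hc.continuousAt.preimage_mem_nhds
              (by simpa using mem_interior_iff_mem_nhds.1 hv))
          obtain ⟨s, h, hs⟩ := (hev.and self_mem_nhdsWithin).exists
          have h0 : v ∈ g ⁻¹' (H : Set _) := interior_subset hv
          have := AffineSubspace.vsub_mem_direction h h0
          have h3 : g (v + s • (⟨w, hw⟩ : V)) -ᵥ g v = s • w := by simp [g]
          rw [h3] at this
          have hs0 : s ≠ 0 := ne_of_gt hs
          simpa [smul_smul, hs0] using H.direction.smul_mem s⁻¹ this
        have := Submodule.finrank_mono hle
        have := hT H (hs (Finset.mem_insert_self _ _))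
        omega
    exact (this T subset_rfl).2
  by_contra! hcon
  have hmem : g ⁻¹' U ∈ 𝓝 (0 : V) := hg.continuousAt.preimage_mem_nhds (by simpa [g] using hU)
  have : (0 : V) ∈ interior (⋃ H ∈ T, g ⁻¹' (H : Set (Fin n → ℝ))) := by
    rw [mem_interior_iff_mem_nhds]
    refine Filter.mem_of_superset hmem fun v hv => ?_
    obtain ⟨H, hH, h⟩ := hcon v v.2 hv
    exact Set.mem_biUnion hH h
  rw [hint] at this
  exact this

/-! ### Polyhedral chains -/

/-- A subset of `ℝⁿ` that is contained in a finite union of affine subspaces of dimension less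
than `d`. -/
def Thin {n : ℕ} (d : ℕ) (N : Set (Fin n → ℝ)) : Prop :=
  ∃ T : Finset (AffineSubspace ℝ (Fin n → ℝ)),
    (∀ H ∈ T, Module.finrank ℝ H.direction < d) ∧ ∀ x ∈ N, ∃ H ∈ T, x ∈ H

theorem Thin.mono {n d : ℕ} {N M : Set (Fin n → ℝ)} (h : Thin d N) (hM : M ⊆ N) : Thin d M := by
  obtain ⟨T, h1, h2⟩ := h
  exact ⟨T, h1, fun x hx => h2 x (hM hx)⟩

theorem Thin.union {n d : ℕ} {N M : Set (Fin n → ℝ)} (h : Thin d N) (h' : Thin d M) :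
    Thin d (N ∪ M) := by
  obtain ⟨T, h1, h2⟩ := h
  obtain ⟨T', h1', h2'⟩ := h'
  refine ⟨T ∪ T', fun H hH => ?_, fun x hx => ?_⟩
  · rcases Finset.mem_union.1 hH with hH | hH
    exacts [h1 H hH, h1' H hH]
  · rcases hx with hx | hx
    · obtain ⟨H, hH, hxH⟩ := h2 x hx
      exact ⟨H, Finset.mem_union_left _ hH, hxH⟩
    · obtain ⟨H, hH, hxH⟩ := h2' x hx
      exact ⟨H, Finset.mem_union_right _ hH, hxH⟩

theorem thin_empty {n d : ℕ} : Thin d (∅ : Set (Fin n → ℝ)) := ⟨∅, by simp, by simp⟩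

theorem thin_biUnion {n d : ℕ} {ι : Type*} (s : Finset ι) {N : ι → Set (Fin n → ℝ)}
    (h : ∀ i ∈ s, Thin d (N i)) : Thin d (⋃ i ∈ s, N i) := by
  induction s using Finset.induction_on with
  | empty => simpa using thin_empty
  | insert a s _ ih =>
    rw [Finset.set_biUnion_insert]
    exact (h a (Finset.mem_insert_self _ _)).union
      (ih fun i hi => h i (Finset.mem_insert_of_mem hi))

theorem thin_affine {n d : ℕ} (H : AffineSubspace ℝ (Fin n → ℝ))
    (h : Module.finrank ℝ H.direction < d) : Thin d (H : Set (Fin n → ℝ)) :=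
  ⟨{H}, by simpa using h, fun _ hx => ⟨H, by simp, hx⟩⟩

theorem thin_of_cellDim {n d : ℕ} {Q : Set (Fin n → ℝ)} (h : cellDim Q < d) : Thin d Q :=
  (thin_affine (affineSpan ℝ Q) (by rwa [direction_affineSpan])).mono (subset_affineSpan ℝ Q)

theorem mk_eq_mk_iff {n d : ℕ} {w w' : (Fin n → ℝ) → ℤ} :
    (QuotientAddGroup.mk w : WeightClass n d) = QuotientAddGroup.mk w' ↔
      Thin d {x | w x ≠ w' x} := by
  rw [QuotientAddGroup.eq]
  constructor
  · rintro ⟨T, h1, h2⟩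
    refine ⟨T, h1, fun x hx => h2 x ?_⟩
    simp only [Pi.add_apply, Pi.neg_apply]
    intro h
    exact hx (by linarith)
  · rintro ⟨T, h1, h2⟩
    refine ⟨T, h1, fun x hx => h2 x ?_⟩
    intro h
    apply hx
    simp only [Pi.add_apply, Pi.neg_apply, h]
    simp

theorem mk_eq_zero_iff {n d : ℕ} {w : (Fin n → ℝ) → ℤ} :
    (QuotientAddGroup.mk w : WeightClass n d) = 0 ↔ Thin d {x | w x ≠ 0} :=
  mk_eq_mk_iff (w' := 0)

/-- A point of a polyhedron that is generic and arbitrarily close to a given point. -/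
theorem exists_generic_mem {n d : ℕ} {Q : Set (Fin n → ℝ)} (hQ : IsRationalPolyhedron Q)
    (hd : d ≤ cellDim Q) {N : Set (Fin n → ℝ)} (hN : Thin d N) {y : Fin n → ℝ} (hy : y ∈ Q)
    {U : Set (Fin n → ℝ)} (hU : U ∈ 𝓝 y) :
    ∃ x ∈ U, x ∈ intrinsicInterior ℝ Q ∧ x ∉ N := by
  obtain ⟨T, hT, hTN⟩ := hN
  obtain ⟨z, hz⟩ := exists_mem_intrinsicInterior hQ
  obtain ⟨hzQ, hzl⟩ := (mem_intrinsicInterior_iff hQ).1 hz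
  obtain ⟨-, S, rfl⟩ := isRationalPolyhedron_iff.1 hQ
  rw [lineality_poly hzQ] at hzl
  have hc : Continuous fun s : ℝ => y + s • (z - y) := by fun_prop
  have hev : ∀ᶠ s in 𝓝[>] (0 : ℝ), y + s • (z - y) ∈ interior U :=
    nhdsWithin_le_nhds (hc.continuousAt.preimage_mem_nhds (by simpa using hU))
  have hev1 : ∀ᶠ s in 𝓝[>] (0 : ℝ), s < 1 :=
    nhdsWithin_le_nhds (gt_mem_nhds one_pos)
  obtain ⟨s, ⟨hsU, hs1⟩, hs0⟩ := ((hev.and hev1).and self_mem_nhdsWithin).exists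
  have hs0 : 0 < s := hs0
  -- move from `y` towards a relative interior point `z`, then to a generic point nearby
  set p := y + s • (z - y) with hp
  have hgp : ∀ c, gap c p = (1 - s) * gap c y + s * gap c z := fun c => by
    rw [hp, gap_add_smul, intForm_sub_eq_gap]; ring
  have hpos : ∀ c ∈ S, 0 < gap c z → 0 < gap c p := fun c hc h => by
    rw [hgp]
    have := hy c hc
    have h1 : 0 ≤ (1 - s) * gap c y := mul_nonneg (by linarith) this
    have h2 : 0 < s * gap c z := mul_pos hs0 h
    linarith
  have hW : interior U ∩ {x | ∀ c ∈ S, 0 < gap c z → 0 < gap c x} ∈ 𝓝 p := by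
    refine Filter.inter_mem (isOpen_interior.mem_nhds hsU) ?_
    refine (eventually_all_finset S).2 fun c hc => ?_
    by_cases h0 : 0 < gap c z
    · exact ((continuous_gap c).continuousAt.eventually
        (lt_mem_nhds (hpos c hc h0))).mono fun z hz _ => hz
    · exact Eventually.of_forall fun z hz => absurd hz h0
  obtain ⟨v, hv, ⟨hvU, hvpos⟩, hvT⟩ := exists_generic (vectorSpan ℝ (poly S)) p T
    (fun H hH => (hT H hH).trans_le hd) hW
  have hv0 : ∀ c ∈ S, gap c z = 0 → gap c (p + v) = 0 := by
    intro c hc h0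
    have h1 : intForm c.1 v = 0 := by
      rw [← hzl] at hv
      exact hv c hc h0
    have h2 : intForm c.1 (z - y) = 0 := by
      have : z - y ∈ kerAt S z := hzl ▸ vsub_mem_vectorSpan ℝ hzQ hy
      exact this c hc h0
    rw [intForm_sub_eq_gap, h0, zero_sub, neg_eq_zero] at h2
    rw [gap_add, h1, hgp, h0, h2]; ring
  have hmem : p + v ∈ poly S := fun c hc => by
    rcases (hzQ c hc).lt_or_eq with h | h
    · exact (hvpos c hc h).le
    · exact (hv0 c hc h.symm).ge
  refine ⟨p + v, interior_subset hvU, (mem_intrinsicInterior_iff hQ).2 ⟨hmem, ?_⟩, fun hN => ?_⟩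
  · refine (lineality_le_vectorSpan hmem).antisymm ?_
    rw [lineality_poly hmem, ← hzl]
    intro u hu c hc h0
    refine hu c hc ?_
    by_contra h
    exact (hvpos c hc (lt_of_le_of_ne (hzQ c hc) (Ne.symm h))).ne' h0
  · obtain ⟨H, hH, hx⟩ := hTN _ hN
    exact hvT H hH hx

/-- Rational polyhedra of dimension `d` in `ℝⁿ`. -/
abbrev Cell (n d : ℕ) : Type := {Q : Set (Fin n → ℝ) // IsRationalPolyhedron Q ∧ cellDim Q = d}

/-- Formal integer combinations of rational polyhedra of dimension `d`. -/
abbrev Chain (n d : ℕ) : Type := Cell n d →₀ ℤ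

namespace Chain

variable {n d : ℕ}

/-- The weight function of a chain: the sum of the weights of the polyhedra that contain a point
in their relative interior. -/
def fn : Chain n d →ₗ[ℤ] ((Fin n → ℝ) → ℤ) :=
  Finsupp.linearCombination ℤ fun Q x => if x ∈ intrinsicInterior ℝ Q.1 then 1 else 0

/-- The class of the weight function of a chain. -/
def cls : Chain n d →+ WeightClass n d :=
  (QuotientAddGroup.mk' (negligible n d)).comp fn.toAddMonoidHom

theorem cls_apply (c : Chain n d) : cls c = QuotientAddGroup.mk (fn c) := rfl

theorem fn_apply (c : Chain n d) (x : Fin n → ℝ) :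
    fn c x = ∑ Q ∈ c.support, if x ∈ intrinsicInterior ℝ Q.1 then c Q else 0 := by
  simp [fn, Finsupp.linearCombination_apply, Finsupp.sum, Finset.sum_apply]

/-- The divergence of a chain at a point `y` in the direction of a linear subspace `L`: the
weighted sum of the primitive vectors of the polyhedra that have lineality space `L` at `y`. -/
def dv (y : Fin n → ℝ) (L : Submodule ℝ (Fin n → ℝ)) : Chain n d →ₗ[ℤ] (Fin n → ℤ) :=
  Finsupp.linearCombination ℤ fun Q => if y ∈ Q.1 ∧ lineality Q.1 y = L then pv Q.1 y else 0

theorem dv_apply (y : Fin n → ℝ) (L : Submodule ℝ (Fin n → ℝ)) (c : Chain n d) :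
    dv y L c =
      ∑ Q ∈ c.support, if y ∈ Q.1 ∧ lineality Q.1 y = L then c Q • pv Q.1 y else 0 := by
  simp only [dv, Finsupp.linearCombination_apply, Finsupp.sum]
  exact Finset.sum_congr rfl fun Q _ => by split_ifs <;> simp

/-- The balancing condition for chains of dimension `d`: the divergence in the direction of each
linear subspace `L` of dimension `d - 1` lies in `L`, at all points outside of a finite union of
affine subspaces of dimension less than `d - 1`. -/
def Bal (c : Chain n d) : Prop :=
  ∃ N : Set (Fin n → ℝ), Thin (d - 1) N ∧ ∀ y ∉ N, ∀ L : Submodule ℝ (Fin n → ℝ),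
    Module.finrank ℝ L + 1 = d → dv y L c ∈ lat L

theorem Bal.add {c c' : Chain n d} (h : Bal c) (h' : Bal c') : Bal (c + c') := by
  obtain ⟨N, hN, h⟩ := h
  obtain ⟨N', hN', h'⟩ := h'
  refine ⟨N ∪ N', hN.union hN', fun y hy L hL => ?_⟩
  rw [Set.mem_union, not_or] at hy
  rw [map_add]
  exact AddSubgroup.add_mem _ (h y hy.1 L hL) (h' y hy.2 L hL)

theorem Bal.neg {c : Chain n d} (h : Bal c) : Bal (-c) := by
  obtain ⟨N, hN, h⟩ := h
  refine ⟨N, hN, fun y hy L hL => ?_⟩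
  rw [map_neg]
  exact AddSubgroup.neg_mem _ (h y hy L hL)

/-- `S` contains defining inequalities of all polyhedra of the chain. -/
def Adapted (S : Finset ((Fin n → ℤ) × ℝ)) (c : Chain n d) : Prop :=
  ∀ Q ∈ c.support, ∃ T ⊆ S, Q.1 = poly T

theorem exists_adapted (c : Chain n d) (S₀ : Finset ((Fin n → ℤ) × ℝ)) :
    ∃ S, S₀ ⊆ S ∧ Adapted S c := by
  have : ∀ Q : Cell n d, ∃ T, Q.1 = poly T := fun Q => (isRationalPolyhedron_iff.1 Q.2.1).2
  choose T hT using this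
  exact ⟨S₀ ∪ c.support.biUnion T, Finset.subset_union_left, fun Q hQ =>
    ⟨T Q, (Finset.subset_biUnion_of_mem T hQ).trans Finset.subset_union_right, hT Q⟩⟩

end Chain

/-! ### The cells of a hyperplane arrangement around a point -/

theorem finite_range_signCell {n : ℕ} (S : Finset ((Fin n → ℤ) × ℝ)) :
    (Set.range (signCell S)).Finite := by
  let sgn : (Fin n → ℝ) → (S → Bool × Bool) :=
    fun x c => (decide (0 ≤ gap c.1 x), decide (gap c.1 x ≤ 0))
  refine Set.Finite.subset ((Set.toFinite (Set.range sgn)).image fun t =>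
    {y | ∀ c : S, ((t c).1 = true → 0 ≤ gap c.1 y) ∧ ((t c).2 = true → gap c.1 y ≤ 0)}) ?_
  rintro _ ⟨x, rfl⟩
  refine ⟨sgn x, ⟨x, rfl⟩, ?_⟩
  ext y
  rw [mem_signCell]
  simp [sgn]

/-- All closed cells of the hyperplane arrangement of `S`. -/
def allCells {n : ℕ} (S : Finset ((Fin n → ℤ) × ℝ)) : Finset (Set (Fin n → ℝ)) :=
  (finite_range_signCell S).toFinset

theorem mem_allCells {n : ℕ} {S : Finset ((Fin n → ℤ) × ℝ)} {C : Set (Fin n → ℝ)} :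
    C ∈ allCells S ↔ ∃ x, signCell S x = C := by simp [allCells]

theorem signCell_eq_of_kerAt_eq {n : ℕ} {S : Finset ((Fin n → ℤ) × ℝ)} {x y : Fin n → ℝ}
    (h : y ∈ signCell S x) (hk : Module.finrank ℝ (kerAt S x) ≤ Module.finrank ℝ (kerAt S y)) :
    signCell S y = signCell S x := by
  have hle : kerAt S y ≤ kerAt S x := by
    rw [← vectorSpan_signCell, ← vectorSpan_signCell]
    exact vectorSpan_mono ℝ (signCell_subset h)
  have heq := Submodule.eq_of_le_of_finrank_eq hle (le_antisymm (Submodule.finrank_mono hle) hk)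
  refine (signCell_subset h).antisymm (signCell_subset (mem_signCell.2 fun c hc => ?_))
  have hz : gap c y = 0 → gap c x = 0 := fun h0 => by
    have : x - y ∈ kerAt S y := by
      rw [heq, ← vectorSpan_signCell]
      exact vsub_mem_vectorSpan ℝ (self_mem_signCell S x) h
    have := this c hc h0
    rwa [intForm_sub_eq_gap, h0, sub_zero] at this
  have h1 := mem_signCell.1 h c hc
  constructor
  · intro h0
    by_contra hcon
    push Not at hcon
    exact hcon.ne (hz (le_antisymm (h1.2 hcon.le) h0))
  · intro h0
    by_contra hcon
    push Not at hcon
    exact hcon.ne' (hz (le_antisymm h0 (h1.1 hcon.le)))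

/-- The closed cell that one enters when moving from `y` in the direction `w`. -/
def dirCell {n : ℕ} (S : Finset ((Fin n → ℤ) × ℝ)) (y w : Fin n → ℝ) : Set (Fin n → ℝ) :=
  {z | ∀ c ∈ S, (0 < gap c y → 0 ≤ gap c z) ∧ (gap c y < 0 → gap c z ≤ 0) ∧
    (gap c y = 0 → (0 ≤ intForm c.1 w → 0 ≤ gap c z) ∧ (intForm c.1 w ≤ 0 → gap c z ≤ 0))}

/-- The cell `dirCell` is a cell of the arrangement, as it is the cell of the points close to `y` on
the ray in the direction `w`. -/
theorem eventually_signCell_eq {n : ℕ} (S : Finset ((Fin n → ℤ) × ℝ)) (y w : Fin n → ℝ) :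
    ∀ᶠ s in 𝓝[>] (0 : ℝ), signCell S (y + s • w) = dirCell S y w := by
  have h : ∀ᶠ s in 𝓝[>] (0 : ℝ), ∀ c ∈ S, (0 < gap c y → 0 < gap c (y + s • w)) ∧
      (gap c y < 0 → gap c (y + s • w) < 0) := by
    refine (eventually_all_finset S).2 fun c _ => Eventually.and ?_ ?_
    · by_cases h : 0 < gap c y
      · exact (eventually_pos_gap c y w h).mono fun s hs _ => hs
      · exact Eventually.of_forall fun s hs => absurd hs h
    · by_cases h : gap c y < 0
      · refine (eventually_pos_gap (-c) y w (by rw [gap_neg]; linarith)).mono fun s hs _ => ?_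
        rw [gap_neg] at hs
        linarith
      · exact Eventually.of_forall fun s hs => absurd hs h
  filter_upwards [h, self_mem_nhdsWithin] with s hs hs0
  have hs0 : 0 < s := hs0
  ext z
  rw [mem_signCell]
  refine forall₂_congr fun c hc => ?_
  obtain ⟨h1, h2⟩ := hs c hc
  rcases lt_trichotomy (gap c y) 0 with h | h | h
  · have := h2 h
    simp [h, h.ne, this.le, this.not_ge, h.not_gt]
  · rw [gap_add_smul, h, zero_add]
    simp [mul_nonneg_iff_of_pos_left hs0, mul_nonpos_iff, hs0.le, hs0.not_ge]
  · have := h1 h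
    simp [h, h.ne', this.le, this.not_ge, h.not_gt]

theorem self_mem_dirCell {n : ℕ} (S : Finset ((Fin n → ℤ) × ℝ)) (y w : Fin n → ℝ) :
    y ∈ dirCell S y w :=
  fun _ _ => ⟨fun h => h.le, fun h => h.le, fun h => ⟨fun _ => h.ge, fun _ => h.le⟩⟩

theorem dirCell_congr {n : ℕ} {S : Finset ((Fin n → ℤ) × ℝ)} {y w w' : Fin n → ℝ}
    (h : w - w' ∈ kerAt S y) : dirCell S y w = dirCell S y w' := by
  ext z
  refine forall₂_congr fun c hc => and_congr Iff.rfl (and_congr Iff.rfl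
    (imp_congr_right fun h0 => ?_))
  have := h c hc h0
  rw [map_sub, sub_eq_zero] at this
  rw [this]

theorem dirCell_mem {n d : ℕ} {S T : Finset ((Fin n → ℤ) × ℝ)} (hT : T ⊆ S)
    {y w : Fin n → ℝ} (hy : Module.finrank ℝ (kerAt S y) + 1 = d)
    (hd : cellDim (poly T) = d) (hw : w ∉ kerAt S y)
    (hev : ∀ᶠ s in 𝓝[>] (0 : ℝ), y + s • w ∈ poly T) :
    dirCell S y w ∈ (allCells S).filter fun C => (cellDim C = d ∧ y ∈ C) ∧ C ⊆ poly T := by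
  obtain ⟨s, ⟨h1, h2⟩, hs⟩ :=
    ((hev.and (eventually_signCell_eq S y w)).and self_mem_nhdsWithin).exists
  have hs0 : s ≠ 0 := ne_of_gt hs
  have hyC : y ∈ signCell S (y + s • w) := h2 ▸ self_mem_dirCell S y w
  have hsub := signCell_subset_poly hT h1
  rw [← h2]
  refine Finset.mem_filter.2 ⟨mem_allCells.2 ⟨_, rfl⟩, ⟨?_, hyC⟩, hsub⟩
  have hle : cellDim (signCell S (y + s • w)) ≤ d :=
    hd ▸ Submodule.finrank_mono (vectorSpan_mono ℝ hsub)
  have hlt : kerAt S y < vectorSpan ℝ (signCell S (y + s • w)) := by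
    refine lt_of_le_of_ne ?_ fun h => hw ?_
    · rw [← lineality_signCell hyC]
      exact lineality_le_vectorSpan hyC
    · rw [h]
      have := vsub_mem_vectorSpan ℝ (self_mem_signCell S (y + s • w)) hyC
      rw [vsub_eq_sub, add_sub_cancel_left] at this
      simpa [smul_smul, hs0] using Submodule.smul_mem _ s⁻¹ this
  have := Submodule.finrank_lt_finrank_of_lt hlt
  unfold cellDim at hle ⊢
  omega

/-- The cells of an arrangement around a ridge that lie in a given polyhedron: their primitive
vectors sum up to the primitive vector of the polyhedron, or cancel if the ridge passes through
its relative interior. -/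
theorem sum_primitiveVector_sub_mem {n d : ℕ} {S T : Finset ((Fin n → ℤ) × ℝ)} (hT : T ⊆ S)
    {y : Fin n → ℝ} (hy : Module.finrank ℝ (kerAt S y) + 1 = d) (hd : cellDim (poly T) = d) :
    ∑ C ∈ (allCells S).filter (fun C => (cellDim C = d ∧ y ∈ C) ∧ C ⊆ poly T),
        primitiveVector (signCell S y) C -
      (if y ∈ poly T ∧ lineality (poly T) y = kerAt S y then pv (poly T) y else 0) ∈
      lat (kerAt S y) := by
  set N := (allCells S).filter (fun C => (cellDim C = d ∧ y ∈ C) ∧ C ⊆ poly T) with hN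
  set V := kerAt S y with hV
  set W := vectorSpan ℝ (poly T) with hW
  by_cases hyT : y ∈ poly T
  swap
  · have : N = ∅ := Finset.filter_eq_empty_iff.2 fun C _ h => hyT (h.2 h.1.2)
    rw [this, if_neg (fun h => hyT h.1)]
    simp
  have hQ : IsRationalPolyhedron (poly T) := isRationalPolyhedron_iff.2 ⟨⟨y, hyT⟩, T, rfl⟩
  have hspan : ∀ C ∈ N, vectorSpan ℝ C = W := by
    intro C hC
    obtain ⟨-, ⟨h1, -⟩, h2⟩ := Finset.mem_filter.1 hC
    exact Submodule.eq_of_le_of_finrank_eq (vectorSpan_mono ℝ h2) (h1.trans hd.symm)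
  have hlin : ∀ C ∈ N, lineality C y = V := by
    intro C hC
    obtain ⟨h0, ⟨-, h1⟩, -⟩ := Finset.mem_filter.1 hC
    obtain ⟨x, rfl⟩ := mem_allCells.1 h0
    exact lineality_signCell h1
  have hrat : ∀ C ∈ N, IsRationalPolyhedron C := by
    intro C hC
    obtain ⟨x, rfl⟩ := mem_allCells.1 (Finset.mem_filter.1 hC).1
    exact isRationalPolyhedron_signCell S x
  have hprim : ∀ C ∈ N, IsPrimAt C y (primitiveVector (signCell S y) C) := by
    intro C hC
    have hd' : Module.finrank ℝ (lineality C y) + 1 = cellDim C := by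
      rw [hlin C hC, hy]; exact (Finset.mem_filter.1 hC).2.1.1.symm
    have hyC := (Finset.mem_filter.1 hC).2.1.2
    obtain ⟨x, hx⟩ := mem_allCells.1 (Finset.mem_filter.1 hC).1
    have hiff := fun v => isPrimitiveVector_iff (v := v) (hrat C hC) (self_mem_signCell S y)
      (hx ▸ signCell_subset (hx ▸ hyC)) (by rw [vectorSpan_signCell, hlin C hC])
    rw [← hiff]
    obtain ⟨v, hv⟩ := exists_isPrimAt (hrat C hC) hyC hd'
    exact Classical.epsilon_spec ⟨v, (hiff v).2 hv⟩
  set p := fun C => primitiveVector (signCell S y) C with hp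
  have hpW : ∀ C ∈ N, p C ∈ lat W := fun C hC => hspan C hC ▸ (hprim C hC).1
  have hpgen : ∀ C ∈ N, ∀ w ∈ lat W, ∃ k : ℤ, w - k • p C ∈ lat V := fun C hC w hw => by
    have := (hprim C hC).2.1 w (by rw [hspan C hC]; exact hw)
    rwa [hlin C hC] at this
  have hpV : ∀ C ∈ N, castVec n (p C) ∉ V := fun C hC => by
    have := (hprim C hC).notMem (hrat C hC)
      (by rw [hlin C hC, hy]; exact (Finset.mem_filter.1 hC).2.1.1.symm)
    rwa [hlin C hC] at this
  -- each cell is determined by its primitive vector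
  have hdir : ∀ C ∈ N, C = dirCell S y (castVec n (p C)) := by
    intro C hC
    obtain ⟨ε, hε, hm⟩ := (hprim C hC).2.2
    obtain ⟨h0, ⟨h1, h2⟩, -⟩ := Finset.mem_filter.1 hC
    obtain ⟨x, rfl⟩ := mem_allCells.1 h0
    have hm' := eventually_mem_poly (v := castVec n (p (signCell S x))) h2
      (intForm_nonneg_of_mem_poly hε hm)
    obtain ⟨s, ⟨h3, h4⟩, hs⟩ := ((hm'.and (eventually_signCell_eq S y
      (castVec n (p (signCell S x))))).and self_mem_nhdsWithin).exists
    rw [← h4]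
    symm
    have hs0 : s ≠ 0 := ne_of_gt hs
    refine signCell_eq_of_kerAt_eq h3 ?_
    have hyC : y ∈ signCell S (y + s • castVec n (p (signCell S x))) :=
      h4 ▸ self_mem_dirCell S y _
    have hlt : V < kerAt S (y + s • castVec n (p (signCell S x))) := by
      rw [← vectorSpan_signCell]
      refine lt_of_le_of_ne ?_ fun h => hpV _ hC ?_
      · rw [hV, ← lineality_signCell hyC]
        exact lineality_le_vectorSpan hyC
      · rw [h]
        have := vsub_mem_vectorSpan ℝ (self_mem_signCell S
          (y + s • castVec n (p (signCell S x)))) hyC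
        rw [vsub_eq_sub, add_sub_cancel_left] at this
        simpa [smul_smul, hs0] using Submodule.smul_mem _ s⁻¹ this
    have := Submodule.finrank_lt_finrank_of_lt hlt
    unfold cellDim at h1
    rw [vectorSpan_signCell] at h1
    omega
  have hVW : V ≤ lineality (poly T) y := by
    rw [lineality_poly hyT]; exact kerAt_anti hT y
  by_cases hl : lineality (poly T) y = V
  · -- exactly one cell
    have hd' : Module.finrank ℝ (lineality (poly T) y) + 1 = cellDim (poly T) := by
      rw [hl, hy, hd]
    have hv := pv_spec hQ hyT hd'
    have hvV := hv.notMem hQ hd'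
    rw [hl] at hvV
    obtain ⟨ε, hε, hm⟩ := hv.2.2
    have hC₀ : dirCell S y (castVec n (pv (poly T) y)) ∈ N :=
      dirCell_mem hT hy hd hvV (eventually_mem_poly hyT (intForm_nonneg_of_mem_poly hε hm))
    have hsub : ∀ C ∈ N, p C - pv (poly T) y ∈ lat V := by
      intro C hC
      have h1 : IsPrimAt (poly T) y (p C) := by
        refine ⟨hpW C hC, fun w hw => ?_, ?_⟩
        · rw [hl]; exact hpgen C hC w hw
        · obtain ⟨ε, hε, hm⟩ := (hprim C hC).2.2
          exact ⟨ε, hε, (Finset.mem_filter.1 hC).2.2 hm⟩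
      have := h1.sub_mem hQ hyT hd' hv
      rwa [hl] at this
    have hNeq : N = {dirCell S y (castVec n (pv (poly T) y))} := by
      refine Finset.eq_singleton_iff_unique_mem.2 ⟨hC₀, fun C hC => ?_⟩
      rw [hdir C hC]
      exact dirCell_congr (by rw [← map_sub]; exact hsub C hC)
    rw [if_pos ⟨hyT, hl⟩, hNeq, Finset.sum_singleton]
    exact hsub _ hC₀
  · -- exactly two opposite cells
    rw [if_neg (fun h => hl h.2), sub_zero]
    have hlW : lineality (poly T) y = W := by
      have hle := lineality_le_vectorSpan hyT
      refine Submodule.eq_of_le_of_finrank_le hle ?_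
      have := Submodule.finrank_lt_finrank_of_lt (lt_of_le_of_ne hVW (Ne.symm hl))
      unfold cellDim at hd
      rw [hd]
      omega
    have hev : ∀ w ∈ W, ∀ᶠ s in 𝓝[>] (0 : ℝ), y + s • w ∈ poly T := by
      intro w hw
      rw [← hlW, lineality_poly hyT] at hw
      exact eventually_mem_poly hyT fun c hc h0 => (hw c hc h0).ge
    obtain ⟨w, hw, hwV⟩ : ∃ w ∈ W, w ∉ V := by
      by_contra! hcon
      exact hl (hVW.antisymm' (hlW.trans_le hcon))
    have hC₁ := dirCell_mem hT hy hd hwV (hev w hw)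
    set C₁ := dirCell S y w
    have hC₂ : dirCell S y (-castVec n (p C₁)) ∈ N :=
      dirCell_mem hT hy hd (fun h => hpV _ hC₁ (by simpa using V.neg_mem h))
        (hev _ (W.neg_mem (hpW _ hC₁)))
    set C₂ := dirCell S y (-castVec n (p C₁)) with hC₂def
    -- all primitive vectors generate the same infinite cyclic group modulo `V`
    have hpm : ∀ C ∈ N, (p C - p C₁ ∈ lat V) ∨ (p C + p C₁ ∈ lat V) := by
      intro C hC
      obtain ⟨k, hk⟩ := hpgen C₁ hC₁ _ (hpW C hC)
      obtain ⟨k', hk'⟩ := hpgen C hC _ (hpW C₁ hC₁)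
      have h1 : (1 - k' * k) • p C₁ ∈ lat V := by
        have := AddSubgroup.add_mem _ hk' (AddSubgroup.zsmul_mem _ hk k')
        convert this using 1
        rw [smul_sub, sub_smul, one_smul, mul_smul]; abel
      have h2 : k' * k = 1 := by
        by_contra hne
        have : (1 - k' * k : ℤ) ≠ 0 := fun h => hne (by linarith)
        have hr : ((1 - k' * k : ℤ) : ℝ) ≠ 0 := by exact_mod_cast this
        rw [mem_lat, castVec_zsmul] at h1
        exact hpV _ hC₁ ((Submodule.smul_mem_iff _ hr).1 h1)
      rcases Int.eq_one_or_neg_one_of_mul_eq_one (by rwa [mul_comm] at h2) with h | h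
      · left; simpa [h] using hk
      · right; simpa [h] using hk
    have hp₂ : p C₂ + p C₁ ∈ lat V := by
      rcases hpm C₂ hC₂ with h | h
      · exfalso
        -- otherwise both cells coincide and contain points on both sides
        have heq : C₂ = C₁ := by
          rw [hdir C₂ hC₂, hdir C₁ hC₁]
          exact dirCell_congr (by rw [← map_sub]; exact h)
        apply hpV _ hC₁
        intro c hc h0
        obtain ⟨ε, hε, hm⟩ := (hprim _ hC₁).2.2
        have hm' : y + ε • castVec n (p C₁) ∈ C₂ := by rw [heq]; exact hm
        have a1 := (hm' c hc).2.2 h0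
        rw [gap_add_smul, h0, zero_add] at a1
        simp only [map_neg, Left.nonneg_neg_iff, Left.neg_nonpos_iff] at a1
        rcases le_total 0 (intForm c.1 (castVec n (p C₁))) with h1 | h1
        · exact le_antisymm (nonpos_of_mul_nonpos_right (a1.2 h1) hε) h1
        · exact le_antisymm h1 (nonneg_of_mul_nonneg_right (a1.1 h1) hε)
      · exact h
    have hne : C₁ ≠ C₂ := by
      intro h
      rw [← h] at hp₂
      have h1 : (2 : ℤ) • p C₁ ∈ lat V := by rwa [two_smul]
      rw [mem_lat, castVec_zsmul] at h1
      exact hpV _ hC₁ ((Submodule.smul_mem_iff _ (by norm_num)).1 h1)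
    have hNeq : N = {C₁, C₂} := by
      ext C
      rw [Finset.mem_insert, Finset.mem_singleton]
      constructor
      · intro hC
        rcases hpm C hC with h | h
        · left
          rw [hdir C hC, hdir C₁ hC₁]
          exact dirCell_congr (by rw [← map_sub]; exact h)
        · right
          rw [hdir C hC, hC₂def]
          exact dirCell_congr (by rw [sub_neg_eq_add, ← map_add]; exact h)
      · rintro (rfl | rfl)
        exacts [hC₁, hC₂]
    rw [hNeq, Finset.sum_pair hne, add_comm]
    exact hp₂

/-! ### Chains and arrangement complexes -/

/-- The direction of a cell of an arrangement is contained in the lineality space of each polyhedron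
of the arrangement at the points of the cell. -/
theorem lineality_cell_eq {n d : ℕ} {S T : Finset ((Fin n → ℤ) × ℝ)} (hT : T ⊆ S)
    (hd : cellDim (poly T) = d) {x : Fin n → ℝ} (hx : x ∈ poly T) :
    kerAt S x ≤ lineality (poly T) x ∧ Module.finrank ℝ (kerAt S x) ≤ d := by
  have h1 : kerAt S x ≤ lineality (poly T) x := by
    rw [lineality_poly hx]; exact kerAt_anti hT x
  exact ⟨h1, hd ▸ Submodule.finrank_mono (h1.trans (lineality_le_vectorSpan hx))⟩

theorem thin_finrank_kerAt {n : ℕ} (S : Finset ((Fin n → ℤ) × ℝ)) (d : ℕ) :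
    Thin d {x | Module.finrank ℝ (kerAt S x) < d} := by
  refine (thin_biUnion ((allCells S).filter fun C => cellDim C < d) (N := id) fun C hC =>
    thin_of_cellDim (Finset.mem_filter.1 hC).2).mono fun x hx => ?_
  refine Set.mem_biUnion (x := signCell S x) (Finset.mem_coe.2 (Finset.mem_filter.2
    ⟨mem_allCells.2 ⟨x, rfl⟩, ?_⟩)) (self_mem_signCell S x)
  unfold cellDim
  rw [vectorSpan_signCell]
  exact hx

theorem mem_intrinsicInterior_signCell {n : ℕ} {S : Finset ((Fin n → ℤ) × ℝ)}
    {x y : Fin n → ℝ} :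
    y ∈ intrinsicInterior ℝ (signCell S x) ↔ y ∈ signCell S x ∧ signCell S y = signCell S x := by
  rw [mem_intrinsicInterior_iff (isRationalPolyhedron_signCell S x)]
  refine and_congr_right fun h => ?_
  rw [lineality_signCell h, vectorSpan_signCell]
  constructor
  · intro h1
    exact signCell_eq_of_kerAt_eq h (by rw [h1])
  · intro h1
    rw [← vectorSpan_signCell, h1, vectorSpan_signCell]

namespace Chain

variable {n d : ℕ}

/-- The total weight of the polyhedra of a chain that contain the set `C`. -/
def mult (c : Chain n d) (C : Set (Fin n → ℝ)) : ℤ :=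
  ∑ Q ∈ c.support, if C ⊆ Q.1 then c Q else 0

/-- At points in the interior of a cell of dimension `d` of an adapted arrangement, the weight
function is the multiplicity of the cell. -/
theorem fn_eq_mult {S : Finset ((Fin n → ℤ) × ℝ)} {c : Chain n d} (hS : Adapted S c)
    {x : Fin n → ℝ} (hx : Module.finrank ℝ (kerAt S x) = d) :
    fn c x = mult c (signCell S x) := by
  rw [fn_apply, mult]
  refine Finset.sum_congr rfl fun Q hQ => ?_
  obtain ⟨T, hT, hQT⟩ := hS Q hQ
  congr 1
  rw [mem_intrinsicInterior_iff Q.2.1, eq_iff_iff]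
  have hd := Q.2.2
  rw [hQT] at hd ⊢
  constructor
  · exact fun h => signCell_subset_poly hT h.1
  · intro h
    have hxT := h (self_mem_signCell S x)
    refine ⟨hxT, Submodule.eq_of_le_of_finrank_le (lineality_le_vectorSpan hxT) ?_⟩
    have := Submodule.finrank_mono (lineality_cell_eq hT hd hxT).1
    unfold cellDim at hd
    omega

theorem fn_eq_zero {S : Finset ((Fin n → ℤ) × ℝ)} {c : Chain n d} (hS : Adapted S c)
    {x : Fin n → ℝ} (hx : d < Module.finrank ℝ (kerAt S x)) : fn c x = 0 := by
  rw [fn_apply]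
  refine Finset.sum_eq_zero fun Q hQ => if_neg fun h => ?_
  obtain ⟨T, hT, hQT⟩ := hS Q hQ
  have hd := Q.2.2
  have h := intrinsicInterior_subset h
  rw [hQT] at hd h
  have := (lineality_cell_eq hT hd h).2
  omega

/-- The divergence of a chain, computed from the cells of an arrangement that refines it. -/
theorem sum_mult_sub_dv_mem {S : Finset ((Fin n → ℤ) × ℝ)} {c : Chain n d} (hS : Adapted S c)
    {y : Fin n → ℝ} (hy : Module.finrank ℝ (kerAt S y) + 1 = d) :
    ∑ C ∈ (allCells S).filter (fun C => cellDim C = d ∧ y ∈ C),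
        mult c C • primitiveVector (signCell S y) C - dv y (kerAt S y) c ∈ lat (kerAt S y) := by
  have h1 : ∑ C ∈ (allCells S).filter (fun C => cellDim C = d ∧ y ∈ C),
      mult c C • primitiveVector (signCell S y) C = ∑ Q ∈ c.support, c Q •
        ∑ C ∈ (allCells S).filter (fun C => (cellDim C = d ∧ y ∈ C) ∧ C ⊆ Q.1),
          primitiveVector (signCell S y) C := by
    simp only [mult, Finset.sum_smul]
    rw [Finset.sum_comm]
    refine Finset.sum_congr rfl fun Q _ => ?_
    rw [Finset.smul_sum, ← Finset.filter_filter _ (fun C => C ⊆ Q.1),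
      Finset.sum_filter (fun C => C ⊆ Q.1)]
    refine Finset.sum_congr rfl fun C _ => ?_
    split_ifs <;> simp
  rw [h1, dv_apply, ← Finset.sum_sub_distrib]
  refine AddSubgroup.sum_mem _ fun Q hQ => ?_
  obtain ⟨T, hT, hQT⟩ := hS Q hQ
  have h2 := sum_primitiveVector_sub_mem hT hy (hQT ▸ Q.2.2)
  rw [← hQT] at h2
  have h3 : (if y ∈ Q.1 ∧ lineality Q.1 y = kerAt S y then c Q • pv Q.1 y else 0) =
      c Q • (if y ∈ Q.1 ∧ lineality Q.1 y = kerAt S y then pv Q.1 y else 0) := by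
    split_ifs <;> simp
  rw [h3, ← smul_sub]
  exact AddSubgroup.zsmul_mem _ h2 _

/-- The complex of the cells of an arrangement that are contained in a cell of dimension `d` of
non-zero weight. -/
def cpx (S : Finset ((Fin n → ℤ) × ℝ)) (c : Chain n d) : WeightedComplex n d where
  cells := (allCells S).filter fun C =>
    ∃ C' ∈ allCells S, cellDim C' = d ∧ mult c C' ≠ 0 ∧ C ⊆ C'
  isPolyhedron σ hσ := by
    obtain ⟨x, rfl⟩ := mem_allCells.1 (Finset.mem_filter.1 hσ).1
    exact isRationalPolyhedron_signCell S x
  face_mem σ hσ τ hτ := by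
    obtain ⟨h1, C', h2, h3, h4, h5⟩ := Finset.mem_filter.1 hσ
    obtain ⟨x, rfl⟩ := mem_allCells.1 h1
    obtain ⟨y, -, rfl⟩ := isFace_signCell_iff.1 hτ
    exact Finset.mem_filter.2 ⟨mem_allCells.2 ⟨y, rfl⟩, C', h2, h3, h4, hτ.2.subset.trans h5⟩
  inter_face σ hσ τ hτ hne := by
    obtain ⟨x, rfl⟩ := mem_allCells.1 (Finset.mem_filter.1 hσ).1
    obtain ⟨x', rfl⟩ := mem_allCells.1 (Finset.mem_filter.1 hτ).1
    obtain ⟨y, hy, h⟩ := exists_eq_signCell (S := S) hne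
      ((isRationalPolyhedron_signCell S x).convex.inter
        (isRationalPolyhedron_signCell S x').convex)
      (fun y hy => Set.subset_inter (signCell_subset hy.1) (signCell_subset hy.2))
      (fun c hc => (le_total 0 (gap c x)).imp
        (fun h z hz => (mem_signCell.1 hz.1 c hc).1 h)
        (fun h z hz => (mem_signCell.1 hz.1 c hc).2 h))
    rw [h]
    exact ⟨isFace_signCell_iff.2 ⟨y, hy.1, rfl⟩, isFace_signCell_iff.2 ⟨y, hy.2, rfl⟩⟩
  dim_le σ hσ := by
    obtain ⟨-, C', -, h3, -, h5⟩ := Finset.mem_filter.1 hσ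
    exact h3 ▸ Submodule.finrank_mono (vectorSpan_mono ℝ h5)
  weight := mult c

theorem mem_facets_cpx {S : Finset ((Fin n → ℤ) × ℝ)} {c : Chain n d} {C : Set (Fin n → ℝ)} :
    C ∈ (cpx S c).facets ↔ C ∈ allCells S ∧ cellDim C = d ∧ mult c C ≠ 0 := by
  constructor
  · intro h
    obtain ⟨h1, h2⟩ := Finset.mem_filter.1 h
    obtain ⟨h1, C', h3, h4, h5, h6⟩ := Finset.mem_filter.1 h1
    obtain ⟨x, rfl⟩ := mem_allCells.1 h1
    obtain ⟨x', rfl⟩ := mem_allCells.1 h3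
    unfold cellDim at h2 h4
    rw [vectorSpan_signCell] at h2 h4
    have := signCell_eq_of_kerAt_eq (signCell_subset_iff.1 h6) (by omega)
    refine ⟨h1, ?_, ?_⟩
    · unfold cellDim; rw [vectorSpan_signCell, h2]
    · rw [this]; exact h5
  · rintro ⟨h1, h2, h3⟩
    exact Finset.mem_filter.2 ⟨Finset.mem_filter.2 ⟨h1, C, h1, h2, h3, subset_rfl⟩, h2⟩

theorem isReduced_cpx (S : Finset ((Fin n → ℤ) × ℝ)) (c : Chain n d) : (cpx S c).IsReduced :=
  fun _ hσ => (mem_facets_cpx.1 hσ).2.2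

theorem isPure_cpx (S : Finset ((Fin n → ℤ) × ℝ)) (c : Chain n d) : (cpx S c).IsPure := by
  intro τ hτ
  obtain ⟨-, C', h1, h2, h3, h4⟩ := Finset.mem_filter.1 hτ
  exact ⟨C', mem_facets_cpx.2 ⟨h1, h2, h3⟩, h4⟩

theorem toClass_cpx {S : Finset ((Fin n → ℤ) × ℝ)} {c : Chain n d} (hS : Adapted S c) :
    (cpx S c).toClass = cls c := by
  rw [cls_apply, WeightedComplex.toClass, mk_eq_mk_iff]
  refine (thin_finrank_kerAt S d).mono fun x hx => ?_
  by_contra hlt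
  have hlt : d ≤ Module.finrank ℝ (kerAt S x) := not_lt.1 hlt
  apply hx
  rcases hlt.lt_or_eq with h | h
  · rw [fn_eq_zero hS h]
    refine Finset.sum_eq_zero fun σ hσ => if_neg fun hxσ => ?_
    obtain ⟨h1, h2, -⟩ := mem_facets_cpx.1 hσ
    obtain ⟨z, rfl⟩ := mem_allCells.1 h1
    have h3 := (mem_intrinsicInterior_signCell.1 hxσ).2
    unfold cellDim at h2
    rw [← h3, vectorSpan_signCell] at h2
    omega
  · rw [fn_eq_mult hS h.symm]
    have hd : cellDim (signCell S x) = d := by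
      unfold cellDim; rw [vectorSpan_signCell, h]
    rw [Finset.sum_eq_single (signCell S x)]
    · rw [if_pos (mem_intrinsicInterior_signCell.2 ⟨self_mem_signCell S x, rfl⟩)]
      rfl
    · intro σ hσ hne
      refine if_neg fun hxσ => hne ?_
      obtain ⟨z, rfl⟩ := mem_allCells.1 (mem_facets_cpx.1 hσ).1
      exact (mem_intrinsicInterior_signCell.1 hxσ).2.symm
    · intro hnot
      rw [if_pos (mem_intrinsicInterior_signCell.2 ⟨self_mem_signCell S x, rfl⟩)]
      by_contra hm
      exact hnot (mem_facets_cpx.2 ⟨mem_allCells.2 ⟨x, rfl⟩, hd, hm⟩)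

/-- The complex of a balanced chain is balanced: each ridge has generic points. -/
theorem isTropical_cpx {S : Finset ((Fin n → ℤ) × ℝ)} {c : Chain n d} (hS : Adapted S c)
    (hc : Bal c) : (cpx S c).IsTropical := by
  refine ⟨isPure_cpx S c, fun τ hτ => ?_⟩
  obtain ⟨h1, h2⟩ := Finset.mem_filter.1 hτ
  obtain ⟨h1, -⟩ := Finset.mem_filter.1 h1
  obtain ⟨x, rfl⟩ := mem_allCells.1 h1
  obtain ⟨N, hN, hb⟩ := hc
  obtain ⟨y, -, hy, hyN⟩ := exists_generic_mem (isRationalPolyhedron_signCell S x)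
    (by omega : d - 1 ≤ _) hN (self_mem_signCell S x) Filter.univ_mem
  have hyx := (mem_intrinsicInterior_signCell.1 hy).2
  rw [← hyx] at h2 ⊢
  have hker : Module.finrank ℝ (kerAt S y) + 1 = d := by
    unfold cellDim at h2
    rwa [vectorSpan_signCell] at h2
  have h3 := sum_mult_sub_dv_mem hS hker
  have h4 := AddSubgroup.add_mem _ h3 (hb y hyN _ hker)
  rw [sub_add_cancel] at h4
  have h5 : cellLattice (signCell S y) = lat (kerAt S y) := by
    rw [← vectorSpan_signCell]; rfl
  rw [h5]
  convert h4 using 1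
  refine Finset.sum_subset (fun C hC => ?_) fun C hC hnot => ?_
  · obtain ⟨h6, h7⟩ := Finset.mem_filter.1 hC
    obtain ⟨h8, h9, -⟩ := mem_facets_cpx.1 h6
    exact Finset.mem_filter.2 ⟨h8, h9, h7 (self_mem_signCell S y)⟩
  · obtain ⟨h6, h7, h8⟩ := Finset.mem_filter.1 hC
    have : mult c C = 0 := by
      by_contra hm
      refine hnot (Finset.mem_filter.2 ⟨mem_facets_cpx.2 ⟨h6, h7, hm⟩, ?_⟩)
      obtain ⟨z, rfl⟩ := mem_allCells.1 h6
      exact signCell_subset h8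
    change mult c C • _ = 0
    rw [this, zero_smul]

end Chain

/-! ### The chain of a weighted complex -/

namespace WeightedComplex

variable {n d : ℕ}

theorem exists_signCell_eq {K : WeightedComplex n d} {σ : Set (Fin n → ℝ)} (hσ : σ ∈ K.cells) :
    ∃ S x, σ = signCell S x := by
  obtain ⟨hne, S, rfl⟩ := isRationalPolyhedron_iff.1 (K.isPolyhedron σ hσ)
  obtain ⟨x, -, h⟩ := exists_poly_eq_signCell hne
  exact ⟨S, x, h⟩

theorem subset_of_mem_intrinsicInterior {K : WeightedComplex n d} {τ σ : Set (Fin n → ℝ)}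
    (hτ : τ ∈ K.cells) (hσ : σ ∈ K.cells) {y : Fin n → ℝ} (hy : y ∈ intrinsicInterior ℝ τ)
    (hyσ : y ∈ σ) : τ ⊆ σ := by
  obtain ⟨S, x, rfl⟩ := exists_signCell_eq hτ
  obtain ⟨h1, h2⟩ := mem_intrinsicInterior_signCell.1 hy
  obtain ⟨a, -, ha⟩ := isFace_signCell_iff.1 (K.inter_face _ hτ _ hσ ⟨y, h1, hyσ⟩).1
  have : y ∈ signCell S a := ha ▸ ⟨h1, hyσ⟩
  have h3 := signCell_subset this
  rw [h2, ← ha] at h3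
  exact h3.trans Set.inter_subset_right

/-- Each point of a complex lies in the relative interior of a unique cell `τ`, and the cells
that contain the point are those that contain `τ`. -/
theorem exists_cell_at {K : WeightedComplex n d} {σ₀ : Set (Fin n → ℝ)} (hσ₀ : σ₀ ∈ K.cells)
    {y : Fin n → ℝ} (hy : y ∈ σ₀) : ∃ τ ∈ K.cells, y ∈ intrinsicInterior ℝ τ ∧
      (∀ σ ∈ K.cells, y ∈ σ ↔ τ ⊆ σ) ∧
      ∀ σ ∈ K.cells, y ∈ σ → lineality σ y = vectorSpan ℝ τ := by
  have key : ∀ σ ∈ K.cells, y ∈ σ → ∃ τ ∈ K.cells, y ∈ intrinsicInterior ℝ τ ∧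
      lineality σ y = vectorSpan ℝ τ := by
    intro σ hσ hyσ
    obtain ⟨S, x, rfl⟩ := exists_signCell_eq hσ
    refine ⟨signCell S y, K.face_mem _ hσ _ (isFace_signCell_iff.2 ⟨y, hyσ, rfl⟩),
      mem_intrinsicInterior_signCell.2 ⟨self_mem_signCell S y, rfl⟩, ?_⟩
    rw [lineality_signCell hyσ, vectorSpan_signCell]
  obtain ⟨τ, hτ, hyτ, -⟩ := key σ₀ hσ₀ hy
  refine ⟨τ, hτ, hyτ, fun σ hσ => ⟨fun h => subset_of_mem_intrinsicInterior hτ hσ hyτ h,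
    fun h => h (intrinsicInterior_subset hyτ)⟩, fun σ hσ h => ?_⟩
  obtain ⟨τ', hτ', hyτ', h'⟩ := key σ hσ h
  have : τ = τ' := (subset_of_mem_intrinsicInterior hτ hτ' hyτ
    (intrinsicInterior_subset hyτ')).antisymm (subset_of_mem_intrinsicInterior hτ' hτ hyτ'
      (intrinsicInterior_subset hyτ))
  rw [h', this]

theorem lineality_eq {K : WeightedComplex n d} {τ σ : Set (Fin n → ℝ)}
    (hτ : τ ∈ K.cells) (hσ : σ ∈ K.cells) {y : Fin n → ℝ} (hy : y ∈ intrinsicInterior ℝ τ)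
    (h : τ ⊆ σ) : lineality σ y = vectorSpan ℝ τ := by
  obtain ⟨τ', hτ', hyτ', -, h'⟩ := exists_cell_at hτ (intrinsicInterior_subset hy)
  have : τ = τ' := (subset_of_mem_intrinsicInterior hτ hτ' hy
    (intrinsicInterior_subset hyτ')).antisymm (subset_of_mem_intrinsicInterior hτ' hτ hyτ'
      (intrinsicInterior_subset hy))
  rw [h' σ hσ (h (intrinsicInterior_subset hy)), this]

/-- The facets with their weights, as a chain. -/
def chain (K : WeightedComplex n d) : Chain n d :=
  ∑ σ ∈ K.facets.attach, Finsupp.single ⟨σ.1, K.isPolyhedron _ (Finset.mem_filter.1 σ.2).1,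
    (Finset.mem_filter.1 σ.2).2⟩ (K.weight σ.1)

theorem linearCombination_chain {A : Type*} [AddCommGroup A] (K : WeightedComplex n d)
    (g : Set (Fin n → ℝ) → A) :
    Finsupp.linearCombination ℤ (fun Q : Cell n d => g Q.1) K.chain =
      ∑ σ ∈ K.facets, K.weight σ • g σ := by
  rw [chain, map_sum]
  simp only [Finsupp.linearCombination_single]
  exact Finset.sum_attach K.facets fun σ => K.weight σ • g σ

theorem support_chain_subset {K : WeightedComplex n d} {Q : Cell n d}
    (hQ : Q ∈ K.chain.support) : Q.1 ∈ K.facets := by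
  have := Finsupp.support_finsetSum hQ
  obtain ⟨σ, -, hσ⟩ := Finset.mem_biUnion.1 this
  have := Finsupp.support_single_subset hσ
  rw [Finset.mem_singleton] at this
  rw [this]
  exact σ.2

theorem fn_chain (K : WeightedComplex n d) : Chain.fn K.chain = fun x =>
    ∑ σ ∈ K.facets, if x ∈ intrinsicInterior ℝ σ then K.weight σ else 0 := by
  rw [Chain.fn, linearCombination_chain K
    (fun Q x => if x ∈ intrinsicInterior ℝ Q then (1 : ℤ) else 0)]
  ext x
  simp [Finset.sum_apply]

theorem cls_chain (K : WeightedComplex n d) : Chain.cls K.chain = K.toClass := by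
  rw [Chain.cls_apply, fn_chain]; rfl

theorem dv_chain (K : WeightedComplex n d) (y : Fin n → ℝ) (L : Submodule ℝ (Fin n → ℝ)) :
    Chain.dv y L K.chain =
      ∑ σ ∈ K.facets.filter (fun σ => y ∈ σ ∧ lineality σ y = L), K.weight σ • pv σ y := by
  rw [Chain.dv, linearCombination_chain K
    (fun Q => if y ∈ Q ∧ lineality Q y = L then pv Q y else 0), Finset.sum_filter]
  exact Finset.sum_congr rfl fun σ _ => by split_ifs <;> simp

theorem primitiveVector_sub_pv_mem {K : WeightedComplex n d} {τ σ : Set (Fin n → ℝ)}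
    (hτ : τ ∈ K.cells) (hσ : σ ∈ K.cells) (hd : cellDim τ + 1 = cellDim σ) {y : Fin n → ℝ}
    (hy : y ∈ intrinsicInterior ℝ τ) (h : τ ⊆ σ) :
    IsPrimAt σ y (primitiveVector τ σ) ∧
      primitiveVector τ σ - pv σ y ∈ lat (vectorSpan ℝ τ) := by
  have hl := lineality_eq hτ hσ hy h
  have hyτ := intrinsicInterior_subset hy
  have hd' : Module.finrank ℝ (lineality σ y) + 1 = cellDim σ := by rw [hl]; exact hd
  have hp := pv_spec (K.isPolyhedron σ hσ) (h hyτ) hd'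
  have hiff := fun v => isPrimitiveVector_iff (v := v) (K.isPolyhedron σ hσ) hyτ h hl.symm
  have h1 : IsPrimAt σ y (primitiveVector τ σ) :=
    (hiff _).1 (Classical.epsilon_spec ⟨_, (hiff _).2 hp⟩)
  exact ⟨h1, hl ▸ h1.sub_mem (K.isPolyhedron σ hσ) (h hyτ) hd' hp⟩

/-- At a point of the relative interior of a ridge, the divergence of the chain of a complex is
the sum over the facets around the ridge. -/
theorem dv_chain_ridge {K : WeightedComplex n d} {τ : Set (Fin n → ℝ)} (hτ : τ ∈ K.ridges)
    {y : Fin n → ℝ} (hy : y ∈ intrinsicInterior ℝ τ) :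
    Chain.dv y (vectorSpan ℝ τ) K.chain = ∑ σ ∈ K.facetsAround τ, K.weight σ • pv σ y := by
  rw [dv_chain]
  refine Finset.sum_congr (Finset.filter_congr fun σ hσ => ?_) fun _ _ => rfl
  have hσ' := (Finset.mem_filter.1 hσ).1
  have hτ' := (Finset.mem_filter.1 hτ).1
  constructor
  · exact fun h => subset_of_mem_intrinsicInterior hτ' hσ' hy h.1
  · exact fun h => ⟨h (intrinsicInterior_subset hy), lineality_eq hτ' hσ' hy h⟩

theorem exists_ridge_of_lineality {K : WeightedComplex n d} {σ : Set (Fin n → ℝ)}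
    (hσ : σ ∈ K.cells) {y : Fin n → ℝ} (hy : y ∈ σ)
    (hL : Module.finrank ℝ (lineality σ y) + 1 = d) :
    ∃ τ ∈ K.ridges, y ∈ intrinsicInterior ℝ τ ∧ vectorSpan ℝ τ = lineality σ y := by
  obtain ⟨τ, hτ, hyτ, -, h⟩ := exists_cell_at hσ hy
  refine ⟨τ, Finset.mem_filter.2 ⟨hτ, ?_⟩, hyτ, (h σ hσ hy).symm⟩
  unfold cellDim
  rw [← h σ hσ hy]
  exact hL

theorem cellDim_of_mem_facets {K : WeightedComplex n d} {σ : Set (Fin n → ℝ)}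
    (hσ : σ ∈ K.facets) : cellDim σ = d := (Finset.mem_filter.1 hσ).2

/-- The chain of a balanced complex is balanced, at all points. -/
theorem dv_chain_mem {K : WeightedComplex n d} (hK : K.IsBalanced) (y : Fin n → ℝ)
    (L : Submodule ℝ (Fin n → ℝ)) (hL : Module.finrank ℝ L + 1 = d) :
    Chain.dv y L K.chain ∈ lat L := by
  by_cases hex : ∃ σ ∈ K.facets, y ∈ σ ∧ lineality σ y = L
  · obtain ⟨σ₀, hσ₀, hy, rfl⟩ := hex
    obtain ⟨τ, hτ, hyτ, h⟩ := exists_ridge_of_lineality (Finset.mem_filter.1 hσ₀).1 hy hL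
    rw [← h, dv_chain_ridge hτ hyτ]
    obtain ⟨hτ1, hτ2⟩ := Finset.mem_filter.1 hτ
    have h1 := hK τ hτ
    have h2 : ∑ σ ∈ K.facetsAround τ, K.weight σ • primitiveVector τ σ -
        ∑ σ ∈ K.facetsAround τ, K.weight σ • pv σ y ∈ lat (vectorSpan ℝ τ) := by
      rw [← Finset.sum_sub_distrib]
      refine AddSubgroup.sum_mem _ fun σ hσ => ?_
      obtain ⟨hσ1, hσ2⟩ := Finset.mem_filter.1 hσ
      rw [← smul_sub]
      exact AddSubgroup.zsmul_mem _ (primitiveVector_sub_pv_mem hτ1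
        (Finset.mem_filter.1 hσ1).1 (by rw [hτ2, cellDim_of_mem_facets hσ1]) hyτ hσ2).2 _
    have := AddSubgroup.sub_mem _ h1 h2
    rwa [sub_sub_cancel] at this
  · rw [dv_chain, Finset.filter_eq_empty_iff.2 fun σ hσ h => hex ⟨σ, hσ, h⟩, Finset.sum_empty]
    exact zero_mem _

theorem bal_chain {K : WeightedComplex n d} (hK : K.IsBalanced) : Chain.Bal K.chain :=
  ⟨∅, thin_empty, fun y _ L hL => dv_chain_mem hK y L hL⟩

end WeightedComplex

/-! ### Supports -/

theorem WeightedComplex.eq_of_mem_intrinsicInterior {n d : ℕ} {K : WeightedComplex n d}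
    {τ σ : Set (Fin n → ℝ)} (hτ : τ ∈ K.cells) (hσ : σ ∈ K.cells) {y : Fin n → ℝ}
    (hy : y ∈ intrinsicInterior ℝ τ) (hy' : y ∈ intrinsicInterior ℝ σ) : τ = σ :=
  (subset_of_mem_intrinsicInterior hτ hσ hy (intrinsicInterior_subset hy')).antisymm
    (subset_of_mem_intrinsicInterior hσ hτ hy' (intrinsicInterior_subset hy))

theorem WeightedComplex.fn_chain_of_mem {n d : ℕ} {K : WeightedComplex n d}
    {σ : Set (Fin n → ℝ)} (hσ : σ ∈ K.facets) {x : Fin n → ℝ}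
    (hx : x ∈ intrinsicInterior ℝ σ) : Chain.fn K.chain x = K.weight σ := by
  rw [K.fn_chain]
  refine (Finset.sum_eq_single_of_mem σ hσ fun σ' hσ' hne => if_neg fun h => hne ?_).trans
    (if_pos hx)
  exact eq_of_mem_intrinsicInterior (Finset.mem_filter.1 hσ').1 (Finset.mem_filter.1 hσ).1 h hx

/-- The support of a cycle lies in the union of the polyhedra of each chain that represents
it. -/
theorem TropicalCycle.exists_mem_of_mem_support {n d : ℕ} {X : TropicalCycle n d}
    {c : Chain n d} (hc : c.cls = X.1) {x : Fin n → ℝ} (hx : x ∈ X.support) :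
    ∃ Q ∈ c.support, x ∈ Q.1 := by
  obtain ⟨K, ⟨-, hKX⟩, σ, hσ, hw, hxσ⟩ := hx
  by_contra! hcon
  have hU : ∀ᶠ z in 𝓝 x, ∀ Q ∈ c.support, z ∉ Q.1 :=
    (eventually_all_finset _).2 fun Q hQ => Q.2.1.isClosed.isOpen_compl.mem_nhds (hcon Q hQ)
  have hcls : Chain.cls K.chain = c.cls := by rw [K.cls_chain, hKX, hc]
  rw [Chain.cls_apply, Chain.cls_apply, mk_eq_mk_iff] at hcls
  obtain ⟨hσ1, hσ2⟩ := Finset.mem_filter.1 hσ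
  obtain ⟨z, hzU, hz, hzN⟩ := exists_generic_mem (K.isPolyhedron σ hσ1) hσ2.ge hcls hxσ hU
  apply hzN
  change Chain.fn K.chain z ≠ Chain.fn c z
  rw [WeightedComplex.fn_chain_of_mem hσ hz, Chain.fn_apply, Finset.sum_eq_zero]
  · exact hw
  · exact fun Q hQ => if_neg fun h => hzU Q hQ (intrinsicInterior_subset h)

theorem WeightedComplex.IsStructureOf.cell_subset_support {n d : ℕ} {K : WeightedComplex n d}
    {X : TropicalCycle n d} (hK : K.IsStructureOf X) (hr : K.IsReduced) {σ : Set (Fin n → ℝ)}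
    (hσ : σ ∈ K.cells) : σ ⊆ X.support := by
  obtain ⟨σ', hσ', hsub⟩ := hK.1.1 σ hσ
  exact fun x hx => ⟨K, hK, σ', hσ', hr σ' hσ', hsub hx⟩

/-! ### Push-forward of chains -/

theorem Thin.image {m n d : ℕ} (f : IntAffineMap m n) {N : Set (Fin m → ℝ)} (h : Thin d N) :
    Thin d (f.toFun '' N) := by
  obtain ⟨T, hT, hN⟩ := h
  refine (thin_biUnion T (N := fun H => f.toFun '' (H : Set (Fin m → ℝ))) fun H hH =>
    thin_of_cellDim ?_).mono ?_
  · unfold cellDim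
    rw [f.vectorSpan_image]
    refine (Submodule.finrank_map_le _ _).trans_lt ?_
    exact hT H hH
  · rintro _ ⟨x, hx, rfl⟩
    obtain ⟨H, hH, h⟩ := hN x hx
    exact Set.mem_biUnion (Finset.mem_coe.2 hH) ⟨x, h, rfl⟩

namespace IntAffineMap

variable {m n d : ℕ} (f : IntAffineMap m n)

theorem inj_of_cellDim {Q : Cell m d} (h : cellDim (f.toFun '' Q.1) = d) :
    ∀ x ∈ vectorSpan ℝ Q.1, f.linMap x = 0 → x = 0 :=
  (f.cellDim_image_eq_iff Q.1).1 (h.trans Q.2.2.symm)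

/-- The push-forward of a polyhedron: its image with the lattice index as weight, if the
dimension does not drop. -/
def pushCell (Q : Cell m d) : Chain n d :=
  if h : cellDim (f.toFun '' Q.1) = d then
    Finsupp.single ⟨f.toFun '' Q.1, Q.2.1.image (f.inj_of_cellDim h), h⟩
      (f.idx (vectorSpan ℝ Q.1) : ℤ)
  else 0

/-- The push-forward of chains. -/
def push : Chain m d →ₗ[ℤ] Chain n d := Finsupp.linearCombination ℤ f.pushCell

theorem linearCombination_push {A : Type*} [AddCommGroup A] (g : Set (Fin n → ℝ) → A)
    (c : Chain m d) : Finsupp.linearCombination ℤ (fun Q : Cell n d => g Q.1) (f.push c) =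
      ∑ Q ∈ c.support, c Q • if cellDim (f.toFun '' Q.1) = d then
        (f.idx (vectorSpan ℝ Q.1) : ℤ) • g (f.toFun '' Q.1) else 0 := by
  have h0 : f.push c = ∑ Q ∈ c.support, c Q • f.pushCell Q := Finsupp.linearCombination_apply ℤ c
  rw [h0, map_sum]
  refine Finset.sum_congr rfl fun Q _ => ?_
  rw [map_smul, pushCell]
  split_ifs with h <;> simp

theorem exists_of_mem_support_push {c : Chain m d} {R : Cell n d}
    (hR : R ∈ (f.push c).support) : ∃ Q ∈ c.support, R.1 = f.toFun '' Q.1 := by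
  rw [push, Finsupp.linearCombination_apply] at hR
  obtain ⟨Q, hQ, h⟩ := Finset.mem_biUnion.1 (Finsupp.support_finsetSum hR)
  refine ⟨Q, hQ, ?_⟩
  have h := Finsupp.support_smul h
  rw [pushCell] at h
  split_ifs at h with hd
  · have := Finset.mem_singleton.1 (Finsupp.support_single_subset h)
    rw [this]
  · simp at h

theorem fn_push (c : Chain m d) (y : Fin n → ℝ) : Chain.fn (f.push c) y =
    ∑ Q ∈ c.support, if cellDim (f.toFun '' Q.1) = d ∧
      y ∈ intrinsicInterior ℝ (f.toFun '' Q.1) then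
        c Q * (f.idx (vectorSpan ℝ Q.1) : ℤ) else 0 := by
  rw [Chain.fn, f.linearCombination_push (fun Q x => if x ∈ intrinsicInterior ℝ Q then (1 : ℤ)
    else 0), Finset.sum_apply]
  refine Finset.sum_congr rfl fun Q _ => ?_
  by_cases h1 : cellDim (f.toFun '' Q.1) = d <;>
    by_cases h2 : y ∈ intrinsicInterior ℝ (f.toFun '' Q.1) <;>
      simp [h1, h2, -mem_intrinsicInterior]

theorem cls_push_chain (K : WeightedComplex m d) :
    Chain.cls (f.push K.chain) = K.pushforward f := by
  rw [Chain.cls_apply, WeightedComplex.pushforward]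
  congr 1
  ext y
  have h1 : Chain.fn (f.push K.chain) y = Finsupp.linearCombination ℤ
      (fun Q : Cell m d => if cellDim (f.toFun '' Q.1) = d ∧
        y ∈ intrinsicInterior ℝ (f.toFun '' Q.1) then
          (f.idx (vectorSpan ℝ Q.1) : ℤ) else 0) K.chain := by
    rw [f.fn_push, Finsupp.linearCombination_apply, Finsupp.sum]
    exact Finset.sum_congr rfl fun Q _ => by split_ifs <;> simp
  rw [h1, K.linearCombination_chain (fun Q => if cellDim (f.toFun '' Q) = d ∧
        y ∈ intrinsicInterior ℝ (f.toFun '' Q) then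
          (f.idx (vectorSpan ℝ Q) : ℤ) else 0), Finset.sum_filter]
  refine Finset.sum_congr rfl fun σ _ => ?_
  rw [f.latticeIndex_eq]
  by_cases h1 : cellDim (f.toFun '' σ) = d <;>
    by_cases h2 : y ∈ intrinsicInterior ℝ (f.toFun '' σ) <;> simp [h1, h2, mul_comm, -mem_intrinsicInterior]

/-- The push-forward of chains only depends on the class of the chain: the points of a generic
fiber can be treated separately. -/
theorem cls_push_eq_zero {c : Chain m d} (hc : c.cls = 0) : Chain.cls (f.push c) = 0 := by
  rw [Chain.cls_apply, mk_eq_zero_iff] at hc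
  -- points where polyhedra of the chain with different directions meet
  have hW : Thin d (⋃ p ∈ (c.support ×ˢ c.support).filter
      (fun p => vectorSpan ℝ p.1.1 ≠ vectorSpan ℝ p.2.1), p.1.1 ∩ p.2.1) := by
    refine thin_biUnion _ fun p hp => thin_of_cellDim ?_
    have hne := (Finset.mem_filter.1 hp).2
    have h1 : vectorSpan ℝ (p.1.1 ∩ p.2.1) ≤ vectorSpan ℝ p.1.1 :=
      vectorSpan_mono ℝ Set.inter_subset_left
    have h2 : vectorSpan ℝ (p.1.1 ∩ p.2.1) ≤ vectorSpan ℝ p.2.1 :=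
      vectorSpan_mono ℝ Set.inter_subset_right
    have d1 : Module.finrank ℝ (vectorSpan ℝ p.1.1) = d := p.1.2.2
    have d2 : Module.finrank ℝ (vectorSpan ℝ p.2.1) = d := p.2.2.2
    by_contra hlt
    have hlt : d ≤ Module.finrank ℝ (vectorSpan ℝ (p.1.1 ∩ p.2.1)) := not_lt.1 hlt
    exact hne ((Submodule.eq_of_le_of_finrank_le h1 (by omega)).symm.trans
      (Submodule.eq_of_le_of_finrank_le h2 (by omega)))
  rw [Chain.cls_apply, mk_eq_zero_iff]
  refine ((hc.union hW).image f).mono fun y hy => ?_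
  by_contra hyM
  apply hy
  rw [f.fn_push, ← Finset.sum_filter]
  set s := c.support.filter fun Q => cellDim (f.toFun '' Q.1) = d ∧
      y ∈ intrinsicInterior ℝ (f.toFun '' Q.1) with hs
  -- a preimage of `y` in each polyhedron whose image contributes; by injectivity it is unique
  have hx : ∀ Q : Cell m d, ∃ x, Q ∈ s → x ∈ intrinsicInterior ℝ Q.1 ∧ f.toFun x = y := by
    intro Q
    by_cases hQ : Q ∈ s
    · obtain ⟨-, h1, h2⟩ := Finset.mem_filter.1 hQ
      obtain ⟨x, hx, hxy⟩ :=
        (mem_intrinsicInterior_image Q.2.1 (f.inj_of_cellDim h1)).1 h2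
      exact ⟨x, fun _ => ⟨hx, hxy⟩⟩
    · exact ⟨0, fun h => absurd h hQ⟩
  choose x hx using hx
  rw [← Finset.sum_fiberwise_of_maps_to (t := s.image x)
    (fun Q hQ => Finset.mem_image_of_mem x hQ)]
  refine Finset.sum_eq_zero fun z hz => ?_
  obtain ⟨Q₀, hQ₀, rfl⟩ := Finset.mem_image.1 hz
  obtain ⟨hx₀, hfx₀⟩ := hx Q₀ hQ₀
  have hgen : x Q₀ ∉ {x | Chain.fn c x ≠ 0} ∪ _ := fun h => hyM ⟨_, h, hfx₀⟩
  rw [Set.mem_union, not_or] at hgen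
  have hV : ∀ Q ∈ c.support, x Q₀ ∈ Q.1 → vectorSpan ℝ Q.1 = vectorSpan ℝ Q₀.1 := by
    intro Q hQ hxQ
    by_contra hne
    refine hgen.2 (Set.mem_biUnion (x := (Q, Q₀)) ?_ ⟨hxQ, intrinsicInterior_subset hx₀⟩)
    exact Finset.mem_coe.2 (Finset.mem_filter.2 ⟨Finset.mem_product.2
      ⟨hQ, (Finset.mem_filter.1 hQ₀).1⟩, hne⟩)
  -- near one point of the fiber, the lattice index is constant and the weights sum up to `fn c`
  have hset : s.filter (fun Q => x Q = x Q₀) =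
      c.support.filter fun Q => x Q₀ ∈ intrinsicInterior ℝ Q.1 := by
    ext Q
    simp only [Finset.mem_filter]
    constructor
    · rintro ⟨hQ, h⟩
      exact ⟨(Finset.mem_filter.1 hQ).1, h ▸ (hx Q hQ).1⟩
    · rintro ⟨hQ, h⟩
      have hVQ := hV Q hQ (intrinsicInterior_subset h)
      have hinj₀ := f.inj_of_cellDim (Finset.mem_filter.1 hQ₀).2.1
      have hinj : ∀ x ∈ vectorSpan ℝ Q.1, f.linMap x = 0 → x = 0 := by rw [hVQ]; exact hinj₀
      have hQs : Q ∈ s := Finset.mem_filter.2 ⟨hQ,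
        ((f.cellDim_image_eq_iff Q.1).2 hinj).trans Q.2.2,
        (mem_intrinsicInterior_image Q.2.1 hinj).2 ⟨_, h, hfx₀⟩⟩
      exact ⟨hQs, eq_of_toFun_eq hinj (intrinsicInterior_subset (hx Q hQs).1)
        (intrinsicInterior_subset h) ((hx Q hQs).2.trans hfx₀.symm)⟩
  rw [hset]
  have h1 : ∀ Q ∈ c.support.filter fun Q => x Q₀ ∈ intrinsicInterior ℝ Q.1,
      c Q * (f.idx (vectorSpan ℝ Q.1) : ℤ) = c Q * (f.idx (vectorSpan ℝ Q₀.1) : ℤ) := by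
    intro Q hQ
    obtain ⟨h1, h2⟩ := Finset.mem_filter.1 hQ
    rw [hV Q h1 (intrinsicInterior_subset h2)]
  rw [Finset.sum_congr rfl h1, ← Finset.sum_mul, Finset.sum_filter, ← Chain.fn_apply]
  have h2 : Chain.fn c (x Q₀) = 0 := by
    by_contra h
    exact hgen.1 h
  rw [h2, zero_mul]

theorem cls_push_congr {c c' : Chain m d} (h : c.cls = c'.cls) :
    Chain.cls (f.push c) = Chain.cls (f.push c') := by
  have := f.cls_push_eq_zero (c := c - c') (by rw [map_sub, h, sub_self])
  rwa [map_sub, map_sub, sub_eq_zero] at this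

/-- The divergence of a single polyhedron under push-forward. -/
theorem idx_smul_pv_sub_mem {Q : Cell m d} (hQ : cellDim (f.toFun '' Q.1) = d)
    {x : Fin m → ℝ} (hx : x ∈ Q.1) (hL : Module.finrank ℝ (lineality Q.1 x) + 1 = d) :
    (f.idx (vectorSpan ℝ Q.1) : ℤ) • pv (f.toFun '' Q.1) (f.toFun x) -
      (f.idx (lineality Q.1 x) : ℤ) • f.lin.mulVec (pv Q.1 x) ∈
        lat ((lineality Q.1 x).map f.linMap) := by
  have hinj := f.inj_of_cellDim hQ
  have hlin := lineality_image hinj hx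
  have hspan := f.vectorSpan_image Q.1
  have hrat := Q.2.1.image hinj
  have hle := lineality_le_vectorSpan hx
  have hd1 : Module.finrank ℝ (lineality Q.1 x) + 1 = cellDim Q.1 := by rw [hL, Q.2.2]
  have hd2 : Module.finrank ℝ (lineality (f.toFun '' Q.1) (f.toFun x)) + 1 =
      cellDim (f.toFun '' Q.1) := by
    rw [hlin, (finrank_map_eq_iff _ _).2 fun v hv => hinj v (hle hv), hL, hQ]
  have hfx : f.toFun x ∈ f.toFun '' Q.1 := ⟨x, hx, rfl⟩
  have hp := pv_spec Q.2.1 hx hd1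
  have hp' := pv_spec hrat hfx hd2
  obtain ⟨b, hb, hbpos, -⟩ := exists_facetForm hrat hfx hd2
  have h1 := hp'.pos hrat hd2 hb hbpos
  have hmem : castVec n (f.lin.mulVec (pv Q.1 x)) ∈ (vectorSpan ℝ Q.1).map f.linMap :=
    ⟨_, hp.1, f.linMap_castVec _⟩
  have h2 : 0 < b ⬝ᵥ (f.lin.mulVec (pv Q.1 x)) := by
    obtain ⟨ε, hε, hm⟩ := hp.2.2
    have h3 := hbpos _ ⟨_, hm, rfl⟩
    rw [f.toFun_add, add_sub_cancel_left, map_smul, f.linMap_castVec, map_smul, smul_eq_mul] at h3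
    have h4 := nonneg_of_mul_nonneg_right h3 hε
    rw [intForm_castVec] at h4
    refine lt_of_le_of_ne (by exact_mod_cast h4) fun h0 => hp.notMem Q.2.1 hd1 ?_
    have h5 := (hb _ (hspan ▸ hmem)).2 (by rw [intForm_castVec, ← h0]; simp)
    rw [hlin] at h5
    obtain ⟨w, hw, hwv⟩ := h5
    rw [← f.linMap_castVec] at hwv
    have := hinj (w - castVec m (pv Q.1 x)) (Submodule.sub_mem _ (hle hw) hp.1)
      (by rw [map_sub, hwv, sub_self])
    rw [sub_eq_zero] at this
    rw [← this]; exact hw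
  rw [hlin, hspan] at hb
  have hp1 := hp'.1
  have hp2 := hp'.2.1
  rw [hspan] at hp1 hp2
  rw [hlin] at hp2
  exact f.idx_smul_sub_mem hle hinj hp.1 hp.2.1 hp1 hp2 hb h1 h2

/-- The push-forward of a balanced chain is balanced: the divergence at a generic point is the
sum of the images of the divergences at the points of the fiber. -/
theorem bal_push {c : Chain m d} (hc : c.Bal) : (f.push c).Bal := by
  obtain ⟨N, hN, hb⟩ := hc
  refine ⟨_, hN.image f, fun y hy L hL => ?_⟩
  rw [Chain.dv, f.linearCombination_push
    (fun Q => if y ∈ Q ∧ lineality Q y = L then pv Q y else 0)]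
  set s := c.support.filter fun Q => cellDim (f.toFun '' Q.1) = d ∧ y ∈ f.toFun '' Q.1 ∧
    lineality (f.toFun '' Q.1) y = L with hs
  -- a preimage of `y` in each polyhedron whose image contributes to the divergence
  have hx : ∀ Q : Cell m d, ∃ x, Q ∈ s → x ∈ Q.1 ∧ f.toFun x = y := by
    intro Q
    by_cases hQ : Q ∈ s
    · obtain ⟨x, hx⟩ := (Finset.mem_filter.1 hQ).2.2.1
      exact ⟨x, fun _ => hx⟩
    · exact ⟨0, fun h => absurd h hQ⟩
  choose x hx using hx
  let P := s.image fun Q => (x Q, lineality Q.1 (x Q))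
  have hP : ∀ p ∈ P, f.toFun p.1 = y ∧ p.2.map f.linMap = L ∧
      Module.finrank ℝ p.2 + 1 = d := by
    intro p hp
    obtain ⟨Q, hQ, rfl⟩ := Finset.mem_image.1 hp
    obtain ⟨-, h1, -, h2⟩ := Finset.mem_filter.1 hQ
    obtain ⟨hxQ, hxy⟩ := hx Q hQ
    have hinj := f.inj_of_cellDim h1
    have h3 := lineality_image hinj hxQ
    rw [hxy, h2] at h3
    refine ⟨hxy, h3.symm, ?_⟩
    have h4 := (finrank_map_eq_iff f.linMap _).2
      fun v hv => hinj v (lineality_le_vectorSpan hxQ hv)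
    change Module.finrank ℝ (lineality Q.1 (x Q)) + 1 = d
    rw [← h4, ← h3]
    exact hL
  -- the contribution of `Q` comes from a single pair of a preimage and a subspace; polyhedra whose
  -- dimension drops contribute to the divergences upstairs, but with vectors that are mapped to `L`
  have key : ∀ Q ∈ c.support, (if cellDim (f.toFun '' Q.1) = d then
      (f.idx (vectorSpan ℝ Q.1) : ℤ) • (if y ∈ f.toFun '' Q.1 ∧ lineality (f.toFun '' Q.1) y = L
        then pv (f.toFun '' Q.1) y else 0) else 0) -
      ∑ p ∈ P, (if p.1 ∈ Q.1 ∧ lineality Q.1 p.1 = p.2 then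
        (f.idx p.2 : ℤ) • f.lin.mulVec (pv Q.1 p.1) else 0) ∈ lat L := by
    intro Q hQ
    by_cases hQs : Q ∈ s
    · obtain ⟨-, h1, h2⟩ := Finset.mem_filter.1 hQs
      obtain ⟨hxQ, hxy⟩ := hx Q hQs
      have hinj := f.inj_of_cellDim h1
      rw [if_pos h1, if_pos h2, Finset.sum_eq_single_of_mem (x Q, lineality Q.1 (x Q))
        (Finset.mem_image_of_mem (fun Q => (x Q, lineality Q.1 (x Q))) hQs), if_pos ⟨hxQ, rfl⟩]
      · have hp := hP _ (Finset.mem_image_of_mem (fun Q => (x Q, lineality Q.1 (x Q))) hQs)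
        have := f.idx_smul_pv_sub_mem h1 hxQ hp.2.2
        rw [hp.2.1, hxy] at this
        exact this
      · rintro p hp hne
        refine if_neg fun h => hne ?_
        have := eq_of_toFun_eq hinj h.1 hxQ ((hP p hp).1.trans hxy.symm)
        rw [← this, h.2]
    · have h0 : (if cellDim (f.toFun '' Q.1) = d then (f.idx (vectorSpan ℝ Q.1) : ℤ) •
          (if y ∈ f.toFun '' Q.1 ∧ lineality (f.toFun '' Q.1) y = L
            then pv (f.toFun '' Q.1) y else 0) else 0) = 0 := by
        split_ifs with h1 h2
        · exact absurd (Finset.mem_filter.2 ⟨hQ, h1, h2⟩) hQs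
        · simp
        · rfl
      rw [h0, zero_sub]
      refine AddSubgroup.neg_mem _ (AddSubgroup.sum_mem _ fun p hp => ?_)
      split_ifs with h
      swap
      · exact zero_mem _
      obtain ⟨hp1, hp2, hp3⟩ := hP p hp
      refine AddSubgroup.zsmul_mem _ ?_ _
      have hle : L ≤ (vectorSpan ℝ Q.1).map f.linMap := by
        rw [← hp2, ← h.2]
        exact Submodule.map_mono (lineality_le_vectorSpan h.1)
      have hlt : Module.finrank ℝ ((vectorSpan ℝ Q.1).map f.linMap) ≠ d := by
        intro heq
        have hd : cellDim (f.toFun '' Q.1) = d := by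
          unfold cellDim; rw [f.vectorSpan_image, heq]
        refine hQs (Finset.mem_filter.2 ⟨hQ, hd, ⟨_, h.1, hp1⟩, ?_⟩)
        rw [← hp1, lineality_image (f.inj_of_cellDim hd) h.1, h.2, hp2]
      have hle' : Module.finrank ℝ ((vectorSpan ℝ Q.1).map f.linMap) ≤ d :=
        (Submodule.finrank_map_le _ _).trans_eq Q.2.2
      have heq : L = (vectorSpan ℝ Q.1).map f.linMap :=
        Submodule.eq_of_le_of_finrank_le hle (by omega)
      rw [mem_lat, heq, ← f.linMap_castVec]
      refine ⟨_, ?_, rfl⟩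
      exact (pv_spec Q.2.1 h.1 (by rw [h.2, hp3, Q.2.2])).1
  have hsum : ∑ Q ∈ c.support, c Q • ∑ p ∈ P, (if p.1 ∈ Q.1 ∧ lineality Q.1 p.1 = p.2 then
        (f.idx p.2 : ℤ) • f.lin.mulVec (pv Q.1 p.1) else 0) ∈ lat L := by
    have : ∑ Q ∈ c.support, c Q • ∑ p ∈ P, (if p.1 ∈ Q.1 ∧ lineality Q.1 p.1 = p.2 then
        (f.idx p.2 : ℤ) • f.lin.mulVec (pv Q.1 p.1) else 0) =
        ∑ p ∈ P, (f.idx p.2 : ℤ) • f.lin.mulVec (Chain.dv p.1 p.2 c) := by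
      simp only [Finset.smul_sum]
      rw [Finset.sum_comm]
      refine Finset.sum_congr rfl fun p _ => ?_
      rw [Chain.dv_apply, ← Matrix.mulVecLin_apply, map_sum, Finset.smul_sum]
      refine Finset.sum_congr rfl fun Q _ => ?_
      split_ifs
      · rw [map_smul, smul_comm, Matrix.mulVecLin_apply]
      · simp
    rw [this]
    refine AddSubgroup.sum_mem _ fun p hp => AddSubgroup.zsmul_mem _ ?_ _
    obtain ⟨hp1, hp2, hp3⟩ := hP p hp
    have := hb p.1 (fun h => hy ⟨_, h, hp1⟩) p.2 hp3
    rw [mem_lat, ← hp2, ← f.linMap_castVec]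
    exact ⟨_, this, rfl⟩
  have htot := AddSubgroup.sum_mem (lat L) fun Q hQ =>
    AddSubgroup.zsmul_mem (lat L) (key Q hQ) (c Q)
  simp only [smul_sub, Finset.sum_sub_distrib] at htot
  have := AddSubgroup.add_mem _ htot hsum
  rwa [sub_add_cancel] at this

end IntAffineMap

/-! ### Linear parts and divisor weights -/

theorem IsLinearPart.eqOn {n : ℕ} {φ : (Fin n → ℝ) → ℝ} {σ : Set (Fin n → ℝ)}
    {A B : Fin n → ℤ} (hA : IsLinearPart φ σ A) (hB : IsLinearPart φ σ B) {v : Fin n → ℝ}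
    (hv : v ∈ vectorSpan ℝ σ) : intForm A v = intForm B v := by
  obtain ⟨a, ha⟩ := hA
  obtain ⟨b, hb⟩ := hB
  have hle : vectorSpan ℝ σ ≤ LinearMap.eqLocus (intForm A) (intForm B) := by
    rw [vectorSpan, Submodule.span_le]
    rintro _ ⟨x, hx, y, hy, rfl⟩
    have h1 := ha x hx
    have h2 := ha y hy
    have h3 := hb x hx
    have h4 := hb y hy
    rw [← intForm_apply] at h1 h2 h3 h4
    simp only [SetLike.mem_coe, LinearMap.mem_eqLocus, vsub_eq_sub, map_sub]
    linarith
  exact hle hv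

theorem IsLinearPart.dotProduct_eq {n : ℕ} {φ : (Fin n → ℝ) → ℝ} {σ : Set (Fin n → ℝ)}
    {A B : Fin n → ℤ} (hA : IsLinearPart φ σ A) (hB : IsLinearPart φ σ B) {v : Fin n → ℤ}
    (hv : v ∈ lat (vectorSpan ℝ σ)) : A ⬝ᵥ v = B ⬝ᵥ v := by
  have := hA.eqOn hB hv
  rw [intForm_castVec, intForm_castVec] at this
  exact_mod_cast this

theorem IsLinearPart.mono {n : ℕ} {φ : (Fin n → ℝ) → ℝ} {σ τ : Set (Fin n → ℝ)}
    {A : Fin n → ℤ} (hA : IsLinearPart φ σ A) (h : τ ⊆ σ) : IsLinearPart φ τ A :=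
  ⟨hA.choose, fun x hx => hA.choose_spec x (h hx)⟩

theorem IsLinearPart.sub {n : ℕ} {φ ψ : (Fin n → ℝ) → ℝ} {σ : Set (Fin n → ℝ)}
    {A B : Fin n → ℤ} (hA : IsLinearPart φ σ A) (hB : IsLinearPart ψ σ B) :
    IsLinearPart (fun x => φ x - ψ x) σ (A - B) := by
  obtain ⟨a, ha⟩ := hA
  obtain ⟨b, hb⟩ := hB
  refine ⟨a - b, fun x hx => ?_⟩
  simp only [ha x hx, hb x hx, Pi.sub_apply, Int.cast_sub, sub_mul, Finset.sum_sub_distrib]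
  ring

namespace WeightedComplex

variable {n d : ℕ}

/-- The weight of a divisor at a ridge does not depend on the choice of the linear parts and of
the primitive vectors. -/
theorem divisorWeight_eq {K : WeightedComplex n d} (hK : K.IsBalanced) {φ : (Fin n → ℝ) → ℝ}
    {τ : Set (Fin n → ℝ)} (hτ : τ ∈ K.ridges) {y : Fin n → ℝ}
    (hy : y ∈ intrinsicInterior ℝ τ) {A : Set (Fin n → ℝ) → Fin n → ℤ}
    (hA : ∀ σ ∈ K.facetsAround τ, IsLinearPart φ σ (A σ)) {B : Fin n → ℤ}
    (hB : IsLinearPart φ τ B) :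
    K.divisorWeight φ τ = ∑ σ ∈ K.facetsAround τ, K.weight σ * (A σ ⬝ᵥ pv σ y) -
      B ⬝ᵥ ∑ σ ∈ K.facetsAround τ, K.weight σ • pv σ y := by
  obtain ⟨hτ1, hτ2⟩ := Finset.mem_filter.1 hτ
  have hBτ : IsLinearPart φ τ (linearPart φ τ) := Classical.epsilon_spec ⟨B, hB⟩
  have h1 : linearPart φ τ ⬝ᵥ ∑ σ ∈ K.facetsAround τ, K.weight σ • primitiveVector τ σ =
      B ⬝ᵥ ∑ σ ∈ K.facetsAround τ, K.weight σ • primitiveVector τ σ :=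
    hBτ.dotProduct_eq hB (hK τ hτ)
  rw [divisorWeight, h1, ← sub_eq_zero]
  have h2 : ∀ σ ∈ K.facetsAround τ,
      K.weight σ * (linearPart φ σ ⬝ᵥ primitiveVector τ σ) -
        K.weight σ * (B ⬝ᵥ primitiveVector τ σ) =
      K.weight σ * (A σ ⬝ᵥ pv σ y) - K.weight σ * (B ⬝ᵥ pv σ y) := by
    intro σ hσ
    obtain ⟨hσ1, hσ2⟩ := Finset.mem_filter.1 hσ
    have hd : cellDim τ + 1 = cellDim σ := by rw [hτ2, cellDim_of_mem_facets hσ1]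
    obtain ⟨hp, hsub⟩ :=
      primitiveVector_sub_pv_mem hτ1 (Finset.mem_filter.1 hσ1).1 hd hy hσ2
    have hAσ : IsLinearPart φ σ (linearPart φ σ) := Classical.epsilon_spec ⟨_, hA σ hσ⟩
    have h3 := hAσ.dotProduct_eq (hA σ hσ) hp.1
    have h4 := ((hA σ hσ).mono hσ2).dotProduct_eq hB hsub
    rw [dotProduct_sub, dotProduct_sub] at h4
    rw [h3]
    linear_combination (K.weight σ) * h4
  have h5 := Finset.sum_congr rfl h2
  simp only [Finset.sum_sub_distrib] at h5
  simp only [dotProduct_sum, dotProduct_smul, smul_eq_mul]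
  linear_combination h5

theorem mem_facets_divisor {K : WeightedComplex n (d + 1)} {φ : (Fin n → ℝ) → ℝ}
    {τ : Set (Fin n → ℝ)} : τ ∈ (K.divisor φ).facets ↔ τ ∈ K.ridges := by
  simp only [facets, ridges, divisor, Finset.mem_filter]
  constructor
  · rintro ⟨⟨h1, -⟩, h2⟩
    exact ⟨h1, by omega⟩
  · rintro ⟨h1, h2⟩
    exact ⟨⟨h1, by omega⟩, by omega⟩

theorem facets_divisor (K : WeightedComplex n (d + 1)) (φ : (Fin n → ℝ) → ℝ) :
    (K.divisor φ).facets = K.ridges := Finset.ext fun _ => mem_facets_divisor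

end WeightedComplex

/-! ### Truncation of chains at a height -/

/-- The integral linear form `t`, the last coordinate. -/
def lastForm (n : ℕ) : Fin (n + 1) → ℤ := Pi.single (Fin.last n) 1

theorem lastForm_dotProduct {n : ℕ} (v : Fin (n + 1) → ℤ) :
    lastForm n ⬝ᵥ v = v (Fin.last n) := by simp [lastForm]

theorem intForm_lastForm {n : ℕ} (x : Fin (n + 1) → ℝ) :
    intForm (lastForm n) x = x (Fin.last n) := by
  rw [intForm_apply, Finset.sum_eq_single (Fin.last n)]
  · simp [lastForm]
  · intro i _ hi; simp [lastForm, hi]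
  · simp

theorem gap_lastForm {n : ℕ} (p : ℝ) (x : Fin (n + 1) → ℝ) :
    gap (lastForm n, p) x = x (Fin.last n) - p := by rw [gap, intForm_lastForm]

theorem poly_insert {n : ℕ} (c : (Fin n → ℤ) × ℝ) (S : Finset ((Fin n → ℤ) × ℝ)) :
    poly (insert c S) = poly S ∩ {x | 0 ≤ gap c x} := by
  ext x
  simp [poly, and_comm]

theorem kerAt_insert_of_ne {n : ℕ} {c : (Fin n → ℤ) × ℝ} (S : Finset ((Fin n → ℤ) × ℝ))
    {x : Fin n → ℝ} (h : gap c x ≠ 0) : kerAt (insert c S) x = kerAt S x := by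
  ext v
  simp [mem_kerAt, h]

theorem intForm_eq_zero_of_const {n : ℕ} {a : Fin n → ℤ} {b : ℝ}
    {Q : Set (Fin n → ℝ)} (h : ∀ x ∈ Q, intForm a x = b) {v : Fin n → ℝ}
    (hv : v ∈ vectorSpan ℝ Q) : intForm a v = 0 := by
  have hle : vectorSpan ℝ Q ≤ LinearMap.ker (intForm a) := by
    rw [vectorSpan, Submodule.span_le]
    rintro _ ⟨x, hx, y, hy, rfl⟩
    simp [h x hx, h y hy]
  exact hle hv

/-- The part of `Q` where the last coordinate is at least `p`. -/
def upper {n : ℕ} (p : ℝ) (Q : Set (Fin (n + 1) → ℝ)) : Set (Fin (n + 1) → ℝ) :=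
  Q ∩ {x | p ≤ x (Fin.last n)}

theorem IsRationalPolyhedron.upper {n : ℕ} {p : ℝ} {Q : Set (Fin (n + 1) → ℝ)}
    (hQ : IsRationalPolyhedron Q) (hne : (upper p Q).Nonempty) :
    IsRationalPolyhedron (upper p Q) := by
  obtain ⟨-, S, rfl⟩ := isRationalPolyhedron_iff.1 hQ
  refine isRationalPolyhedron_iff.2 ⟨hne, insert (lastForm n, p) S, ?_⟩
  rw [poly_insert]
  simp [TropCycle.upper, gap_lastForm]

theorem lineality_upper {n : ℕ} {p : ℝ} {Q : Set (Fin (n + 1) → ℝ)}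
    (hQ : IsRationalPolyhedron Q) {x : Fin (n + 1) → ℝ} (hx : x ∈ Q) (h : p < x (Fin.last n)) :
    lineality (upper p Q) x = lineality Q x := by
  obtain ⟨-, S, rfl⟩ := isRationalPolyhedron_iff.1 hQ
  have h1 : upper p (poly S) = poly (insert (lastForm n, p) S) := by
    rw [poly_insert]; simp [upper, gap_lastForm]
  have hx' : x ∈ poly (insert (lastForm n, p) S) := h1 ▸ ⟨hx, h.le⟩
  rw [h1, lineality_poly hx', lineality_poly hx, kerAt_insert_of_ne]
  rw [gap_lastForm]
  exact (sub_pos.2 h).ne'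

theorem last_eq_of_cellDim_upper {n : ℕ} {p : ℝ} {Q : Set (Fin (n + 1) → ℝ)}
    (hle : ∀ x ∈ Q, x (Fin.last n) ≤ p) (hd : cellDim (upper p Q) = cellDim Q)
    (hne : (upper p Q).Nonempty) : ∀ x ∈ Q, x (Fin.last n) = p := by
  have heq : vectorSpan ℝ (upper p Q) = vectorSpan ℝ Q :=
    Submodule.eq_of_le_of_finrank_eq (vectorSpan_mono ℝ Set.inter_subset_left) hd
  have hconst : ∀ x ∈ upper p Q, intForm (lastForm n) x = p := fun x hx => by
    rw [intForm_lastForm]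
    exact le_antisymm (hle x hx.1) hx.2
  obtain ⟨z, hz⟩ := hne
  intro x hx
  have h1 : x - z ∈ vectorSpan ℝ (upper p Q) := heq ▸ vsub_mem_vectorSpan ℝ hx hz.1
  have h2 := intForm_eq_zero_of_const hconst h1
  rw [map_sub, hconst z hz, intForm_lastForm, sub_eq_zero] at h2
  exact h2

namespace Chain

variable {n d : ℕ}

/-- The truncation of a polyhedron at height `p`; polyhedra whose dimension drops are
discarded. -/
def truncCell (p : ℝ) (Q : Cell (n + 1) d) : Chain (n + 1) d :=
  if h : (upper p Q.1).Nonempty ∧ cellDim (upper p Q.1) = d then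
    Finsupp.single ⟨upper p Q.1, Q.2.1.upper h.1, h.2⟩ 1 else 0

/-- The truncation of a chain at height `p`. -/
def trunc (p : ℝ) : Chain (n + 1) d →ₗ[ℤ] Chain (n + 1) d :=
  Finsupp.linearCombination ℤ (truncCell p)

theorem linearCombination_trunc {A : Type*} [AddCommGroup A] (p : ℝ)
    (g : Set (Fin (n + 1) → ℝ) → A) (c : Chain (n + 1) d) :
    Finsupp.linearCombination ℤ (fun Q : Cell (n + 1) d => g Q.1) (trunc p c) =
      Finsupp.linearCombination ℤ (fun Q : Cell (n + 1) d =>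
        if (upper p Q.1).Nonempty ∧ cellDim (upper p Q.1) = d then g (upper p Q.1) else 0) c := by
  have h0 : trunc p c = ∑ Q ∈ c.support, c Q • truncCell p Q :=
    Finsupp.linearCombination_apply ℤ c
  rw [h0, map_sum, Finsupp.linearCombination_apply, Finsupp.sum]
  refine Finset.sum_congr rfl fun Q _ => ?_
  rw [map_smul, truncCell]
  split_ifs with h <;> simp

theorem fn_trunc_apply {c : Chain (n + 1) d} (p : ℝ) (x : Fin (n + 1) → ℝ) :
    fn (trunc p c) x = ∑ Q ∈ c.support, if ((upper p Q.1).Nonempty ∧ cellDim (upper p Q.1) = d) ∧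
      x ∈ intrinsicInterior ℝ (upper p Q.1) then c Q else 0 := by
  have h := linearCombination_trunc p
    (fun Q x => if x ∈ intrinsicInterior ℝ Q then (1 : ℤ) else 0) c
  rw [fn, h, Finsupp.linearCombination_apply, Finsupp.sum, Finset.sum_apply]
  refine Finset.sum_congr rfl fun Q _ => ?_
  by_cases h1 : (upper p Q.1).Nonempty ∧ cellDim (upper p Q.1) = d
  · by_cases h2 : x ∈ intrinsicInterior ℝ (upper p Q.1)
    · rw [if_pos h1, if_pos ⟨h1, h2⟩, Pi.smul_apply, if_pos h2, smul_eq_mul, mul_one]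
    · rw [if_pos h1, if_neg (fun h => h2 h.2), Pi.smul_apply, if_neg h2, smul_zero]
  · rw [if_neg h1, if_neg (fun h => h1 h.1), smul_zero, Pi.zero_apply]

/-- Away from finitely many polyhedra of smaller dimension, truncation replaces the weight
function by zero below the height `p` and does not change it above. -/
theorem thin_fn_trunc {c : Chain (n + 1) d} (p : ℝ) {U : Set (Fin (n + 1) → ℝ)}
    (hc : Thin d {x | x ∈ U ∧ fn c x ≠ 0}) : Thin d {x | x ∈ U ∧ fn (trunc p c) x ≠ 0} := by
  -- the sections at height `p` of the polyhedra that are not contained in this height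
  have hW : Thin d (⋃ Q ∈ c.support.filter (fun Q : Cell (n + 1) d =>
      (∃ x ∈ Q.1, x (Fin.last n) ≠ p) ∧ (Q.1 ∩ {x | x (Fin.last n) = p}).Nonempty),
      Q.1 ∩ {x | x (Fin.last n) = p}) := by
    refine thin_biUnion _ fun Q hQ => thin_of_cellDim ?_
    obtain ⟨-, ⟨x, hx, hxp⟩, z, hz, hzp⟩ := Finset.mem_filter.1 hQ
    by_contra hlt
    have hd := Q.2.2
    have heq : vectorSpan ℝ (Q.1 ∩ {x | x (Fin.last n) = p}) = vectorSpan ℝ Q.1 :=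
      Submodule.eq_of_le_of_finrank_le (vectorSpan_mono ℝ Set.inter_subset_left)
        (by unfold cellDim at hd hlt; omega)
    have h2 : intForm (lastForm n) (x - z) = 0 := by
      refine intForm_eq_zero_of_const (b := p)
        (Q := Q.1 ∩ {x | x (Fin.last n) = p}) (fun x hx => ?_) ?_
      · rw [intForm_lastForm]; exact hx.2
      · rw [heq]; exact vsub_mem_vectorSpan ℝ hx hz
    rw [map_sub, intForm_lastForm, intForm_lastForm, sub_eq_zero] at h2
    exact hxp (h2.trans hzp)
  refine (hc.union hW).mono fun x hx => ?_
  by_contra hxn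
  rw [Set.mem_union, not_or] at hxn
  obtain ⟨hxn, hxW⟩ := hxn
  obtain ⟨hxU, hx⟩ := hx
  have hfn : fn c x = 0 := by
    by_contra h; exact hxn ⟨hxU, h⟩
  apply hx
  rw [fn_trunc_apply]
  by_cases hxp : p ≤ x (Fin.last n)
  · refine Eq.trans ?_ hfn
    rw [fn_apply]
    refine Finset.sum_congr rfl fun Q hQ => ?_
    have hd := Q.2.2
    congr 1
    rw [eq_iff_iff, mem_intrinsicInterior_iff Q.2.1]
    constructor
    · rintro ⟨⟨hne, hdim⟩, hxi⟩
      rw [mem_intrinsicInterior_iff (Q.2.1.upper hne)] at hxi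
      have heq : vectorSpan ℝ (upper p Q.1) = vectorSpan ℝ Q.1 :=
        Submodule.eq_of_le_of_finrank_le (vectorSpan_mono ℝ Set.inter_subset_left)
          (by unfold cellDim at hd hdim; omega)
      refine ⟨hxi.1.1, (lineality_le_vectorSpan hxi.1.1).antisymm ?_⟩
      rw [← heq, ← hxi.2]
      exact lineality_mono Set.inter_subset_left x
    · rintro ⟨hxQ, hl⟩
      have hup : x ∈ upper p Q.1 := ⟨hxQ, hxp⟩
      have hlu : lineality (upper p Q.1) x = vectorSpan ℝ Q.1 := by
        rcases hxp.lt_or_eq with h | h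
        · rw [lineality_upper Q.2.1 hxQ h, hl]
        · have hall : ∀ z ∈ Q.1, z (Fin.last n) = p := by
            by_contra hne
            push Not at hne
            exact hxW (Set.mem_biUnion (Finset.mem_coe.2 (Finset.mem_filter.2
              ⟨hQ, hne, x, hxQ, h.symm⟩)) ⟨hxQ, h.symm⟩)
          have : upper p Q.1 = Q.1 := Set.inter_eq_left.2 fun z hz => (hall z hz).ge
          rw [this, hl]
      have h1 := lineality_le_vectorSpan hup
      have h2 : vectorSpan ℝ (upper p Q.1) ≤ vectorSpan ℝ Q.1 :=
        vectorSpan_mono ℝ Set.inter_subset_left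
      have heq : vectorSpan ℝ (upper p Q.1) = vectorSpan ℝ Q.1 := h2.antisymm (hlu ▸ h1)
      exact ⟨⟨⟨x, hup⟩, by unfold cellDim; rw [heq]; exact hd⟩,
        (mem_intrinsicInterior_iff (Q.2.1.upper ⟨x, hup⟩)).2 ⟨hup, by rw [hlu, heq]⟩⟩
  · refine Finset.sum_eq_zero fun Q _ => if_neg fun h => hxp ?_
    exact (intrinsicInterior_subset h.2).2

/-- A cell of an adapted arrangement that meets an open set on which the weight function vanishes
generically has multiplicity zero. -/
theorem mult_eq_zero_of_thin {S : Finset ((Fin n → ℤ) × ℝ)} {c : Chain n d}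
    (hS : Adapted S c) {U : Set (Fin n → ℝ)} (hU : IsOpen U)
    (hc : Thin d {x | x ∈ U ∧ fn c x ≠ 0}) {C : Set (Fin n → ℝ)} (hC : C ∈ allCells S)
    (hd : cellDim C = d) {y : Fin n → ℝ} (hy : y ∈ C) (hyU : y ∈ U) : mult c C = 0 := by
  obtain ⟨x, rfl⟩ := mem_allCells.1 hC
  obtain ⟨z, hzU, hz, hzN⟩ := exists_generic_mem (isRationalPolyhedron_signCell S x) hd.ge hc
    hy (hU.mem_nhds hyU)
  obtain ⟨h1, h2⟩ := mem_intrinsicInterior_signCell.1 hz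
  rw [← h2, ← fn_eq_mult hS]
  · by_contra h
    exact hzN ⟨hzU, h⟩
  · rw [← vectorSpan_signCell, h2]; exact hd

/-- The last coordinate of the divergence of a chain at a point, taken over the polyhedra whose
lineality space at the point is horizontal and has codimension one. On a chain above the height `p`,
this is the weight of the divisor of `max {t, p}` at a point of height `p`: the vectors in horizontal
ridges have last coordinate zero, so the choice of primitive vectors does not matter. -/
def ht (y : Fin (n + 1) → ℝ) : Chain (n + 1) d →ₗ[ℤ] ℤ :=
  Finsupp.linearCombination ℤ fun Q =>
    if y ∈ Q.1 ∧ Module.finrank ℝ (lineality Q.1 y) + 1 = d ∧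
      lineality Q.1 y ≤ LinearMap.ker (intForm (lastForm n)) then pv Q.1 y (Fin.last n) else 0

theorem ht_eq_dv {S : Finset ((Fin (n + 1) → ℤ) × ℝ)} {c : Chain (n + 1) d}
    (hS : Adapted S c) {y : Fin (n + 1) → ℝ} (hy : Module.finrank ℝ (kerAt S y) + 1 = d) :
    ht y c = if kerAt S y ≤ LinearMap.ker (intForm (lastForm n)) then
      dv y (kerAt S y) c (Fin.last n) else 0 := by
  have key : ∀ Q ∈ c.support, y ∈ Q.1 →
      (Module.finrank ℝ (lineality Q.1 y) + 1 = d ↔ lineality Q.1 y = kerAt S y) := by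
    intro Q hQ hyQ
    obtain ⟨T, hT, hQT⟩ := hS Q hQ
    rw [hQT] at hyQ ⊢
    have := (lineality_cell_eq hT rfl hyQ).1
    exact ⟨fun h => (Submodule.eq_of_le_of_finrank_le this (by omega)).symm, fun h => h ▸ hy⟩
  rw [dv_apply, ht, Finsupp.linearCombination_apply, Finsupp.sum, Finset.sum_apply]
  by_cases hk : kerAt S y ≤ LinearMap.ker (intForm (lastForm n))
  · rw [if_pos hk]
    refine Finset.sum_congr rfl fun Q hQ => ?_
    by_cases h : y ∈ Q.1 ∧ lineality Q.1 y = kerAt S y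
    · rw [if_pos h, if_pos ⟨h.1, (key Q hQ h.1).2 h.2, h.2 ▸ hk⟩]
      simp
    · rw [if_neg h, if_neg fun h' => h ⟨h'.1, (key Q hQ h'.1).1 h'.2.1⟩]
      simp
  · rw [if_neg hk]
    refine Finset.sum_eq_zero fun Q hQ => ?_
    rw [if_neg, smul_zero]
    exact fun h' => hk ((key Q hQ h'.1).1 h'.2.1 ▸ h'.2.2)

/-- Generically, `ht` vanishes near the points where the weight function vanishes. -/
theorem thin_ht {c : Chain (n + 1) d} {U : Set (Fin (n + 1) → ℝ)} (hU : IsOpen U)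
    (hc : Thin d {x | x ∈ U ∧ fn c x ≠ 0}) : Thin (d - 1) {y | y ∈ U ∧ ht y c ≠ 0} := by
  obtain ⟨S, -, hS⟩ := exists_adapted c ∅
  refine (thin_finrank_kerAt S (d - 1)).mono fun y hy => ?_
  obtain ⟨hyU, hy⟩ := hy
  rw [Set.mem_ofPred_eq]
  by_contra hlt
  apply hy
  by_cases hd : Module.finrank ℝ (kerAt S y) + 1 = d
  · rw [ht_eq_dv hS hd]
    split_ifs with h
    · have := sum_mult_sub_dv_mem hS hd
      rw [Finset.sum_eq_zero fun C hC => ?_, zero_sub, neg_mem_iff] at this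
      · have h1 := h this
        rw [LinearMap.mem_ker, intForm_castVec, lastForm_dotProduct] at h1
        exact_mod_cast h1
      · obtain ⟨h1, h2, h3⟩ := Finset.mem_filter.1 hC
        rw [mult_eq_zero_of_thin hS hU hc h1 h2 h3 hyU, zero_smul]
    · rfl
  · rw [ht, Finsupp.linearCombination_apply, Finsupp.sum]
    refine Finset.sum_eq_zero fun Q hQ => ?_
    rw [if_neg, smul_zero]
    rintro ⟨h1, h2, -⟩
    obtain ⟨T, hT, hQT⟩ := hS Q hQ
    rw [hQT] at h1 h2
    have := Submodule.finrank_mono (lineality_cell_eq hT rfl h1).1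
    omega

end Chain

/-! ### The divisor of the truncated height function -/

/-- The function `max {t, p}`. -/
def maxLast (n : ℕ) (p : ℝ) (x : Fin (n + 1) → ℝ) : ℝ := max (x (Fin.last n)) p

theorem isLinearPart_maxLast_of_ge {n : ℕ} {p : ℝ} {σ : Set (Fin (n + 1) → ℝ)}
    (h : ∀ x ∈ σ, p ≤ x (Fin.last n)) : IsLinearPart (maxLast n p) σ (lastForm n) :=
  ⟨0, fun x hx => by
    rw [← intForm_apply, intForm_lastForm, add_zero, maxLast, max_eq_left (h x hx)]⟩

theorem isLinearPart_maxLast_of_le {n : ℕ} {p : ℝ} {σ : Set (Fin (n + 1) → ℝ)}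
    (h : ∀ x ∈ σ, x (Fin.last n) ≤ p) : IsLinearPart (maxLast n p) σ 0 :=
  ⟨p, fun x hx => by simp [maxLast, max_eq_right (h x hx)]⟩

/-- A convex set on which `max {t, p}` is affine lies on one side of the height `p`. -/
theorem IsLinearPart.sides {n : ℕ} {p : ℝ} {σ : Set (Fin (n + 1) → ℝ)} (hσ : Convex ℝ σ)
    {A : Fin (n + 1) → ℤ} (hA : IsLinearPart (maxLast n p) σ A) :
    (∀ x ∈ σ, p ≤ x (Fin.last n)) ∨ ∀ x ∈ σ, x (Fin.last n) ≤ p := by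
  by_contra! h
  obtain ⟨⟨x, hx, hxp⟩, z, hz, hzp⟩ := h
  obtain ⟨c, hc⟩ := hA
  have hm := hσ hx hz (by norm_num : (0 : ℝ) ≤ 1 / 2) (by norm_num : (0 : ℝ) ≤ 1 / 2)
    (by norm_num)
  have h1 := hc x hx
  have h2 := hc z hz
  have h3 := hc _ hm
  rw [← intForm_apply] at h1 h2 h3
  rw [map_add, map_smul, map_smul] at h3
  simp only [maxLast, Pi.add_apply, Pi.smul_apply, smul_eq_mul] at h1 h2 h3
  rw [max_eq_right hxp.le] at h1
  rw [max_eq_left hzp.le] at h2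
  have h4 : max (1 / 2 * x (Fin.last n) + 1 / 2 * z (Fin.last n)) p <
      1 / 2 * p + 1 / 2 * z (Fin.last n) := max_lt (by linarith) (by linarith)
  linarith

/-- A cell on one side of the height `p` that has a relative interior point at this height is
horizontal. -/
theorem vectorSpan_le_ker_lastForm {n : ℕ} {p : ℝ} {τ : Set (Fin (n + 1) → ℝ)}
    (hτ : IsRationalPolyhedron τ) {y : Fin (n + 1) → ℝ} (hy : y ∈ intrinsicInterior ℝ τ)
    (hyp : y (Fin.last n) = p)
    (h : (∀ x ∈ τ, p ≤ x (Fin.last n)) ∨ ∀ x ∈ τ, x (Fin.last n) ≤ p) :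
    vectorSpan ℝ τ ≤ LinearMap.ker (intForm (lastForm n)) := by
  rw [mem_intrinsicInterior_iff hτ] at hy
  rw [← hy.2, lineality, Submodule.span_le]
  rintro v ⟨h1, h2⟩
  rw [SetLike.mem_coe, LinearMap.mem_ker, intForm_lastForm]
  rcases h with h | h
  · have h3 := h _ h1
    have h4 := h _ h2
    simp only [Pi.add_apply, Pi.sub_apply] at h3 h4
    linarith
  · have h3 := h _ h1
    have h4 := h _ h2
    simp only [Pi.add_apply, Pi.sub_apply] at h3 h4
    linarith

namespace WeightedComplex

variable {n d : ℕ}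

/-- A description of the weights of the divisor of `max {t, p}` that only involves the chain of
facets of the complex. -/
theorem toClass_divisor_maxLast {K : WeightedComplex (n + 1) (d + 1)} (hK : K.IsBalanced) {p : ℝ}
    (hr : ∀ σ ∈ K.cells, ∃ A, IsLinearPart (maxLast n p) σ A) :
    (K.divisor (maxLast n p)).toClass = QuotientAddGroup.mk fun y =>
      if y (Fin.last n) = p then Chain.ht y (Chain.trunc p K.chain) else 0 := by
  -- each cell lies on one side of the height `p`; truncation keeps the facets above and discards the
  -- facets below
  have hsides : ∀ σ ∈ K.cells,
      (∀ x ∈ σ, p ≤ x (Fin.last n)) ∨ ∀ x ∈ σ, x (Fin.last n) ≤ p := fun σ hσ =>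
    (hr σ hσ).choose_spec.sides (K.isPolyhedron σ hσ).convex
  have hup : ∀ σ ∈ K.facets, (upper p σ).Nonempty ∧ cellDim (upper p σ) = d + 1 →
      upper p σ = σ := by
    rintro σ hσ ⟨hne, hd⟩
    refine Set.inter_eq_left.2 fun x hx => ?_
    rcases hsides σ (Finset.mem_filter.1 hσ).1 with h | h
    · exact h x hx
    · exact (last_eq_of_cellDim_upper h (hd.trans (cellDim_of_mem_facets hσ).symm) hne x hx).ge
  have hht : ∀ y, Chain.ht y (Chain.trunc p K.chain) = ∑ σ ∈ K.facets, K.weight σ •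
      if (∀ x ∈ σ, p ≤ x (Fin.last n)) ∧ y ∈ σ ∧
        Module.finrank ℝ (lineality σ y) + 1 = d + 1 ∧
        lineality σ y ≤ LinearMap.ker (intForm (lastForm n)) then pv σ y (Fin.last n) else 0 := by
    intro y
    rw [Chain.ht, Chain.linearCombination_trunc p (fun Q => if y ∈ Q ∧
      Module.finrank ℝ (lineality Q y) + 1 = d + 1 ∧
      lineality Q y ≤ LinearMap.ker (intForm (lastForm n)) then pv Q y (Fin.last n) else 0),
      linearCombination_chain K (fun Q => if (upper p Q).Nonempty ∧ cellDim (upper p Q) = d + 1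
        then (if y ∈ upper p Q ∧
      Module.finrank ℝ (lineality (upper p Q) y) + 1 = d + 1 ∧
      lineality (upper p Q) y ≤ LinearMap.ker (intForm (lastForm n)) then
        pv (upper p Q) y (Fin.last n) else 0) else 0)]
    refine Finset.sum_congr rfl fun σ hσ => ?_
    congr 1
    by_cases h : (upper p σ).Nonempty ∧ cellDim (upper p σ) = d + 1
    · have h1 := hup σ hσ h
      rw [if_pos h, h1]
      refine if_congr ?_ rfl rfl
      exact ⟨fun h2 => ⟨fun x hx => (h1.ge hx).2, h2⟩, fun h2 => h2.2⟩
    · rw [if_neg h, if_neg]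
      rintro ⟨h1, -⟩
      have h2 : upper p σ = σ := Set.inter_eq_left.2 fun x hx => h1 x hx
      rw [h2] at h
      exact h ⟨(K.isPolyhedron σ (Finset.mem_filter.1 hσ).1).1, cellDim_of_mem_facets hσ⟩
  have hcls : (K.divisor (maxLast n p)).toClass = QuotientAddGroup.mk fun y =>
      ∑ τ ∈ K.ridges, if y ∈ intrinsicInterior ℝ τ then K.divisorWeight (maxLast n p) τ else 0 := by
    rw [toClass, facets_divisor]; rfl
  rw [hcls]
  congr 1
  funext y
  by_cases hex : ∃ τ ∈ K.ridges, y ∈ intrinsicInterior ℝ τ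
  · obtain ⟨τ, hτ, hy⟩ := hex
    obtain ⟨hτ1, hτ2⟩ := Finset.mem_filter.1 hτ
    rw [Finset.sum_eq_single_of_mem τ hτ fun τ' hτ' hne => if_neg fun hy' =>
      hne (eq_of_mem_intrinsicInterior (Finset.mem_filter.1 hτ').1 hτ1 hy' hy), if_pos hy]
    have hyτ := intrinsicInterior_subset hy
    set A : Set (Fin (n + 1) → ℝ) → Fin (n + 1) → ℤ := fun σ =>
      if ∀ x ∈ σ, p ≤ x (Fin.last n) then lastForm n else 0 with hAdef
    have hA : ∀ σ ∈ K.facetsAround τ, IsLinearPart (maxLast n p) σ (A σ) := by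
      intro σ hσ
      have hσK := (Finset.mem_filter.1 (Finset.mem_filter.1 hσ).1).1
      by_cases h : ∀ x ∈ σ, p ≤ x (Fin.last n)
      · rw [hAdef]; simp only [if_pos h]
        exact isLinearPart_maxLast_of_ge h
      · rw [hAdef]; simp only [if_neg h]
        exact isLinearPart_maxLast_of_le ((hsides σ hσK).resolve_left h)
    -- away from the height `p` the function is affine near `y`, and balancing gives weight zero
    rcases lt_trichotomy (y (Fin.last n)) p with hyp | hyp | hyp
    · rw [if_neg hyp.ne]
      have hnot : ∀ σ ∈ K.facetsAround τ, A σ = 0 := fun σ hσ =>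
        if_neg fun h => (h y ((Finset.mem_filter.1 hσ).2 hyτ)).not_gt hyp
      rw [divisorWeight_eq hK hτ hy hA (B := 0) (isLinearPart_maxLast_of_le
        ((hsides τ hτ1).resolve_left fun h => (h y hyτ).not_gt hyp)),
        Finset.sum_eq_zero fun σ hσ => by rw [hnot σ hσ, zero_dotProduct, mul_zero]]
      simp
    · rw [if_pos hyp]
      have hker := vectorSpan_le_ker_lastForm (K.isPolyhedron τ hτ1) hy hyp (hsides τ hτ1)
      have hB : IsLinearPart (maxLast n p) τ 0 := by
        refine isLinearPart_maxLast_of_le fun x hx => ?_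
        have := hker (vsub_mem_vectorSpan ℝ hx hyτ)
        rw [LinearMap.mem_ker, vsub_eq_sub, map_sub, intForm_lastForm, intForm_lastForm] at this
        linarith
      rw [divisorWeight_eq hK hτ hy hA hB, zero_dotProduct, sub_zero, hht]
      rw [facetsAround, Finset.sum_filter]
      refine Finset.sum_congr rfl fun σ hσ => ?_
      have hσK := (Finset.mem_filter.1 hσ).1
      by_cases hτσ : τ ⊆ σ
      · have hl := lineality_eq hτ1 hσK hy hτσ
        rw [if_pos hτσ, hAdef, smul_eq_mul]
        by_cases h : ∀ x ∈ σ, p ≤ x (Fin.last n)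
        · rw [if_pos ⟨h, hτσ hyτ, by rw [hl]; exact hτ2, by rw [hl]; exact hker⟩]
          simp only [if_pos h, lastForm_dotProduct]
        · rw [if_neg fun h' => h h'.1]
          simp only [if_neg h, zero_dotProduct]
      · rw [if_neg hτσ, if_neg, smul_zero]
        exact fun h => hτσ (subset_of_mem_intrinsicInterior hτ1 hσK hy h.2.1)
    · rw [if_neg hyp.ne']
      have hnot : ∀ σ ∈ K.facetsAround τ, A σ = lastForm n := fun σ hσ => by
        have hσK := (Finset.mem_filter.1 (Finset.mem_filter.1 hσ).1).1
        exact if_pos ((hsides σ hσK).resolve_right fun h =>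
          (h y ((Finset.mem_filter.1 hσ).2 hyτ)).not_gt hyp)
      rw [divisorWeight_eq hK hτ hy hA (B := lastForm n) (isLinearPart_maxLast_of_ge
        ((hsides τ hτ1).resolve_right fun h => (h y hyτ).not_gt hyp)), sub_eq_zero,
        dotProduct_sum]
      refine Finset.sum_congr rfl fun σ hσ => ?_
      rw [hnot σ hσ, dotProduct_smul, smul_eq_mul]
  · rw [Finset.sum_eq_zero fun τ hτ => if_neg fun h => hex ⟨τ, hτ, h⟩]
    split_ifs with hyp
    · rw [hht]
      symm
      refine Finset.sum_eq_zero fun σ hσ => ?_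
      rw [if_neg, smul_zero]
      rintro ⟨-, hyσ, hfr, -⟩
      obtain ⟨τ, hτ, hy, -⟩ := exists_ridge_of_lineality (Finset.mem_filter.1 hσ).1 hyσ hfr
      exact hex ⟨τ, hτ, hy⟩
    · rfl

end WeightedComplex

namespace Chain

variable {n d : ℕ}

/-- The weights of the divisor of `max {t, p}` only depend on the weight function near the
height `p`. -/
theorem mk_ht_trunc_congr {c c' : Chain (n + 1) (d + 1)} {p : ℝ} {U : Set (Fin (n + 1) → ℝ)}
    (hU : IsOpen U) (hpU : ∀ x : Fin (n + 1) → ℝ, x (Fin.last n) = p → x ∈ U)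
    (h : Thin (d + 1) {x | x ∈ U ∧ fn c x ≠ fn c' x}) :
    (QuotientAddGroup.mk fun y => if y (Fin.last n) = p then ht y (trunc p c) else 0 :
      WeightClass (n + 1) d) =
    QuotientAddGroup.mk fun y => if y (Fin.last n) = p then ht y (trunc p c') else 0 := by
  rw [mk_eq_mk_iff]
  have h1 : Thin (d + 1) {x | x ∈ U ∧ fn (c - c') x ≠ 0} := h.mono fun x hx =>
    ⟨hx.1, fun he => hx.2 (by rw [map_sub, Pi.sub_apply, he, sub_self])⟩
  refine (thin_ht hU (thin_fn_trunc p h1)).mono fun y hy => ?_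
  rw [Set.mem_ofPred_eq] at hy
  by_cases hyp : y (Fin.last n) = p
  · refine ⟨hpU y hyp, fun he => hy ?_⟩
    rw [if_pos hyp, if_pos hyp]
    rw [map_sub, map_sub] at he
    exact sub_eq_zero.1 he
  · rw [if_neg hyp, if_neg hyp] at hy
    exact absurd rfl hy

end Chain

/-! ### Polyhedra over polyhedra -/

/-- The first `n` coordinates. -/
def ini {n : ℕ} {α : Type*} (x : Fin (n + 1) → α) : Fin n → α := fun i => x i.castSucc

/-- The point with first coordinates `x` and last coordinate `t`. -/
def sn {n : ℕ} {α : Type*} (x : Fin n → α) (t : α) : Fin (n + 1) → α :=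
  Fin.snoc (α := fun _ => α) x t

@[simp] theorem ini_sn {n : ℕ} {α : Type*} (x : Fin n → α) (t : α) : ini (sn x t) = x := by
  ext i; simp [ini, sn]

@[simp] theorem sn_last {n : ℕ} {α : Type*} (x : Fin n → α) (t : α) :
    sn x t (Fin.last n) = t := by simp [sn]

@[simp] theorem sn_castSucc {n : ℕ} {α : Type*} (x : Fin n → α) (t : α) (i : Fin n) :
    sn x t i.castSucc = x i := by simp [sn]

theorem ini_sum {n : ℕ} {α ι : Type*} [AddCommMonoid α] (s : Finset ι)
    (f : ι → Fin (n + 1) → α) : ini (∑ i ∈ s, f i) = ∑ i ∈ s, ini (f i) := by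
  ext j; simp [ini, Finset.sum_apply]

theorem ini_sub {n : ℕ} {α : Type*} [AddGroup α] (x y : Fin (n + 1) → α) :
    ini (x - y) = ini x - ini y := rfl

theorem ini_add {n : ℕ} {α : Type*} [AddGroup α] (x y : Fin (n + 1) → α) :
    ini (x + y) = ini x + ini y := rfl

theorem ini_smul {n : ℕ} {R α : Type*} [SMul R α] (r : R) (x : Fin (n + 1) → α) :
    ini (r • x) = r • ini x := rfl

theorem sn_ext {n : ℕ} {α : Type*} {x y : Fin (n + 1) → α} (h : ini x = ini y)
    (h' : x (Fin.last n) = y (Fin.last n)) : x = y := by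
  ext i
  refine Fin.lastCases h' (fun i => ?_) i
  exact congrFun h i

@[simp] theorem sn_ini {n : ℕ} {α : Type*} (x : Fin (n + 1) → α) :
    sn (ini x) (x (Fin.last n)) = x := sn_ext (by simp) (by simp)

/-- The projection to the first `n` coordinates, as a linear map. -/
def iniL (n : ℕ) : (Fin (n + 1) → ℝ) →ₗ[ℝ] (Fin n → ℝ) where
  toFun := ini
  map_add' _ _ := rfl
  map_smul' _ _ := rfl

@[simp] theorem iniL_apply {n : ℕ} (x : Fin (n + 1) → ℝ) : iniL n x = ini x := rfl

theorem iniL_surjective (n : ℕ) : Function.Surjective (iniL n) := fun x => ⟨sn x 0, by simp⟩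

theorem ini_castVec {n : ℕ} (v : Fin (n + 1) → ℤ) : ini (castVec (n + 1) v) = castVec n (ini v) :=
  rfl

theorem castVec_sn {n : ℕ} (v : Fin n → ℤ) (k : ℤ) :
    castVec (n + 1) (sn v k) = sn (castVec n v) (k : ℝ) :=
  sn_ext (by rw [ini_castVec, ini_sn, ini_sn]) (by simp [castVec_apply])

theorem mem_lat_comap {n : ℕ} {V : Submodule ℝ (Fin n → ℝ)} {v : Fin (n + 1) → ℤ} :
    v ∈ lat (V.comap (iniL n)) ↔ ini v ∈ lat V := Iff.rfl

theorem intForm_sn {n : ℕ} (a : Fin n → ℤ) (b : ℤ) (x : Fin (n + 1) → ℝ) :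
    intForm (sn a b) x = intForm a (ini x) + b * x (Fin.last n) := by
  rw [intForm_apply, intForm_apply, Fin.sum_univ_castSucc]
  simp [ini]

theorem dotProduct_sn {n : ℕ} (a : Fin n → ℤ) (b : ℤ) (v : Fin (n + 1) → ℤ) :
    sn a b ⬝ᵥ v = a ⬝ᵥ ini v + b * v (Fin.last n) := by
  simp [dotProduct, Fin.sum_univ_castSucc, ini]

theorem finrank_comap_iniL {n : ℕ} (V : Submodule ℝ (Fin n → ℝ)) :
    Module.finrank ℝ (V.comap (iniL n)) = Module.finrank ℝ V + 1 := by
  let e : V.comap (iniL n) ≃ₗ[ℝ] V × ℝ :=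
    { toFun := fun w => (⟨ini w.1, w.2⟩, w.1 (Fin.last n))
      map_add' := fun _ _ => rfl
      map_smul' := fun _ _ => rfl
      invFun := fun v => ⟨sn v.1.1 v.2, by simp⟩
      left_inv := fun w => Subtype.ext (sn_ini w.1)
      right_inv := fun v => by simp }
  rw [e.finrank_eq, Module.finrank_prod, Module.finrank_self]

theorem intForm_eq_ini_add {n : ℕ} (f : Fin (n + 1) → ℤ) (x : Fin (n + 1) → ℝ) :
    intForm f x = intForm (ini f) (ini x) + f (Fin.last n) * x (Fin.last n) := by
  conv_lhs => rw [← sn_ini f, intForm_sn]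

theorem map_comap_inf_ker {n : ℕ} (V : Submodule ℝ (Fin n → ℝ)) {f : Fin (n + 1) → ℤ}
    (hf : f (Fin.last n) ≠ 0) :
    (V.comap (iniL n) ⊓ LinearMap.ker (intForm f)).map (iniL n) = V := by
  have hf' : (f (Fin.last n) : ℝ) ≠ 0 := by exact_mod_cast hf
  ext v
  constructor
  · rintro ⟨w, hw, rfl⟩
    exact hw.1
  · intro hv
    refine ⟨sn v (-intForm (ini f) v / f (Fin.last n)), ⟨by simpa using hv, ?_⟩, by simp⟩
    rw [SetLike.mem_coe, LinearMap.mem_ker, intForm_eq_ini_add, ini_sn, sn_last]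
    field_simp
    ring

theorem finrank_comap_inf_ker {n : ℕ} (V : Submodule ℝ (Fin n → ℝ)) {f : Fin (n + 1) → ℤ}
    (hf : f (Fin.last n) ≠ 0) :
    Module.finrank ℝ (V.comap (iniL n) ⊓ LinearMap.ker (intForm f) :
      Submodule ℝ (Fin (n + 1) → ℝ)) = Module.finrank ℝ V := by
  have hf' : (f (Fin.last n) : ℝ) ≠ 0 := by exact_mod_cast hf
  conv_rhs => rw [← map_comap_inf_ker V hf]
  refine ((finrank_map_eq_iff (iniL n) _).2 fun x hx h0 => ?_).symm
  have h1 : intForm f x = 0 := hx.2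
  rw [iniL_apply] at h0
  rw [intForm_eq_ini_add, h0, map_zero, zero_add, mul_eq_zero] at h1
  exact sn_ext h0 (h1.resolve_left hf')

/-- The cylinder `Q × ℝ`. -/
def cylSet {n : ℕ} (Q : Set (Fin n → ℝ)) : Set (Fin (n + 1) → ℝ) := {x | ini x ∈ Q}

/-- The part of the cylinder over `Q` that satisfies the inequality `f`. -/
def halfCyl {n : ℕ} (f : (Fin (n + 1) → ℤ) × ℝ) (Q : Set (Fin n → ℝ)) :
    Set (Fin (n + 1) → ℝ) := cylSet Q ∩ {x | 0 ≤ gap f x}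

/-- The inequalities of a polyhedron, as inequalities for a cylinder. -/
def liftForms {n : ℕ} (S : Finset ((Fin n → ℤ) × ℝ)) : Finset ((Fin (n + 1) → ℤ) × ℝ) :=
  S.image fun c => (sn c.1 0, c.2)

theorem gap_lift {n : ℕ} (c : (Fin n → ℤ) × ℝ) (x : Fin (n + 1) → ℝ) :
    gap (sn c.1 0, c.2) x = gap c (ini x) := by
  simp [gap, intForm_sn]

theorem poly_liftForms {n : ℕ} (S : Finset ((Fin n → ℤ) × ℝ)) :
    poly (liftForms S) = cylSet (poly S) := by
  ext x
  change (∀ c ∈ liftForms S, 0 ≤ gap c x) ↔ ∀ c ∈ S, 0 ≤ gap c (ini x)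
  rw [liftForms, Finset.forall_mem_image]
  simp only [gap_lift]

theorem kerAt_liftForms {n : ℕ} (S : Finset ((Fin n → ℤ) × ℝ)) (x : Fin (n + 1) → ℝ) :
    kerAt (liftForms S) x = (kerAt S (ini x)).comap (iniL n) := by
  ext v
  rw [mem_kerAt, Submodule.mem_comap, mem_kerAt, liftForms, Finset.forall_mem_image]
  simp [gap_lift, intForm_sn]

theorem kerAt_insert_of_eq {n : ℕ} {c : (Fin n → ℤ) × ℝ} (S : Finset ((Fin n → ℤ) × ℝ))
    {x : Fin n → ℝ} (h : gap c x = 0) :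
    kerAt (insert c S) x = kerAt S x ⊓ LinearMap.ker (intForm c.1) := by
  ext v
  simp [mem_kerAt, h, and_comm]

theorem IsRationalPolyhedron.cylSet {n : ℕ} {Q : Set (Fin n → ℝ)} (hQ : IsRationalPolyhedron Q) :
    IsRationalPolyhedron (cylSet Q) := by
  obtain ⟨⟨x, hx⟩, S, rfl⟩ := isRationalPolyhedron_iff.1 hQ
  exact isRationalPolyhedron_iff.2 ⟨⟨sn x 0, by simpa [TropCycle.cylSet] using hx⟩, _,
    (poly_liftForms S).symm⟩

theorem lineality_cylSet {n : ℕ} {Q : Set (Fin n → ℝ)} (hQ : IsRationalPolyhedron Q)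
    {x : Fin (n + 1) → ℝ} (hx : ini x ∈ Q) :
    lineality (cylSet Q) x = (lineality Q (ini x)).comap (iniL n) := by
  obtain ⟨-, S, rfl⟩ := isRationalPolyhedron_iff.1 hQ
  rw [← poly_liftForms, lineality_poly, kerAt_liftForms, lineality_poly hx]
  rw [poly_liftForms]
  exact hx

theorem halfCyl_poly {n : ℕ} (f : (Fin (n + 1) → ℤ) × ℝ) (S : Finset ((Fin n → ℤ) × ℝ)) :
    halfCyl f (poly S) = poly (insert f (liftForms S)) := by
  rw [poly_insert, poly_liftForms]; rfl

theorem lineality_halfCyl_of_pos {n : ℕ} {Q : Set (Fin n → ℝ)} (hQ : IsRationalPolyhedron Q)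
    {f : (Fin (n + 1) → ℤ) × ℝ} {x : Fin (n + 1) → ℝ} (hx : ini x ∈ Q) (h : 0 < gap f x) :
    lineality (halfCyl f Q) x = (lineality Q (ini x)).comap (iniL n) := by
  obtain ⟨-, S, rfl⟩ := isRationalPolyhedron_iff.1 hQ
  rw [halfCyl_poly, lineality_poly, kerAt_insert_of_ne _ h.ne', kerAt_liftForms,
    lineality_poly hx]
  rw [← halfCyl_poly]
  exact ⟨hx, h.le⟩

theorem lineality_halfCyl_of_eq {n : ℕ} {Q : Set (Fin n → ℝ)} (hQ : IsRationalPolyhedron Q)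
    {f : (Fin (n + 1) → ℤ) × ℝ} {x : Fin (n + 1) → ℝ} (hx : ini x ∈ Q) (h : gap f x = 0) :
    lineality (halfCyl f Q) x =
      (lineality Q (ini x)).comap (iniL n) ⊓ LinearMap.ker (intForm f.1) := by
  obtain ⟨-, S, rfl⟩ := isRationalPolyhedron_iff.1 hQ
  rw [halfCyl_poly, lineality_poly, kerAt_insert_of_eq _ h, kerAt_liftForms,
    lineality_poly hx]
  rw [← halfCyl_poly]
  exact ⟨hx, h.ge⟩

theorem vectorSpan_eq_comap {n : ℕ} {Q : Set (Fin n → ℝ)} {R : Set (Fin (n + 1) → ℝ)}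
    (hRQ : R ⊆ cylSet Q) {x : Fin (n + 1) → ℝ} (hx : x ∈ R)
    (h : lineality R x = (vectorSpan ℝ Q).comap (iniL n)) :
    vectorSpan ℝ R = (vectorSpan ℝ Q).comap (iniL n) := by
  refine le_antisymm ?_ (h ▸ lineality_le_vectorSpan hx)
  rw [vectorSpan, Submodule.span_le]
  rintro _ ⟨y, hy, z, hz, rfl⟩
  exact vsub_mem_vectorSpan ℝ (hRQ hy) (hRQ hz)

theorem vectorSpan_cylSet {n : ℕ} {Q : Set (Fin n → ℝ)} (hQ : IsRationalPolyhedron Q) :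
    vectorSpan ℝ (cylSet Q) = (vectorSpan ℝ Q).comap (iniL n) := by
  obtain ⟨x, hx⟩ := exists_mem_intrinsicInterior hQ
  rw [mem_intrinsicInterior_iff hQ] at hx
  have hx' : ini (sn x (0 : ℝ)) ∈ Q := by simpa using hx.1
  refine vectorSpan_eq_comap subset_rfl (x := sn x 0) hx' ?_
  rw [lineality_cylSet hQ hx', ini_sn, hx.2]

theorem cellDim_cylSet {n : ℕ} {Q : Set (Fin n → ℝ)} (hQ : IsRationalPolyhedron Q) :
    cellDim (cylSet Q) = cellDim Q + 1 := by
  rw [cellDim, vectorSpan_cylSet hQ, finrank_comap_iniL]; rfl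

theorem exists_gap_pos {n : ℕ} {f : (Fin (n + 1) → ℤ) × ℝ} (hf : f.1 (Fin.last n) ≠ 0)
    (x : Fin n → ℝ) : ∃ t, 0 < gap f (sn x t) := by
  have hf' : (f.1 (Fin.last n) : ℝ) ≠ 0 := by exact_mod_cast hf
  refine ⟨(1 + f.2 - intForm (ini f.1) x) / f.1 (Fin.last n), ?_⟩
  rw [gap, intForm_eq_ini_add, ini_sn, sn_last]
  field_simp
  linarith

theorem IsRationalPolyhedron.halfCyl {n : ℕ} {Q : Set (Fin n → ℝ)} (hQ : IsRationalPolyhedron Q)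
    {f : (Fin (n + 1) → ℤ) × ℝ} (hf : f.1 (Fin.last n) ≠ 0) :
    IsRationalPolyhedron (halfCyl f Q) := by
  obtain ⟨⟨x, hx⟩, S, rfl⟩ := isRationalPolyhedron_iff.1 hQ
  obtain ⟨t, ht⟩ := exists_gap_pos hf x
  exact isRationalPolyhedron_iff.2 ⟨⟨sn x t, by simpa [TropCycle.cylSet] using hx, ht.le⟩, _,
    halfCyl_poly f S⟩

theorem vectorSpan_halfCyl {n : ℕ} {Q : Set (Fin n → ℝ)} (hQ : IsRationalPolyhedron Q)
    {f : (Fin (n + 1) → ℤ) × ℝ} (hf : f.1 (Fin.last n) ≠ 0) :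
    vectorSpan ℝ (halfCyl f Q) = (vectorSpan ℝ Q).comap (iniL n) := by
  obtain ⟨x, hx⟩ := exists_mem_intrinsicInterior hQ
  rw [mem_intrinsicInterior_iff hQ] at hx
  obtain ⟨t, ht⟩ := exists_gap_pos hf x
  have hx' : ini (sn x t) ∈ Q := by simpa using hx.1
  refine vectorSpan_eq_comap Set.inter_subset_left (x := sn x t) ⟨hx', ht.le⟩ ?_
  rw [lineality_halfCyl_of_pos hQ hx' ht, ini_sn, hx.2]

theorem cellDim_halfCyl {n : ℕ} {Q : Set (Fin n → ℝ)} (hQ : IsRationalPolyhedron Q)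
    {f : (Fin (n + 1) → ℤ) × ℝ} (hf : f.1 (Fin.last n) ≠ 0) :
    cellDim (halfCyl f Q) = cellDim Q + 1 := by
  rw [cellDim, vectorSpan_halfCyl hQ hf, finrank_comap_iniL]; rfl

theorem comap_iniL_injective {n : ℕ} {V W : Submodule ℝ (Fin n → ℝ)}
    (h : V.comap (iniL n) = W.comap (iniL n)) : V = W :=
  Submodule.comap_injective_of_surjective (iniL_surjective n) h

theorem mem_intrinsicInterior_cylSet {n : ℕ} {Q : Set (Fin n → ℝ)}
    (hQ : IsRationalPolyhedron Q) {x : Fin (n + 1) → ℝ} :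
    x ∈ intrinsicInterior ℝ (cylSet Q) ↔ ini x ∈ intrinsicInterior ℝ Q := by
  rw [mem_intrinsicInterior_iff hQ.cylSet, mem_intrinsicInterior_iff hQ]
  refine and_congr_right fun h => ?_
  rw [lineality_cylSet hQ h, vectorSpan_cylSet hQ]
  exact ⟨comap_iniL_injective, fun h => by rw [h]⟩

theorem IsPrimAt.eventually {n : ℕ} {Q : Set (Fin n → ℝ)} (hQ : Convex ℝ Q) {y : Fin n → ℝ}
    (hy : y ∈ Q) {v : Fin n → ℤ} (h : IsPrimAt Q y v) :
    ∀ᶠ s in 𝓝[>] (0 : ℝ), y + s • castVec n v ∈ Q := by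
  obtain ⟨-, -, ε, hε, hv⟩ := h
  filter_upwards [Ioo_mem_nhdsGT hε] with s hs
  have h1 : y + s • castVec n v = (1 - s / ε) • y + (s / ε) • (y + ε • castVec n v) := by
    ext i
    simp only [Pi.add_apply, Pi.smul_apply, smul_eq_mul]
    have := hε.ne'
    field_simp
    ring
  rw [h1]
  have h2 : s / ε ≤ 1 := (div_le_one hε).2 hs.2.le
  exact hQ hy hv (by linarith) (div_nonneg hs.1.le hε.le) (by ring)

/-- Where a polyhedron over `Q` is locally the cylinder over `Q`, its primitive vector lies over
the primitive vector of `Q`. -/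
theorem ini_pv_sub_mem {n : ℕ} {Q : Set (Fin n → ℝ)} (hQ : IsRationalPolyhedron Q)
    {R : Set (Fin (n + 1) → ℝ)} (hR : IsRationalPolyhedron R) {x : Fin (n + 1) → ℝ}
    (hx : ini x ∈ Q) (hxR : ∀ᶠ z in 𝓝 x, ini z ∈ Q → z ∈ R)
    (hl : lineality R x = (lineality Q (ini x)).comap (iniL n))
    (hs : vectorSpan ℝ R = (vectorSpan ℝ Q).comap (iniL n))
    (hd : Module.finrank ℝ (lineality Q (ini x)) + 1 = cellDim Q) :
    ini (pv R x) - pv Q (ini x) ∈ lat (lineality Q (ini x)) := by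
  have hdR : Module.finrank ℝ (lineality R x) + 1 = cellDim R := by
    rw [hl, finrank_comap_iniL, cellDim, hs, finrank_comap_iniL, hd]; rfl
  have hxR' : x ∈ R := hxR.self_of_nhds hx
  have hp := pv_spec hQ hx hd
  have hv : IsPrimAt R x (sn (pv Q (ini x)) 0) := by
    refine ⟨?_, fun w hw => ?_, ?_⟩
    · rw [hs, mem_lat_comap, ini_sn]; exact hp.1
    · rw [hs, mem_lat_comap] at hw
      obtain ⟨k, hk⟩ := hp.2.1 _ hw
      refine ⟨k, ?_⟩
      rw [hl, mem_lat_comap]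
      rwa [ini_sub, ini_smul, ini_sn]
    · have hc : Continuous fun s : ℝ => x + s • castVec (n + 1) (sn (pv Q (ini x)) 0) := by
        fun_prop
      have h1 : ∀ᶠ s in 𝓝[>] (0 : ℝ), ini (x + s • castVec (n + 1) (sn (pv Q (ini x)) 0)) ∈ Q →
          x + s • castVec (n + 1) (sn (pv Q (ini x)) 0) ∈ R :=
        (hc.tendsto' 0 x (by simp)).eventually hxR |>.filter_mono nhdsWithin_le_nhds
      obtain ⟨s, ⟨h1, h2⟩, hs⟩ :=
        ((h1.and (hp.eventually hQ.convex hx)).and self_mem_nhdsWithin).exists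
      refine ⟨s, hs, h1 ?_⟩
      rwa [ini_add, ini_smul, ini_castVec, ini_sn]
  have := (pv_spec hR hxR' hdR).sub_mem hR hxR' hdR hv
  rwa [hl, mem_lat_comap, ini_sub, ini_sn] at this

/-- The primitive vector of a half cylinder at its boundary is vertical. -/
theorem pv_halfCyl_sub_mem {n : ℕ} {Q : Set (Fin n → ℝ)} (hQ : IsRationalPolyhedron Q)
    {f : (Fin (n + 1) → ℤ) × ℝ} (hf : f.1 (Fin.last n) * f.1 (Fin.last n) = 1)
    {x : Fin (n + 1) → ℝ} (hx : ini x ∈ intrinsicInterior ℝ Q) (h : gap f x = 0) :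
    pv (halfCyl f Q) x - sn 0 (f.1 (Fin.last n)) ∈
      lat ((vectorSpan ℝ Q).comap (iniL n) ⊓ LinearMap.ker (intForm f.1)) := by
  have hf0 : f.1 (Fin.last n) ≠ 0 := by rintro h0; simp [h0] at hf
  rw [mem_intrinsicInterior_iff hQ] at hx
  have hU : IsRationalPolyhedron (halfCyl f Q) := hQ.halfCyl hf0
  have hxU : x ∈ halfCyl f Q := ⟨hx.1, h.ge⟩
  have hl := lineality_halfCyl_of_eq hQ hx.1 h
  rw [hx.2] at hl
  have hdU : Module.finrank ℝ (lineality (halfCyl f Q) x) + 1 = cellDim (halfCyl f Q) := by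
    rw [hl, finrank_comap_inf_ker _ hf0, cellDim_halfCyl hQ hf0]; rfl
  have hs := vectorSpan_halfCyl hQ (f := f) hf0
  have hv1 : f.1 ⬝ᵥ sn 0 (f.1 (Fin.last n)) = 1 := by
    rw [dotProduct_comm, dotProduct_sn, zero_dotProduct, zero_add, hf]
  have hv : IsPrimAt (halfCyl f Q) x (sn 0 (f.1 (Fin.last n))) := by
    refine ⟨?_, fun w hw => ⟨f.1 ⬝ᵥ w, ?_⟩, 1, one_pos, ?_, ?_⟩
    · rw [hs, mem_lat_comap, ini_sn]; exact zero_mem _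
    · rw [hs, mem_lat_comap] at hw
      rw [hl]
      refine ⟨?_, ?_⟩
      · rw [SetLike.mem_coe, Submodule.mem_comap, iniL_apply, ini_castVec, ini_sub,
          ini_smul, ini_sn, smul_zero, sub_zero]
        exact hw
      · rw [SetLike.mem_coe, LinearMap.mem_ker, intForm_castVec, dotProduct_sub,
          dotProduct_smul, hv1, smul_eq_mul, mul_one, sub_self, Int.cast_zero]
    · change ini (x + (1 : ℝ) • castVec (n + 1) (sn 0 (f.1 (Fin.last n)))) ∈ Q
      rw [ini_add, ini_smul, ini_castVec, ini_sn, map_zero, smul_zero, add_zero]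
      exact hx.1
    · change 0 ≤ gap _ _
      rw [gap_add_smul, h, intForm_castVec, hv1]
      simp
  rw [← hl]
  exact (pv_spec hU hxU hdU).sub_mem hU hxU hdU hv

/-! ### Cylinders over chains and graphs of affine functions -/

theorem upper_cylSet {n : ℕ} (p : ℝ) (Q : Set (Fin n → ℝ)) :
    upper p (cylSet Q) = halfCyl (lastForm n, p) Q := by
  ext x
  simp [upper, halfCyl, gap_lastForm]

theorem lastForm_last (n : ℕ) : lastForm n (Fin.last n) ≠ 0 := by simp [lastForm]

namespace Chain

variable {n k : ℕ}

/-- The cylinder over a cell. -/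
def cylCell (Q : Cell n k) : Cell (n + 1) (k + 1) :=
  ⟨cylSet Q.1, Q.2.1.cylSet, by rw [cellDim_cylSet Q.2.1, Q.2.2]⟩

/-- The cylinder over a chain. -/
def cyl : Chain n k →ₗ[ℤ] Chain (n + 1) (k + 1) := Finsupp.lmapDomain ℤ ℤ cylCell

theorem linearCombination_cyl {A : Type*} [AddCommGroup A]
    (g : Set (Fin (n + 1) → ℝ) → A) (c : Chain n k) :
    Finsupp.linearCombination ℤ (fun Q : Cell (n + 1) (k + 1) => g Q.1) (cyl c) =
      Finsupp.linearCombination ℤ (fun Q : Cell n k => g (cylSet Q.1)) c :=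
  Finsupp.linearCombination_mapDomain ℤ _ _

theorem exists_of_mem_support_cyl {c : Chain n k} {R : Cell (n + 1) (k + 1)}
    (hR : R ∈ (cyl c).support) : ∃ Q ∈ c.support, R.1 = cylSet Q.1 := by
  obtain ⟨Q, hQ, rfl⟩ := Finset.mem_image.1 (Finsupp.mapDomain_support hR)
  exact ⟨Q, hQ, rfl⟩

theorem fn_cyl (c : Chain n k) (x : Fin (n + 1) → ℝ) : fn (cyl c) x = fn c (ini x) := by
  rw [fn, linearCombination_cyl (fun Q x => if x ∈ intrinsicInterior ℝ Q then (1 : ℤ) else 0),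
    fn, Finsupp.linearCombination_apply, Finsupp.linearCombination_apply, Finsupp.sum,
    Finsupp.sum, Finset.sum_apply, Finset.sum_apply]
  refine Finset.sum_congr rfl fun Q _ => ?_
  rw [Pi.smul_apply, Pi.smul_apply]
  congr 1
  exact if_congr (mem_intrinsicInterior_cylSet Q.2.1) rfl rfl

/-- The divisor of `max {t, p}` on a cylinder is the section at height `p`. -/
theorem ht_trunc_cyl (c : Chain n k) {p : ℝ} {x : Fin (n + 1) → ℝ} (hx : x (Fin.last n) = p) :
    ht x (trunc p (cyl c)) = fn c (ini x) := by
  rw [ht, linearCombination_trunc p (fun Q => if x ∈ Q ∧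
      Module.finrank ℝ (lineality Q x) + 1 = k + 1 ∧
      lineality Q x ≤ LinearMap.ker (intForm (lastForm n)) then pv Q x (Fin.last n) else 0),
    linearCombination_cyl (fun Q => if (upper p Q).Nonempty ∧ cellDim (upper p Q) = k + 1
        then (if x ∈ upper p Q ∧
      Module.finrank ℝ (lineality (upper p Q) x) + 1 = k + 1 ∧
      lineality (upper p Q) x ≤ LinearMap.ker (intForm (lastForm n)) then
        pv (upper p Q) x (Fin.last n) else 0) else 0),
    fn, Finsupp.linearCombination_apply, Finsupp.linearCombination_apply, Finsupp.sum,
    Finsupp.sum, Finset.sum_apply]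
  refine Finset.sum_congr rfl fun Q _ => ?_
  rw [Pi.smul_apply]
  congr 1
  have hd := Q.2.2
  have hQ := Q.2.1
  have hU : IsRationalPolyhedron (halfCyl (lastForm n, p) Q.1) := hQ.halfCyl (lastForm_last n)
  rw [upper_cylSet, if_pos ⟨hU.1, by rw [cellDim_halfCyl hQ (lastForm_last n), hd]⟩]
  have hg : gap (lastForm n, p) x = 0 := by rw [gap_lastForm, hx, sub_self]
  by_cases hxQ : ini x ∈ Q.1
  · have hxU : x ∈ halfCyl (lastForm n, p) Q.1 := ⟨hxQ, hg.ge⟩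
    have hl := lineality_halfCyl_of_eq hQ hxQ hg
    have hfr : Module.finrank ℝ (lineality (halfCyl (lastForm n, p) Q.1) x) =
        Module.finrank ℝ (lineality Q.1 (ini x)) := by
      rw [hl, finrank_comap_inf_ker _ (lastForm_last n)]
    by_cases hi : ini x ∈ intrinsicInterior ℝ Q.1
    · rw [if_pos hi]
      rw [mem_intrinsicInterior_iff hQ] at hi
      have hfr' : Module.finrank ℝ (lineality (halfCyl (lastForm n, p) Q.1) x) = k := by
        rw [hfr, hi.2]; exact hd
      have hker : lineality (halfCyl (lastForm n, p) Q.1) x ≤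
          LinearMap.ker (intForm (lastForm n)) := by rw [hl]; exact inf_le_right
      rw [if_pos ⟨hxU, by rw [hfr'], hker⟩]
      have := (pv_halfCyl_sub_mem hQ (by simp [lastForm])
        ((mem_intrinsicInterior_iff hQ).2 hi) hg).2
      rw [SetLike.mem_coe, LinearMap.mem_ker, intForm_castVec, lastForm_dotProduct,
        Pi.sub_apply, sn_last] at this
      have : pv (halfCyl (lastForm n, p) Q.1) x (Fin.last n) - lastForm n (Fin.last n) = 0 := by
        exact_mod_cast this
      rw [sub_eq_zero.1 this]
      simp [lastForm]
    · rw [if_neg hi, if_neg]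
      rintro ⟨-, h, -⟩
      refine hi ((mem_intrinsicInterior_iff hQ).2 ⟨hxQ, ?_⟩)
      refine Submodule.eq_of_le_of_finrank_le (lineality_le_vectorSpan hxQ) ?_
      unfold cellDim at hd
      omega
  · rw [if_neg fun h => hxQ h.1.1, if_neg fun h => hxQ (intrinsicInterior_subset h)]

/-- The cylinder over a chain that is balanced at all points is balanced. -/
theorem bal_cyl {c : Chain n k} (hc : ∀ (y : Fin n → ℝ) (L : Submodule ℝ (Fin n → ℝ)),
    Module.finrank ℝ L + 1 = k → dv y L c ∈ lat L) :
    Bal (cyl c) := by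
  refine ⟨∅, thin_empty, fun x _ L' hL' => ?_⟩
  by_cases hex : ∃ L : Submodule ℝ (Fin n → ℝ), L' = L.comap (iniL n)
  · obtain ⟨L, rfl⟩ := hex
    rw [finrank_comap_iniL] at hL'
    have h := hc (ini x) L (by omega)
    rw [dv, linearCombination_cyl (fun Q => if x ∈ Q ∧ lineality Q x = L.comap (iniL n) then
      pv Q x else 0), Finsupp.linearCombination_apply, Finsupp.sum]
    rw [dv, Finsupp.linearCombination_apply, Finsupp.sum] at h
    rw [mem_lat_comap, ← sub_add_cancel (ini _) (∑ Q ∈ c.support, c Q •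
      if ini x ∈ Q.1 ∧ lineality Q.1 (ini x) = L then pv Q.1 (ini x) else 0)]
    refine AddSubgroup.add_mem _ ?_ h
    rw [ini_sum, ← Finset.sum_sub_distrib]
    refine AddSubgroup.sum_mem _ fun Q _ => ?_
    rw [ini_smul, ← smul_sub]
    refine AddSubgroup.zsmul_mem _ ?_ _
    by_cases hx : ini x ∈ Q.1
    · have hl := lineality_cylSet Q.2.1 hx
      by_cases hL : lineality Q.1 (ini x) = L
      · rw [if_pos ⟨hx, by rw [hl, hL]⟩, if_pos ⟨hx, hL⟩, ← hL]
        refine ini_pv_sub_mem Q.2.1 Q.2.1.cylSet hx (Eventually.of_forall fun _ h => h) hl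
          (vectorSpan_cylSet Q.2.1) ?_
        have := Q.2.2
        rw [hL]
        omega
      · rw [if_neg fun h => hL (comap_iniL_injective (hl.symm.trans h.2)),
          if_neg fun h => hL h.2]
        exact zero_mem _
    · rw [if_neg fun h => hx h.1, if_neg fun h => hx h.1]
      exact zero_mem _
  · rw [dv, linearCombination_cyl (fun Q => if x ∈ Q ∧ lineality Q x = L' then
      pv Q x else 0), Finsupp.linearCombination_apply, Finsupp.sum]
    rw [Finset.sum_eq_zero]
    · exact zero_mem _
    · intro Q _
      rw [if_neg, smul_zero]
      rintro ⟨hx, rfl⟩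
      exact hex ⟨_, lineality_cylSet Q.2.1 hx⟩

end Chain

/-- The map `x ↦ (x, B x + c)`. -/
def graphMap {n : ℕ} (B : Fin n → ℤ) (c : ℝ) : IntAffineMap n (n + 1) where
  lin := fun i j => sn (Pi.single j 1) (B j) i
  trans := sn 0 c

theorem linMap_graphMap {n : ℕ} (B : Fin n → ℤ) (c : ℝ) (x : Fin n → ℝ) :
    (graphMap B c).linMap x = sn x (intForm B x) := by
  refine sn_ext ?_ ?_
  · ext i
    simp only [ini, IntAffineMap.linMap_apply, graphMap, sn_castSucc]
    rw [Finset.sum_eq_single i] <;> simp +contextual [eq_comm]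
  · rw [IntAffineMap.linMap_apply, sn_last, intForm_apply]
    simp [graphMap]

theorem toFun_graphMap {n : ℕ} (B : Fin n → ℤ) (c : ℝ) (x : Fin n → ℝ) :
    (graphMap B c).toFun x = sn x (intForm B x + c) := by
  rw [IntAffineMap.toFun_eq, linMap_graphMap]
  exact sn_ext (by rw [ini_add]; simp [graphMap]) (by simp [graphMap])

theorem mulVec_graphMap {n : ℕ} (B : Fin n → ℤ) (c : ℝ) (v : Fin n → ℤ) :
    (graphMap B c).lin.mulVec v = sn v (B ⬝ᵥ v) := by
  have h := IntAffineMap.linMap_castVec (graphMap B c) v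
  rw [linMap_graphMap, intForm_castVec, ← castVec_sn] at h
  ext i
  have := congrFun h i
  rw [castVec_apply, castVec_apply] at this
  exact_mod_cast this.symm

theorem graphMap_inj {n : ℕ} (B : Fin n → ℤ) (c : ℝ) (x : Fin n → ℝ)
    (h : (graphMap B c).linMap x = 0) : x = 0 := by
  rw [linMap_graphMap] at h
  rw [← ini_sn x (intForm B x), h]; rfl

theorem toFun_projInit {n : ℕ} (x : Fin (n + 1) → ℝ) : (projInit n).toFun x = ini x := by
  ext i
  simp [IntAffineMap.toFun, projInit, ini]

theorem linMap_projInit (n : ℕ) : (projInit n).linMap = iniL n := by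
  ext x i
  have := congrFun (toFun_projInit (Pi.single x 1)) i
  rw [IntAffineMap.toFun_eq] at this
  simpa [projInit] using this

theorem IntAffineMap.idx_eq_one {m n : ℕ} (f : IntAffineMap m n) {V : Submodule ℝ (Fin m → ℝ)}
    (h : ∀ w ∈ lat (V.map f.linMap), ∃ v ∈ lat V, f.lin.mulVec v = w) : f.idx V = 1 := by
  rw [idx, AddSubgroup.relIndex_eq_one]
  intro w hw
  obtain ⟨v, hv, rfl⟩ := h w hw
  exact ⟨v, hv, rfl⟩

theorem idx_graphMap {n : ℕ} (B : Fin n → ℤ) (c : ℝ) (V : Submodule ℝ (Fin n → ℝ)) :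
    (graphMap B c).idx V = 1 := by
  refine (graphMap B c).idx_eq_one fun w hw => ?_
  obtain ⟨x, hx, hxw⟩ := hw
  rw [linMap_graphMap] at hxw
  have h1 : x = castVec n (ini w) := by rw [← ini_castVec, ← hxw, ini_sn]
  subst h1
  refine ⟨ini w, hx, ?_⟩
  rw [mulVec_graphMap]
  refine sn_ext (by simp) ?_
  rw [sn_last]
  have h2 := congrFun hxw (Fin.last n)
  rw [sn_last, intForm_castVec, castVec_apply] at h2
  exact_mod_cast h2

theorem cellDim_image_graphMap {n : ℕ} (B : Fin n → ℤ) (c : ℝ) (Q : Set (Fin n → ℝ)) :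
    cellDim ((graphMap B c).toFun '' Q) = cellDim Q :=
  ((graphMap B c).cellDim_image_eq_iff Q).2 fun x _ h => graphMap_inj B c x h

theorem image_projInit_image_graphMap {n : ℕ} (B : Fin n → ℤ) (c : ℝ) (Q : Set (Fin n → ℝ)) :
    (projInit n).toFun '' ((graphMap B c).toFun '' Q) = Q := by
  simp [Set.image_image, toFun_projInit, toFun_graphMap]

theorem idx_projInit_image_graphMap {n : ℕ} (p : ℝ) (Q : Set (Fin n → ℝ)) :
    (projInit n).idx (vectorSpan ℝ ((graphMap 0 p).toFun '' Q)) = 1 := by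
  refine (projInit n).idx_eq_one fun w hw => ⟨sn w 0, ?_, ?_⟩
  · rw [← IntAffineMap.vectorSpan_image, image_projInit_image_graphMap] at hw
    rw [IntAffineMap.vectorSpan_image, mem_lat, castVec_sn]
    refine ⟨castVec n w, hw, ?_⟩
    rw [linMap_graphMap]
    simp [intForm_apply]
  · have h := IntAffineMap.linMap_castVec (projInit n) (sn w 0)
    rw [linMap_projInit, iniL_apply, ini_castVec, ini_sn] at h
    ext i
    have := congrFun h i
    rw [castVec_apply, castVec_apply] at this
    exact_mod_cast this.symm

theorem isLinearPart_maxLast_cpx {n d : ℕ} {S : Finset ((Fin (n + 1) → ℤ) × ℝ)}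
    {c : Chain (n + 1) d} {p : ℝ} (hp : (lastForm n, p) ∈ S) :
    ∀ σ ∈ (Chain.cpx S c).cells, ∃ A, IsLinearPart (maxLast n p) σ A := by
  intro σ hσ
  obtain ⟨x, rfl⟩ := mem_allCells.1 (Finset.mem_filter.1 hσ).1
  rcases le_total 0 (gap (lastForm n, p) x) with h | h
  · refine ⟨_, isLinearPart_maxLast_of_ge fun z hz => ?_⟩
    have := (mem_signCell.1 hz _ hp).1 h
    rwa [gap_lastForm, sub_nonneg] at this
  · refine ⟨_, isLinearPart_maxLast_of_le fun z hz => ?_⟩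
    have := (mem_signCell.1 hz _ hp).2 h
    rwa [gap_lastForm, sub_nonpos] at this

namespace Chain

variable {n k : ℕ}

theorem fn_push_graphMap (e : Chain n k) (p : ℝ) (x : Fin (n + 1) → ℝ) :
    fn ((graphMap 0 p).push e) x = if x (Fin.last n) = p then fn e (ini x) else 0 := by
  rw [IntAffineMap.fn_push, fn_apply]
  have hmem : ∀ Q : Cell n k, (cellDim ((graphMap 0 p).toFun '' Q.1) = k ∧
      x ∈ intrinsicInterior ℝ ((graphMap 0 p).toFun '' Q.1)) ↔
      x (Fin.last n) = p ∧ ini x ∈ intrinsicInterior ℝ Q.1 := by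
    intro Q
    rw [IntAffineMap.mem_intrinsicInterior_image Q.2.1 fun x _ h => graphMap_inj 0 p x h,
      and_iff_right ((cellDim_image_graphMap 0 p Q.1).trans Q.2.2)]
    constructor
    · rintro ⟨z, hz, rfl⟩
      rw [toFun_graphMap]
      simpa [intForm_apply, -mem_intrinsicInterior] using hz
    · rintro ⟨h1, h2⟩
      refine ⟨ini x, h2, ?_⟩
      rw [toFun_graphMap]
      exact sn_ext (by simp) (by simp [intForm_apply, h1])
  by_cases hx : x (Fin.last n) = p
  · rw [if_pos hx]
    refine Finset.sum_congr rfl fun Q _ => ?_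
    rw [idx_graphMap, Nat.cast_one, mul_one]
    exact if_congr ((hmem Q).trans (and_iff_right hx)) rfl rfl
  · rw [if_neg hx]
    exact Finset.sum_eq_zero fun Q _ => if_neg fun h => hx ((hmem Q).1 h).1

theorem cls_push_projInit_push_graphMap (e : Chain n k) (p : ℝ) :
    cls ((projInit n).push ((graphMap 0 p).push e)) = cls e := by
  rw [cls_apply, cls_apply]
  congr 1
  rw [fn, IntAffineMap.linearCombination_push (projInit n)
    (fun Q x => if x ∈ intrinsicInterior ℝ Q then (1 : ℤ) else 0)]
  have h := IntAffineMap.linearCombination_push (graphMap 0 p)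
    (fun Q => if cellDim ((projInit n).toFun '' Q) = k then
      ((projInit n).idx (vectorSpan ℝ Q) : ℤ) • fun x =>
        if x ∈ intrinsicInterior ℝ ((projInit n).toFun '' Q) then (1 : ℤ) else 0 else 0) e
  rw [Finsupp.linearCombination_apply, Finsupp.sum] at h
  rw [h, Finsupp.linearCombination_apply, Finsupp.sum]
  refine Finset.sum_congr rfl fun Q _ => ?_
  rw [image_projInit_image_graphMap, idx_projInit_image_graphMap, idx_graphMap,
    if_pos ((cellDim_image_graphMap 0 p Q.1).trans Q.2.2), if_pos Q.2.2]
  simp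

/-- The fiber of a family at a height near which the family is a cylinder over a chain. -/
theorem isFiber_of_fn_eq {c : Chain (n + 1) (k + 1)} (hc : Bal c) {e : Chain n k} {p : ℝ}
    {U : Set (Fin (n + 1) → ℝ)} (hU : IsOpen U)
    (hpU : ∀ x : Fin (n + 1) → ℝ, x (Fin.last n) = p → x ∈ U)
    (h : ∀ x ∈ U, fn c x = fn e (ini x)) {F : TropicalCycle (n + 1) (k + 1)}
    (hF : F.1 = cls c) : IsFiber F p (cls e) := by
  obtain ⟨S, hpS, hS⟩ := exists_adapted c {(lastForm n, p)}
  have hK := isTropical_cpx hS hc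
  have hKc := toClass_cpx hS
  set K := cpx S c with hKdef
  have hr : ∀ σ ∈ K.cells, ∃ A, IsLinearPart (maxLast n p) σ A :=
    isLinearPart_maxLast_cpx (hpS (Finset.mem_singleton_self _))
  have hcont : Continuous (maxLast n p) := by unfold maxLast; fun_prop
  refine ⟨_, ⟨K, ⟨hK, hKc.trans hF.symm⟩, ⟨isReduced_cpx S c, hcont.continuousOn, hr⟩, rfl⟩,
    K.divisor (maxLast n p), rfl, ?_⟩
  rw [← IntAffineMap.cls_push_chain, ← cls_push_projInit_push_graphMap e p]
  refine IntAffineMap.cls_push_congr _ ?_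
  rw [WeightedComplex.cls_chain, WeightedComplex.toClass_divisor_maxLast hK.2 hr]
  have h1 := K.cls_chain.trans hKc
  rw [cls_apply, cls_apply, mk_eq_mk_iff] at h1
  rw [mk_ht_trunc_congr (c' := cyl e) hU hpU (h1.mono fun x hx => ?_), cls_apply]
  · congr 1
    funext x
    rw [fn_push_graphMap]
    by_cases hx : x (Fin.last n) = p
    · rw [if_pos hx, if_pos hx, ht_trunc_cyl e hx]
    · rw [if_neg hx, if_neg hx]
  · intro he
    apply hx.2
    rw [he, h x hx.1, fn_cyl]

end Chain

/-! ### The two ridges of a facet around a cell of codimension two -/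

namespace WeightedComplex

variable {n d : ℕ}

/-- A linear form that describes the cell `σ` near a cell `τ` of codimension one in `σ`. -/
theorem exists_ridgeForm {K : WeightedComplex n d} {τ σ : Set (Fin n → ℝ)} (hτ : τ ∈ K.cells)
    (hσ : σ ∈ K.cells) (hτσ : τ ⊆ σ) (hd : cellDim τ + 1 = cellDim σ) {y : Fin n → ℝ}
    (hy : y ∈ intrinsicInterior ℝ τ) :
    ∃ a : Fin n → ℤ, (∀ v ∈ vectorSpan ℝ σ, v ∈ vectorSpan ℝ τ ↔ intForm a v = 0) ∧
      (∀ z ∈ σ, ∀ x ∈ τ, 0 ≤ intForm a (z - x)) ∧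
      (∀ z ∈ σ, ∀ x ∈ τ, intForm a (z - x) = 0 → z ∈ τ) ∧ 0 < a ⬝ᵥ pv σ y := by
  have hyτ := intrinsicInterior_subset hy
  have hyσ := hτσ hyτ
  have hσQ := K.isPolyhedron σ hσ
  have hl := lineality_eq hτ hσ hy hτσ
  have hd' : Module.finrank ℝ (lineality σ y) + 1 = cellDim σ := by rw [hl]; exact hd
  obtain ⟨a, h1, h2, h3⟩ := exists_facetForm hσQ hyσ hd'
  have h4 := (pv_spec hσQ hyσ hd').pos hσQ hd' h1 h2
  rw [hl] at h1
  have hx0 : ∀ x ∈ τ, intForm a (x - y) = 0 := fun x hx =>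
    (h1 _ (vsub_mem_vectorSpan ℝ (hτσ hx) hyσ)).1 (vsub_mem_vectorSpan ℝ hx hyτ)
  have hzx : ∀ z, ∀ x ∈ τ, intForm a (z - x) = intForm a (z - y) := fun z x hx => by
    rw [← sub_sub_sub_cancel_right z x y, map_sub _ (z - y), hx0 x hx, sub_zero]
  refine ⟨a, h1, fun z hz x hx => by rw [hzx z x hx]; exact h2 z hz, fun z hz x hx h0 => ?_, h4⟩
  rw [hzx z x hx] at h0
  -- `y` lies in the interior of a segment in `σ` that starts at `z`
  have hm : -(z - y) ∈ vectorSpan ℝ σ := neg_mem (vsub_mem_vectorSpan ℝ hz hyσ)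
  obtain ⟨s, hs, hs0⟩ := ((h3 _ hm (by rw [map_neg, h0, neg_zero])).and
    self_mem_nhdsWithin).exists
  have hs0 : 0 < s := hs0
  have hint : τ ∩ σ = τ := Set.inter_eq_left.2 hτσ
  have hface := (K.inter_face τ hτ σ hσ (hint.symm ▸ ⟨y, hyτ⟩)).2
  rw [hint] at hface
  refine hface.2.isExtreme.left_mem_of_mem_openSegment hz hs hyτ ?_
  refine ⟨s / (1 + s), 1 / (1 + s), by positivity, by positivity, by field_simp; ring, ?_⟩
  ext i
  simp only [Pi.add_apply, Pi.smul_apply, Pi.neg_apply, Pi.sub_apply, smul_eq_mul]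
  field_simp
  ring

/-- A facet has a second ridge around a cell of codimension two: move from the given ridge
through the interior of the facet until another inequality becomes active. -/
theorem exists_ridge_ne {K : WeightedComplex n (d + 1)} {κ τ σ : Set (Fin n → ℝ)}
    (hκ : κ ∈ K.cells) (hκd : cellDim κ + 1 = d) (hτ : τ ∈ K.ridges) (hσ : σ ∈ K.facets)
    (hκτ : κ ⊆ τ) (hτσ : τ ⊆ σ) : ∃ τ' ∈ K.ridges, (κ ⊆ τ' ∧ τ' ⊆ σ) ∧ τ' ≠ τ := by
  obtain ⟨hτ1, hτd⟩ := Finset.mem_filter.1 hτ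
  obtain ⟨hσ1, hσd⟩ := Finset.mem_filter.1 hσ
  have hτd' : cellDim τ = d := by omega
  obtain ⟨y, hy⟩ := exists_mem_intrinsicInterior (K.isPolyhedron κ hκ)
  obtain ⟨x₁, hx₁⟩ := exists_mem_intrinsicInterior (K.isPolyhedron τ hτ1)
  have hyκ := intrinsicInterior_subset hy
  have hyτ := hκτ hyκ
  have hyσ := hτσ hyτ
  have hlσ := lineality_eq hκ hσ1 hy (hκτ.trans hτσ)
  have hlτ := lineality_eq hκ hτ1 hy hκτ
  obtain ⟨a, ha1, ha2, ha3, -⟩ := exists_ridgeForm hτ1 hσ1 hτσ (hτd.trans hσd.symm) hx₁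
  have hv := pv_spec (K.isPolyhedron τ hτ1) hyτ (by rw [hlτ]; unfold cellDim at *; omega)
  have hvn := hv.notMem (K.isPolyhedron τ hτ1) (by rw [hlτ]; unfold cellDim at *; omega)
  obtain ⟨hv1, -, ε, hε, hv2⟩ := hv
  rw [mem_lat] at hv1
  rw [hlτ] at hvn
  set v := castVec n (pv τ y)
  obtain ⟨x, hx⟩ := exists_mem_intrinsicInterior (K.isPolyhedron σ hσ1)
  have hxσ := intrinsicInterior_subset hx
  have hax : 0 < intForm a (x - y) := by
    refine lt_of_le_of_ne (ha2 x hxσ y hyτ) fun h0 => ?_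
    have h1 := subset_of_mem_intrinsicInterior hσ1 hτ1 hx (ha3 x hxσ y hyτ h0.symm)
    have h2 := Submodule.finrank_mono (vectorSpan_mono ℝ h1)
    unfold cellDim at *
    omega
  obtain ⟨-, S, rfl⟩ := isRationalPolyhedron_iff.1 (K.isPolyhedron _ hσ1)
  rw [lineality_poly hyσ] at hlσ
  rw [mem_intrinsicInterior_iff (K.isPolyhedron _ hσ1), lineality_poly hxσ] at hx
  have hact : ∀ c ∈ S, gap c y = 0 → 0 ≤ intForm c.1 v :=
    intForm_nonneg_of_mem_poly hε (hτσ hv2)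
  have hu : ∀ c, gap c y = 0 → intForm c.1 (x - y) = gap c x := fun c h0 => by
    rw [intForm_sub_eq_gap, h0, sub_zero]
  have hBne : (S.filter fun c => gap c y = 0 ∧ 0 < intForm c.1 v).Nonempty := by
    rw [← hlσ, mem_kerAt] at hvn
    push Not at hvn
    obtain ⟨c, hc, h0, hne⟩ := hvn
    exact ⟨c, Finset.mem_filter.2 ⟨hc, h0, lt_of_le_of_ne (hact c hc h0) (Ne.symm hne)⟩⟩
  obtain ⟨c₀, hc₀, hmin⟩ := Finset.exists_min_image _
    (fun c => intForm c.1 (x - y) / intForm c.1 v) hBne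
  obtain ⟨hc₀S, hc₀y, hc₀v⟩ := Finset.mem_filter.1 hc₀
  -- `w` is the last direction between `x - y` and `-v` that points into the facet
  set r := intForm c₀.1 (x - y) / intForm c₀.1 v with hr
  set w := (x - y) - r • v with hw
  have hwc : ∀ c : (Fin n → ℤ) × ℝ,
      intForm c.1 w = intForm c.1 (x - y) - r * intForm c.1 v := fun c => by
    rw [hw, map_sub, map_smul, smul_eq_mul]
  have hw0 : intForm c₀.1 w = 0 := by
    rw [hwc, hr, div_mul_cancel₀ _ hc₀v.ne', sub_self]
  have hwpos : ∀ c ∈ S, gap c y = 0 → 0 ≤ intForm c.1 w := by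
    intro c hc h0
    rw [hwc]
    rcases (hact c hc h0).lt_or_eq with h | h
    · have h1 := hmin c (Finset.mem_filter.2 ⟨hc, h0, h⟩)
      rw [le_div_iff₀ h] at h1
      linarith
    · rw [← h, mul_zero, sub_zero, hu c h0]
      exact hxσ c hc
  have hwa : 0 < intForm a w := by
    have : intForm a v = 0 := (ha1 v (vectorSpan_mono ℝ hτσ hv1)).1 hv1
    rw [hw, map_sub, map_smul, this, smul_zero, sub_zero]
    exact hax
  have hin : ∀ᶠ s in 𝓝[>] (0 : ℝ), ∀ c ∈ S, 0 < gap c y → 0 < gap c (y + s • w) :=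
    (eventually_all_finset S).2 fun c _ => by
      by_cases h : 0 < gap c y
      · exact (eventually_pos_gap c y w h).mono fun s hs _ => hs
      · exact Eventually.of_forall fun s h' => absurd h' h
  obtain ⟨s, ⟨hz, hzin⟩, hs⟩ :=
    (((eventually_mem_poly hyσ hwpos).and hin).and self_mem_nhdsWithin).exists
  have hs : 0 < s := hs
  set z := y + s • w with hzdef
  have hzact : ∀ c ∈ S, gap c z = 0 → gap c y = 0 := fun c hc h0 => by
    by_contra h
    exact (hzin c hc (lt_of_le_of_ne (hyσ c hc) (Ne.symm h))).ne' h0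
  -- the second ridge is the cell of a point close to `y` in the direction `w`
  obtain ⟨q, -, hq⟩ := exists_poly_eq_signCell (S := S) ⟨y, hyσ⟩
  have hface : IsFace (signCell S z) (poly S) := by
    rw [hq]
    exact isFace_signCell_iff.2 ⟨z, hq ▸ hz, rfl⟩
  have hmem := K.face_mem _ hσ1 _ hface
  have hsub := hface.2.subset
  -- its dimension lies strictly between those of `κ` and `σ`
  have hlt1 : vectorSpan ℝ κ < kerAt S z := by
    rw [← hlσ]
    refine lt_of_le_of_ne (fun u hu c hc h0 => hu c hc (hzact c hc h0)) fun heq => ?_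
    have h1 : w ∈ kerAt S z := fun c hc h0 => by
      have h2 := hzact c hc h0
      rw [hzdef, gap_add_smul, h2, zero_add, mul_eq_zero] at h0
      exact h0.resolve_left hs.ne'
    rw [← heq, hlσ, ← hlτ] at h1
    have h2 := lineality_le_vectorSpan hyτ h1
    exact hwa.ne' ((ha1 w (vectorSpan_mono ℝ hτσ h2)).1 h2)
  have hc₀z : gap c₀ z = 0 := by rw [hzdef, gap_add_smul, hc₀y, hw0, mul_zero, add_zero]
  have hlt2 : kerAt S z < vectorSpan ℝ (poly S) := by
    rw [← vectorSpan_signCell]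
    refine lt_of_le_of_ne (vectorSpan_mono ℝ hsub) fun heq => ?_
    have h1 : v ∈ kerAt S z := by
      rw [← vectorSpan_signCell, heq]; exact vectorSpan_mono ℝ hτσ hv1
    exact hc₀v.ne' (h1 c₀ hc₀S hc₀z)
  have hdim : cellDim (signCell S z) = d := by
    have h1 := Submodule.finrank_lt_finrank_of_lt hlt1
    have h2 := Submodule.finrank_lt_finrank_of_lt hlt2
    unfold cellDim at *
    rw [vectorSpan_signCell]
    omega
  refine ⟨signCell S z, Finset.mem_filter.2 ⟨hmem, by rw [hdim]⟩, ⟨?_, hsub⟩, fun heq => ?_⟩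
  · refine subset_of_mem_intrinsicInterior hκ hmem hy (mem_signCell.2 fun c hc =>
      ⟨fun _ => hyσ c hc, fun h => ?_⟩)
    exact (hzact c hc (le_antisymm h (hz c hc))).le
  · have h1 : v ∈ kerAt S z := by rw [← vectorSpan_signCell, heq]; exact hv1
    exact hc₀v.ne' (h1 c₀ hc₀S hc₀z)

end WeightedComplex

/-- Two pairs `(v₁, w₁)` and `(v₂, w₂)` that express each other integrally modulo `M`. If `aᵢ`
vanishes on `vᵢ` and is positive on `wᵢ` and on the other `v`, then the base change has determinant
`-1`; so expressions that are bilinear and alternating in the two vectors change their sign. -/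
theorem det_neg_of_pos {n : ℕ} {M : AddSubgroup (Fin n → ℤ)} {v₁ w₁ v₂ w₂ a₁ a₂ : Fin n → ℤ}
    (hM₁ : ∀ x ∈ M, a₁ ⬝ᵥ x = 0) (hM₂ : ∀ x ∈ M, a₂ ⬝ᵥ x = 0)
    (h₁ : ∀ x ∈ ({v₂, w₂} : Set (Fin n → ℤ)), ∃ k l : ℤ, x - k • w₁ - l • v₁ ∈ M)
    (h₂ : ∀ x ∈ ({v₁, w₁} : Set (Fin n → ℤ)), ∃ k l : ℤ, x - k • w₂ - l • v₂ ∈ M)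
    (h₁v : a₁ ⬝ᵥ v₁ = 0) (h₁w : 0 < a₁ ⬝ᵥ w₁) (h₁v' : 0 < a₁ ⬝ᵥ v₂)
    (h₂v : a₂ ⬝ᵥ v₂ = 0) (h₂w : 0 < a₂ ⬝ᵥ w₂) (h₂v' : 0 < a₂ ⬝ᵥ v₁) :
    (∀ A : Fin n → ℤ, (∀ x ∈ M, A ⬝ᵥ x = 0) →
      ((A ⬝ᵥ w₁) • v₁ - (A ⬝ᵥ v₁) • w₁) + ((A ⬝ᵥ w₂) • v₂ - (A ⬝ᵥ v₂) • w₂) ∈ M) ∧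
    ∀ f g : Fin n → ℤ, (∀ x ∈ M, f ⬝ᵥ x = 0) → (∀ x ∈ M, g ⬝ᵥ x = 0) →
      (f ⬝ᵥ v₂) * (g ⬝ᵥ w₂) - (g ⬝ᵥ v₂) * (f ⬝ᵥ w₂) =
        -((f ⬝ᵥ v₁) * (g ⬝ᵥ w₁) - (g ⬝ᵥ v₁) * (f ⬝ᵥ w₁)) := by
  obtain ⟨b, a, hv⟩ := h₁ v₂ (by simp)
  obtain ⟨e, c, hw⟩ := h₁ w₂ (by simp)
  obtain ⟨b', a', hv'⟩ := h₂ v₁ (by simp)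
  obtain ⟨e', c', hw'⟩ := h₂ w₁ (by simp)
  have ev : ∀ {f x k u l t : _} , (∀ x ∈ M, f ⬝ᵥ x = 0) → x - k • u - l • t ∈ M →
      f ⬝ᵥ x = k * (f ⬝ᵥ u) + l * (f ⬝ᵥ t) := by
    intro f x k u l t hf hx
    have := hf _ hx
    rw [dotProduct_sub, dotProduct_sub, dotProduct_smul, dotProduct_smul, smul_eq_mul,
      smul_eq_mul] at this
    linarith
  have d1 : ∀ f g : Fin n → ℤ, (∀ x ∈ M, f ⬝ᵥ x = 0) → (∀ x ∈ M, g ⬝ᵥ x = 0) →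
      (f ⬝ᵥ v₂) * (g ⬝ᵥ w₂) - (g ⬝ᵥ v₂) * (f ⬝ᵥ w₂) =
        (a * e - b * c) * ((f ⬝ᵥ v₁) * (g ⬝ᵥ w₁) - (g ⬝ᵥ v₁) * (f ⬝ᵥ w₁)) := by
    intro f g hf hg
    rw [ev hf hv, ev hg hv, ev hf hw, ev hg hw]; ring
  have d2 : ∀ f g : Fin n → ℤ, (∀ x ∈ M, f ⬝ᵥ x = 0) → (∀ x ∈ M, g ⬝ᵥ x = 0) →
      (f ⬝ᵥ v₁) * (g ⬝ᵥ w₁) - (g ⬝ᵥ v₁) * (f ⬝ᵥ w₁) =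
        (a' * e' - b' * c') * ((f ⬝ᵥ v₂) * (g ⬝ᵥ w₂) - (g ⬝ᵥ v₂) * (f ⬝ᵥ w₂)) := by
    intro f g hf hg
    rw [ev hf hv', ev hg hv', ev hf hw', ev hg hw']; ring
  -- the determinant is a unit, and the forms `a₁` and `a₂` show that it is negative
  have hδ : a * e - b * c = -1 := by
    have e1 := d1 a₁ a₂ hM₁ hM₂
    have e2 := d2 a₁ a₂ hM₁ hM₂
    rw [h₁v, h₂v] at e1 e2
    have p1 : 0 < (a₁ ⬝ᵥ v₂) * (a₂ ⬝ᵥ w₂) := mul_pos h₁v' h₂w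
    have p2 : 0 < (a₂ ⬝ᵥ v₁) * (a₁ ⬝ᵥ w₁) := mul_pos h₂v' h₁w
    generalize a * e - b * c = δ at *
    generalize a' * e' - b' * c' = δ' at *
    have h3 : δ * δ' = 1 := by
      have h4 : (δ * δ' - 1) * ((a₂ ⬝ᵥ v₁) * (a₁ ⬝ᵥ w₁)) = 0 := by
        linear_combination δ' * e1 + e2
      rcases mul_eq_zero.1 h4 with h | h
      · linarith
      · exact absurd h p2.ne'
    rcases Int.eq_one_or_neg_one_of_mul_eq_one h3 with h | h
    · rw [h] at e1
      linarith
    · exact h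
  refine ⟨fun A hA => ?_, fun f g hf hg => by rw [d1 f g hf hg, hδ]; ring⟩
  have h1 : ((A ⬝ᵥ w₁) • v₁ - (A ⬝ᵥ v₁) • w₁) + ((A ⬝ᵥ w₂) • v₂ - (A ⬝ᵥ v₂) • w₂) =
      (A ⬝ᵥ w₂) • (v₂ - b • w₁ - a • v₁) - (A ⬝ᵥ v₂) • (w₂ - e • w₁ - c • v₁) := by
    rw [ev hA hv, ev hA hw]
    ext i
    simp only [Pi.add_apply, Pi.sub_apply, Pi.smul_apply, smul_eq_mul]
    linear_combination ((A ⬝ᵥ w₁) * v₁ i - (A ⬝ᵥ v₁) * w₁ i) * hδ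
  rw [h1]
  exact M.sub_mem (M.zsmul_mem hv _) (M.zsmul_mem hw _)

namespace WeightedComplex

variable {n d : ℕ}

theorem eq_of_le_finrank_inter {K : WeightedComplex n d} {τ₁ τ₂ : Set (Fin n → ℝ)} {e : ℕ}
    (h₁ : τ₁ ∈ K.cells) (h₂ : τ₂ ∈ K.cells) (hd₁ : cellDim τ₁ = e) (hd₂ : cellDim τ₂ = e)
    (hne : (τ₁ ∩ τ₂).Nonempty) (hd : e ≤ Module.finrank ℝ (vectorSpan ℝ (τ₁ ∩ τ₂))) :
    τ₁ = τ₂ := by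
  have hρ := K.face_mem _ h₁ _ (K.inter_face _ h₁ _ h₂ hne).1
  obtain ⟨z, hz⟩ := exists_mem_intrinsicInterior (K.isPolyhedron _ hρ)
  rw [mem_intrinsicInterior_iff (K.isPolyhedron _ hρ)] at hz
  unfold cellDim at hd₁ hd₂
  have key : ∀ τ ∈ K.cells, Module.finrank ℝ (vectorSpan ℝ τ) = e → τ₁ ∩ τ₂ ⊆ τ →
      z ∈ intrinsicInterior ℝ τ := by
    intro τ hτ hdτ hsub
    refine (mem_intrinsicInterior_iff (K.isPolyhedron _ hτ)).2 ⟨hsub hz.1, ?_⟩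
    refine Submodule.eq_of_le_of_finrank_le (lineality_le_vectorSpan (hsub hz.1)) ?_
    rw [hdτ]
    refine hd.trans ?_
    rw [← hz.2]
    exact Submodule.finrank_mono (lineality_mono hsub z)
  exact eq_of_mem_intrinsicInterior h₁ h₂ (key τ₁ h₁ hd₁ Set.inter_subset_left)
    (key τ₂ h₂ hd₂ Set.inter_subset_right)

/-- Around a cell `κ` of codimension two in a facet `σ`, the primitive vectors `v_{τ/κ}` and
`v_{σ/τ}` form a lattice basis of `σ` modulo `κ` for each of the two ridges `τ` between `κ` and
`σ`, and these bases are oriented oppositely. -/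
theorem sum_ridges_mem {K : WeightedComplex n (d + 1)} {κ σ : Set (Fin n → ℝ)}
    (hκ : κ ∈ K.cells) (hκd : cellDim κ + 1 = d) (hσ : σ ∈ K.facets) {y : Fin n → ℝ}
    (hy : y ∈ intrinsicInterior ℝ κ) {Y : Set (Fin n → ℝ) → Fin n → ℝ}
    (hY : ∀ τ ∈ K.ridges, Y τ ∈ intrinsicInterior ℝ τ) {A : Fin n → ℤ}
    (hA : ∀ x ∈ lat (vectorSpan ℝ κ), A ⬝ᵥ x = 0) :
    ∑ τ ∈ K.ridges.filter (fun τ => κ ⊆ τ ∧ τ ⊆ σ), ((A ⬝ᵥ pv σ (Y τ)) • pv τ y -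
      (A ⬝ᵥ pv τ y) • pv σ (Y τ)) ∈ lat (vectorSpan ℝ κ) := by
  set T := K.ridges.filter (fun τ => κ ⊆ τ ∧ τ ⊆ σ) with hT
  obtain ⟨hσ1, hσd⟩ := Finset.mem_filter.1 hσ
  have hyκ := intrinsicInterior_subset hy
  have hTm : ∀ τ ∈ T, τ ∈ K.ridges ∧ τ ∈ K.cells ∧ cellDim τ = d ∧ κ ⊆ τ ∧ τ ⊆ σ := by
    intro τ hτ
    obtain ⟨h1, h2⟩ := Finset.mem_filter.1 hτ
    obtain ⟨h3, h4⟩ := Finset.mem_filter.1 h1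
    exact ⟨h1, h3, by omega, h2⟩
  have hex : ∀ τ ∈ T, ∃ a : Fin n → ℤ,
      (∀ v ∈ vectorSpan ℝ σ, v ∈ vectorSpan ℝ τ ↔ intForm a v = 0) ∧
      (∀ z ∈ σ, ∀ x ∈ τ, 0 ≤ intForm a (z - x)) ∧
      (∀ z ∈ σ, ∀ x ∈ τ, intForm a (z - x) = 0 → z ∈ τ) ∧ 0 < a ⬝ᵥ pv σ (Y τ) := by
    intro τ hτ
    obtain ⟨h1, h2, h3, h4, h5⟩ := hTm τ hτ
    exact exists_ridgeForm h2 hσ1 h5 (by omega) (hY τ h1)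
  choose! a ha1 ha2 ha3 ha4 using hex
  have hl : ∀ τ ∈ T, lineality τ y = vectorSpan ℝ κ := fun τ hτ =>
    lineality_eq hκ (hTm τ hτ).2.1 hy (hTm τ hτ).2.2.2.1
  have hfr : ∀ τ ∈ T, Module.finrank ℝ (lineality τ y) + 1 = cellDim τ := fun τ hτ => by
    rw [hl τ hτ, (hTm τ hτ).2.2.1]; exact hκd
  have hv : ∀ τ ∈ T, IsPrimAt τ y (pv τ y) := fun τ hτ =>
    pv_spec (K.isPolyhedron τ (hTm τ hτ).2.1) ((hTm τ hτ).2.2.2.1 hyκ) (hfr τ hτ)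
  have hlσ : ∀ τ ∈ T, lineality σ (Y τ) = vectorSpan ℝ τ := fun τ hτ =>
    lineality_eq (hTm τ hτ).2.1 hσ1 (hY τ (hTm τ hτ).1) (hTm τ hτ).2.2.2.2
  have hw : ∀ τ ∈ T, IsPrimAt σ (Y τ) (pv σ (Y τ)) := fun τ hτ => by
    refine pv_spec (K.isPolyhedron σ hσ1)
      ((hTm τ hτ).2.2.2.2 (intrinsicInterior_subset (hY τ (hTm τ hτ).1))) ?_
    rw [hlσ τ hτ, hσd, ← (hTm τ hτ).2.2.1]; rfl
  have hτle : ∀ τ ∈ T, vectorSpan ℝ τ ≤ vectorSpan ℝ σ := fun τ hτ =>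
    vectorSpan_mono ℝ (hTm τ hτ).2.2.2.2
  have hκle : ∀ τ ∈ T, vectorSpan ℝ κ ≤ vectorSpan ℝ τ := fun τ hτ =>
    vectorSpan_mono ℝ (hTm τ hτ).2.2.2.1
  have haτ : ∀ τ ∈ T, ∀ x ∈ lat (vectorSpan ℝ τ), a τ ⬝ᵥ x = 0 := fun τ hτ x hx => by
    have := (ha1 τ hτ _ (hτle τ hτ hx)).1 hx
    rw [intForm_castVec] at this
    exact_mod_cast this
  have hbasis : ∀ τ ∈ T, ∀ x ∈ lat (vectorSpan ℝ σ),
      ∃ k l : ℤ, x - k • pv σ (Y τ) - l • pv τ y ∈ lat (vectorSpan ℝ κ) := by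
    intro τ hτ x hx
    obtain ⟨k, hk⟩ := (hw τ hτ).2.1 x hx
    rw [hlσ τ hτ] at hk
    obtain ⟨l, hl'⟩ := (hv τ hτ).2.1 _ hk
    rw [hl τ hτ] at hl'
    exact ⟨k, l, hl'⟩
  -- different ridges lie on the positive sides of each other
  have hpos : ∀ τ ∈ T, ∀ τ' ∈ T, τ ≠ τ' → 0 < a τ ⬝ᵥ pv τ' y := by
    intro τ hτ τ' hτ' hne
    obtain ⟨-, h2, h3, h4, h5⟩ := hTm τ hτ
    obtain ⟨-, h2', h3', h4', h5'⟩ := hTm τ' hτ'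
    obtain ⟨-, -, ε, hε, hz⟩ := hv τ' hτ'
    have h0 := ha2 τ hτ _ (h5' hz) y (h4 hyκ)
    have h6 := ha3 τ hτ _ (h5' hz) y (h4 hyκ)
    rw [add_sub_cancel_left, map_smul, intForm_castVec, smul_eq_mul] at h0 h6
    have h7 : 0 ≤ a τ ⬝ᵥ pv τ' y := by exact_mod_cast nonneg_of_mul_nonneg_right h0 hε
    refine lt_of_le_of_ne h7 fun h8 => hne ?_
    have hzτ := h6 (by rw [← h8]; simp)
    have hmem : castVec n (pv τ' y) ∈ vectorSpan ℝ (τ ∩ τ') := by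
      have := vsub_mem_vectorSpan ℝ (s := τ ∩ τ') ⟨hzτ, hz⟩ ⟨h4 hyκ, h4' hyκ⟩
      rw [vsub_eq_sub, add_sub_cancel_left] at this
      exact (Submodule.smul_mem_iff _ hε.ne').1 this
    refine eq_of_le_finrank_inter h2 h2' h3 h3' ⟨y, h4 hyκ, h4' hyκ⟩ ?_
    have hlt : vectorSpan ℝ κ < vectorSpan ℝ (τ ∩ τ') := by
      refine lt_of_le_of_ne (vectorSpan_mono ℝ (Set.subset_inter h4 h4')) fun heq => ?_
      rw [← heq, ← hl τ' hτ'] at hmem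
      exact (hv τ' hτ').notMem (K.isPolyhedron τ' h2') (hfr τ' hτ') hmem
    have := Submodule.finrank_lt_finrank_of_lt hlt
    unfold cellDim at hκd
    omega
  have hpair : ∀ τ ∈ T, ∀ τ' ∈ T, τ ≠ τ' → _ := fun τ hτ τ' hτ' hne =>
    det_neg_of_pos (M := lat (vectorSpan ℝ κ)) (v₁ := pv τ y) (w₁ := pv σ (Y τ))
      (v₂ := pv τ' y) (w₂ := pv σ (Y τ')) (a₁ := a τ) (a₂ := a τ')
      (fun x hx => haτ τ hτ x (lat_mono (hκle τ hτ) hx))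
      (fun x hx => haτ τ' hτ' x (lat_mono (hκle τ' hτ') hx))
      (by
        rintro x (rfl | rfl)
        exacts [hbasis τ hτ _ (lat_mono (hτle τ' hτ') (hv τ' hτ').1), hbasis τ hτ _ (hw τ' hτ').1])
      (by
        rintro x (rfl | rfl)
        exacts [hbasis τ' hτ' _ (lat_mono (hτle τ hτ) (hv τ hτ).1), hbasis τ' hτ' _ (hw τ hτ).1])
      (haτ τ hτ _ (hv τ hτ).1) (ha4 τ hτ) (hpos τ hτ τ' hτ' hne)
      (haτ τ' hτ' _ (hv τ' hτ').1) (ha4 τ' hτ') (hpos τ' hτ' τ hτ hne.symm)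
  rcases T.eq_empty_or_nonempty with h0 | ⟨τ₁, hτ₁⟩
  · rw [h0, Finset.sum_empty]; exact zero_mem _
  · obtain ⟨r1, -, -, r4, r5⟩ := hTm τ₁ hτ₁
    obtain ⟨τ₂, hr₂, hs₂, hne⟩ := exists_ridge_ne hκ hκd r1 hσ r4 r5
    have hτ₂ : τ₂ ∈ T := Finset.mem_filter.2 ⟨hr₂, hs₂⟩
    have hT2 : T = {τ₁, τ₂} := by
      ext τ
      rw [Finset.mem_insert, Finset.mem_singleton]
      refine ⟨fun hτ => ?_, by rintro (rfl | rfl) <;> assumption⟩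
      by_contra! hne'
      -- three opposite orientations cannot coexist
      have f1 : ∀ x ∈ lat (vectorSpan ℝ κ), a τ₁ ⬝ᵥ x = 0 := fun x hx =>
        haτ τ₁ hτ₁ x (lat_mono (hκle τ₁ hτ₁) hx)
      have f2 : ∀ x ∈ lat (vectorSpan ℝ κ), a τ₂ ⬝ᵥ x = 0 := fun x hx =>
        haτ τ₂ hτ₂ x (lat_mono (hκle τ₂ hτ₂) hx)
      have e1 := (hpair τ₁ hτ₁ τ₂ hτ₂ hne.symm).2 _ _ f1 f2
      have e2 := (hpair τ₁ hτ₁ τ hτ hne'.1.symm).2 _ _ f1 f2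
      have e3 := (hpair τ₂ hτ₂ τ hτ hne'.2.symm).2 _ _ f1 f2
      have p := mul_pos (hpos τ₂ hτ₂ τ₁ hτ₁ hne) (ha4 τ₁ hτ₁)
      have q := haτ τ₁ hτ₁ _ (hv τ₁ hτ₁).1
      rw [q, zero_mul] at e1 e2
      linarith
    rw [hT2, Finset.sum_pair hne.symm]
    exact (hpair τ₁ hτ₁ τ₂ hτ₂ hne.symm).1 A hA

/-- The divisor of a rational function is balanced: the sum at a cell `κ` of codimension two is a sum
over the pairs of a facet and a ridge around `κ`, and for each facet the contributions of its two
ridges cancel by `sum_ridges_mem`. -/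
theorem isBalanced_divisor {K : WeightedComplex n (d + 1)} (hK : K.IsBalanced)
    {φ : (Fin n → ℝ) → ℝ} (hr : ∀ σ ∈ K.cells, ∃ A, IsLinearPart φ σ A) :
    (K.divisor φ).IsBalanced := by
  intro κ hκ
  obtain ⟨hκ1, hκd⟩ := Finset.mem_filter.1 hκ
  have hκc := (Finset.mem_filter.1 hκ1).1
  obtain ⟨y, hy⟩ := exists_mem_intrinsicInterior (K.isPolyhedron κ hκc)
  have hyκ := intrinsicInterior_subset hy
  choose! A hA using hr
  have hYex : ∀ τ ∈ K.ridges, ∃ x, x ∈ intrinsicInterior ℝ τ := fun τ hτ =>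
    exists_mem_intrinsicInterior (K.isPolyhedron τ (Finset.mem_filter.1 hτ).1)
  choose! Y hY using hYex
  set T := K.ridges.filter (fun τ => κ ⊆ τ) with hT
  have hfa : (K.divisor φ).facetsAround κ = T := by rw [facetsAround, facets_divisor]
  rw [hfa]
  change ∑ τ ∈ T, K.divisorWeight φ τ • primitiveVector κ τ ∈ lat (vectorSpan ℝ κ)
  -- subtract a linear form from the function so that it becomes constant on `κ`
  set A' : Set (Fin n → ℝ) → Fin n → ℤ := fun σ => A σ - A κ with hA'
  have hA0 : ∀ σ ∈ K.cells, κ ⊆ σ → ∀ x ∈ lat (vectorSpan ℝ κ), A' σ ⬝ᵥ x = 0 := by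
    intro σ hσ hκσ x hx
    rw [hA', sub_dotProduct, ((hA σ hσ).mono hκσ).dotProduct_eq (hA κ hκc) hx, sub_self]
  have hAτ : ∀ τ ∈ K.cells, ∀ σ ∈ K.cells, τ ⊆ σ → ∀ x ∈ lat (vectorSpan ℝ τ),
      A' σ ⬝ᵥ x = A' τ ⬝ᵥ x := by
    intro τ hτ σ hσ hτσ x hx
    rw [hA', sub_dotProduct, sub_dotProduct, ((hA σ hσ).mono hτσ).dotProduct_eq (hA τ hτ) hx]
  -- the contribution of a ridge, as a sum over the facets around it
  have key : ∀ τ ∈ T, K.divisorWeight φ τ • primitiveVector κ τ -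
      ∑ σ ∈ K.facetsAround τ, K.weight σ • ((A' σ ⬝ᵥ pv σ (Y τ)) • pv τ y -
        (A' σ ⬝ᵥ pv τ y) • pv σ (Y τ)) ∈ lat (vectorSpan ℝ κ) := by
    intro τ hτ
    obtain ⟨hτr, hκτ⟩ := Finset.mem_filter.1 hτ
    obtain ⟨hτc, hτd⟩ := Finset.mem_filter.1 hτr
    have hprim := (primitiveVector_sub_pv_mem hκc hτc (by omega) hy hκτ).2
    have hlτ := lineality_eq hκc hτc hy hκτ
    have hpv := pv_spec (K.isPolyhedron τ hτc) (hκτ hyκ)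
      (by rw [hlτ]; unfold cellDim at *; omega)
    have hu : ∑ σ ∈ K.facetsAround τ, K.weight σ • pv σ (Y τ) ∈ lat (vectorSpan ℝ τ) := by
      rw [← dv_chain_ridge hτr (hY τ hτr)]
      exact dv_chain_mem hK _ _ hτd
    have hw := divisorWeight_eq hK hτr (hY τ hτr) (A := A) (B := A τ)
      (fun σ hσ => hA σ (Finset.mem_filter.1 (Finset.mem_filter.1 hσ).1).1) (hA τ hτc)
    have hw' : K.divisorWeight φ τ = ∑ σ ∈ K.facetsAround τ,
        K.weight σ * (A' σ ⬝ᵥ pv σ (Y τ)) -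
        A' τ ⬝ᵥ ∑ σ ∈ K.facetsAround τ, K.weight σ • pv σ (Y τ) := by
      rw [hw, hA']
      simp only [sub_dotProduct, mul_sub, Finset.sum_sub_distrib, dotProduct_sum,
        dotProduct_smul, smul_eq_mul]
      ring
    set u := ∑ σ ∈ K.facetsAround τ, K.weight σ • pv σ (Y τ) with hudef
    obtain ⟨α, hα⟩ := hpv.2.1 u hu
    rw [hlτ] at hα
    have hAu : A' τ ⬝ᵥ u = α * (A' τ ⬝ᵥ pv τ y) := by
      have := hA0 τ hτc hκτ _ hα
      rw [dotProduct_sub, dotProduct_smul, smul_eq_mul] at this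
      linarith
    have hsum : ∑ σ ∈ K.facetsAround τ, K.weight σ • ((A' σ ⬝ᵥ pv σ (Y τ)) • pv τ y -
        (A' σ ⬝ᵥ pv τ y) • pv σ (Y τ)) =
        (∑ σ ∈ K.facetsAround τ, K.weight σ * (A' σ ⬝ᵥ pv σ (Y τ))) • pv τ y -
          (A' τ ⬝ᵥ pv τ y) • u := by
      rw [Finset.sum_smul, hudef, Finset.smul_sum, ← Finset.sum_sub_distrib]
      refine Finset.sum_congr rfl fun σ hσ => ?_
      obtain ⟨hσ1, hτσ⟩ := Finset.mem_filter.1 hσ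
      rw [hAτ τ hτc σ (Finset.mem_filter.1 hσ1).1 hτσ _ hpv.1]
      rw [smul_sub, smul_smul, smul_comm]
    rw [hsum]
    have hfin : K.divisorWeight φ τ • primitiveVector κ τ -
        ((∑ σ ∈ K.facetsAround τ, K.weight σ * (A' σ ⬝ᵥ pv σ (Y τ))) • pv τ y -
          (A' τ ⬝ᵥ pv τ y) • u) =
        K.divisorWeight φ τ • (primitiveVector κ τ - pv τ y) +
          (A' τ ⬝ᵥ pv τ y) • (u - α • pv τ y) := by
      rw [hw', hAu]
      module
    rw [hfin]
    exact AddSubgroup.add_mem _ (AddSubgroup.zsmul_mem _ hprim _)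
      (AddSubgroup.zsmul_mem _ hα _)
  have htotal : ∑ τ ∈ T, ∑ σ ∈ K.facetsAround τ, K.weight σ •
      ((A' σ ⬝ᵥ pv σ (Y τ)) • pv τ y - (A' σ ⬝ᵥ pv τ y) • pv σ (Y τ)) ∈
      lat (vectorSpan ℝ κ) := by
    rw [Finset.sum_comm' (t' := K.facetsAround κ)
      (s' := fun σ => K.ridges.filter (fun τ => κ ⊆ τ ∧ τ ⊆ σ))]
    · refine AddSubgroup.sum_mem _ fun σ hσ => ?_
      obtain ⟨hσ1, hκσ⟩ := Finset.mem_filter.1 hσ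
      rw [← Finset.smul_sum]
      exact AddSubgroup.zsmul_mem _ (sum_ridges_mem hκc hκd hσ1 hy hY
        (hA0 σ (Finset.mem_filter.1 hσ1).1 hκσ)) _
    · intro τ σ
      simp only [hT, facetsAround, Finset.mem_filter]
      constructor
      · rintro ⟨⟨h1, h2⟩, h3, h4⟩
        exact ⟨⟨h1, h2, h4⟩, h3, h2.trans h4⟩
      · rintro ⟨⟨h1, h2, h4⟩, h3, -⟩
        exact ⟨⟨h1, h2⟩, h3, h4⟩
  have := AddSubgroup.add_mem _ (AddSubgroup.sum_mem _ key) htotal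
  rwa [← Finset.sum_add_distrib, Finset.sum_congr rfl fun τ _ => sub_add_cancel _ _] at this

end WeightedComplex

/-! ### The modification along a rational function -/

namespace Chain

variable {m n d : ℕ}

/-- The chain of the polyhedra `G σ` with weights `w σ`, for `σ` in a finite set. -/
def ofFinset (s : Finset (Set (Fin m → ℝ))) (w : Set (Fin m → ℝ) → ℤ)
    (G : Set (Fin m → ℝ) → Set (Fin n → ℝ))
    (h : ∀ σ ∈ s, IsRationalPolyhedron (G σ) ∧ cellDim (G σ) = d) : Chain n d :=
  ∑ σ ∈ s.attach, Finsupp.single ⟨G σ.1, h σ.1 σ.2⟩ (w σ.1)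

theorem linearCombination_ofFinset {A : Type*} [AddCommGroup A]
    {s : Finset (Set (Fin m → ℝ))} {w : Set (Fin m → ℝ) → ℤ}
    {G : Set (Fin m → ℝ) → Set (Fin n → ℝ)}
    (h : ∀ σ ∈ s, IsRationalPolyhedron (G σ) ∧ cellDim (G σ) = d) (g : Set (Fin n → ℝ) → A) :
    Finsupp.linearCombination ℤ (fun Q : Cell n d => g Q.1) (ofFinset s w G h) =
      ∑ σ ∈ s, w σ • g (G σ) := by
  rw [ofFinset, map_sum]
  simp only [Finsupp.linearCombination_single]
  exact Finset.sum_attach s fun σ => w σ • g (G σ)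

theorem exists_of_mem_support_ofFinset {s : Finset (Set (Fin m → ℝ))}
    {w : Set (Fin m → ℝ) → ℤ} {G : Set (Fin m → ℝ) → Set (Fin n → ℝ)}
    (h : ∀ σ ∈ s, IsRationalPolyhedron (G σ) ∧ cellDim (G σ) = d) {Q : Cell n d}
    (hQ : Q ∈ (ofFinset s w G h).support) : ∃ σ ∈ s, Q.1 = G σ := by
  obtain ⟨σ, -, hσ⟩ := Finset.mem_biUnion.1 (Finsupp.support_finsetSum hQ)
  have := Finset.mem_singleton.1 (Finsupp.support_single_subset hσ)
  exact ⟨σ.1, σ.2, by rw [this]⟩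

end Chain

/-- The graph over `σ` of the affine function with linear part `A σ` and constant `c σ`. -/
def graphCell {m : ℕ} (A : Set (Fin m → ℝ) → Fin m → ℤ) (c : Set (Fin m → ℝ) → ℝ)
    (σ : Set (Fin m → ℝ)) : Set (Fin (m + 1) → ℝ) := (graphMap (A σ) (c σ)).toFun '' σ

/-- The region below the graph over `τ` of the affine function with linear part `A τ` and
constant `c τ`. -/
def hypoCell {m : ℕ} (A : Set (Fin m → ℝ) → Fin m → ℤ) (c : Set (Fin m → ℝ) → ℝ)
    (τ : Set (Fin m → ℝ)) : Set (Fin (m + 1) → ℝ) := halfCyl (sn (A τ) (-1), -c τ) τ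

theorem sn_neg_one_ne {m : ℕ} (a : Fin m → ℤ) : sn a (-1) (Fin.last m) ≠ 0 := by simp

theorem gap_hypo {m : ℕ} (a : Fin m → ℤ) (b : ℝ) (x : Fin (m + 1) → ℝ) :
    gap (sn a (-1), -b) x = intForm a (ini x) + b - x (Fin.last m) := by
  rw [gap, intForm_sn]
  push_cast
  ring

namespace WeightedComplex

variable {m k : ℕ}

theorem graphCell_spec (K : WeightedComplex m (k + 1)) (A : Set (Fin m → ℝ) → Fin m → ℤ)
    (c : Set (Fin m → ℝ) → ℝ) : ∀ σ ∈ K.facets,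
      IsRationalPolyhedron (graphCell A c σ) ∧ cellDim (graphCell A c σ) = k + 1 :=
  fun σ hσ => ⟨(K.isPolyhedron σ (Finset.mem_filter.1 hσ).1).image
    fun x _ h => graphMap_inj _ _ x h,
    (cellDim_image_graphMap _ _ σ).trans (cellDim_of_mem_facets hσ)⟩

theorem hypoCell_spec (K : WeightedComplex m (k + 1)) (A : Set (Fin m → ℝ) → Fin m → ℤ)
    (c : Set (Fin m → ℝ) → ℝ) : ∀ τ ∈ K.ridges,
      IsRationalPolyhedron (hypoCell A c τ) ∧ cellDim (hypoCell A c τ) = k + 1 :=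
  fun τ hτ => ⟨(K.isPolyhedron τ (Finset.mem_filter.1 hτ).1).halfCyl (sn_neg_one_ne _),
    (cellDim_halfCyl (K.isPolyhedron τ (Finset.mem_filter.1 hτ).1) (sn_neg_one_ne _)).trans
      (Finset.mem_filter.1 hτ).2⟩

/-- The graph of a piecewise affine function `φ` together with the downward cells over the
divisor of `φ`. -/
def modification (K : WeightedComplex m (k + 1)) (φ : (Fin m → ℝ) → ℝ)
    (A : Set (Fin m → ℝ) → Fin m → ℤ) (c : Set (Fin m → ℝ) → ℝ) : Chain (m + 1) (k + 1) :=
  Chain.ofFinset K.facets K.weight (graphCell A c) (K.graphCell_spec A c) +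
    Chain.ofFinset K.ridges (K.divisorWeight φ) (hypoCell A c) (K.hypoCell_spec A c)

theorem linearCombination_modification {M : Type*} [AddCommGroup M]
    (K : WeightedComplex m (k + 1)) (φ : (Fin m → ℝ) → ℝ)
    (A : Set (Fin m → ℝ) → Fin m → ℤ) (c : Set (Fin m → ℝ) → ℝ)
    (g : Set (Fin (m + 1) → ℝ) → M) :
    Finsupp.linearCombination ℤ (fun Q : Cell (m + 1) (k + 1) => g Q.1)
      (K.modification φ A c) = ∑ σ ∈ K.facets, K.weight σ • g (graphCell A c σ) +
        ∑ τ ∈ K.ridges, K.divisorWeight φ τ • g (hypoCell A c τ) := by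
  rw [modification, map_add, Chain.linearCombination_ofFinset, Chain.linearCombination_ofFinset]

theorem exists_of_mem_support_modification {K : WeightedComplex m (k + 1)}
    {φ : (Fin m → ℝ) → ℝ} {A : Set (Fin m → ℝ) → Fin m → ℤ} {c : Set (Fin m → ℝ) → ℝ}
    {Q : Cell (m + 1) (k + 1)} (hQ : Q ∈ (K.modification φ A c).support) :
    ∃ σ ∈ K.cells, Q.1 ⊆ cylSet σ := by
  rcases Finset.mem_union.1 (Finsupp.support_add hQ) with h | h
  · obtain ⟨σ, hσ, hQσ⟩ := Chain.exists_of_mem_support_ofFinset _ h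
    refine ⟨σ, (Finset.mem_filter.1 hσ).1, ?_⟩
    rw [hQσ]
    rintro _ ⟨x, hx, rfl⟩
    rw [toFun_graphMap]
    simpa [cylSet] using hx
  · obtain ⟨τ, hτ, hQτ⟩ := Chain.exists_of_mem_support_ofFinset _ h
    exact ⟨τ, (Finset.mem_filter.1 hτ).1, hQτ ▸ Set.inter_subset_left⟩

variable {K : WeightedComplex m (k + 1)} {φ : (Fin m → ℝ) → ℝ}
  {A : Set (Fin m → ℝ) → Fin m → ℤ} {c : Set (Fin m → ℝ) → ℝ}

theorem mem_graphCell (hφ : ∀ σ ∈ K.cells, ∀ x ∈ σ, φ x = intForm (A σ) x + c σ)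
    {σ : Set (Fin m → ℝ)} (hσ : σ ∈ K.cells) {x : Fin (m + 1) → ℝ} :
    x ∈ graphCell A c σ ↔ ini x ∈ σ ∧ x (Fin.last m) = φ (ini x) := by
  constructor
  · rintro ⟨z, hz, rfl⟩
    rw [toFun_graphMap, ini_sn, sn_last, hφ σ hσ z hz]
    exact ⟨hz, rfl⟩
  · rintro ⟨h1, h2⟩
    refine ⟨ini x, h1, ?_⟩
    rw [toFun_graphMap, ← hφ σ hσ _ h1, ← h2, sn_ini]

theorem gap_hypo_eq (hφ : ∀ σ ∈ K.cells, ∀ x ∈ σ, φ x = intForm (A σ) x + c σ)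
    {τ : Set (Fin m → ℝ)} (hτ : τ ∈ K.cells) {x : Fin (m + 1) → ℝ} (hx : ini x ∈ τ) :
    gap (sn (A τ) (-1), -c τ) x = φ (ini x) - x (Fin.last m) := by
  rw [gap_hypo, hφ τ hτ _ hx]

theorem mem_hypoCell (hφ : ∀ σ ∈ K.cells, ∀ x ∈ σ, φ x = intForm (A σ) x + c σ)
    {τ : Set (Fin m → ℝ)} (hτ : τ ∈ K.cells) {x : Fin (m + 1) → ℝ} :
    x ∈ hypoCell A c τ ↔ ini x ∈ τ ∧ x (Fin.last m) ≤ φ (ini x) := by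
  refine and_congr_right fun h => ?_
  rw [Set.mem_ofPred_eq, gap_hypo_eq hφ hτ h, sub_nonneg]

theorem isLinearPart_of_eq (hφ : ∀ σ ∈ K.cells, ∀ x ∈ σ, φ x = intForm (A σ) x + c σ)
    {σ : Set (Fin m → ℝ)} (hσ : σ ∈ K.cells) : IsLinearPart φ σ (A σ) :=
  ⟨c σ, fun x hx => by rw [hφ σ hσ x hx, intForm_apply]⟩

/-- The direction of the graph over `V` of the linear form `a`. -/
theorem map_graphMap_eq {a : Fin m → ℤ} {b : ℝ} (V : Submodule ℝ (Fin m → ℝ)) :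
    V.map (graphMap a b).linMap =
      V.comap (iniL m) ⊓ LinearMap.ker (intForm (sn a (-1))) := by
  ext v
  rw [Submodule.mem_map, Submodule.mem_inf, Submodule.mem_comap, LinearMap.mem_ker, iniL_apply,
    intForm_sn]
  constructor
  · rintro ⟨x, hx, rfl⟩
    rw [linMap_graphMap]
    simpa using hx
  · rintro ⟨h1, h2⟩
    refine ⟨ini v, h1, ?_⟩
    rw [linMap_graphMap]
    refine sn_ext (by simp) ?_
    rw [sn_last]
    push_cast at h2
    linarith

theorem comap_inf_ker_congr {a b : Fin m → ℤ} {V : Submodule ℝ (Fin m → ℝ)}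
    (h : ∀ v ∈ V, intForm a v = intForm b v) :
    V.comap (iniL m) ⊓ LinearMap.ker (intForm (sn a (-1))) =
      V.comap (iniL m) ⊓ LinearMap.ker (intForm (sn b (-1))) := by
  ext v
  refine and_congr_right fun hv => ?_
  rw [SetLike.mem_coe, LinearMap.mem_ker, SetLike.mem_coe, LinearMap.mem_ker, intForm_sn,
    intForm_sn, h (ini v) hv]

theorem mem_lat_graph {a : Fin m → ℤ} {V : Submodule ℝ (Fin m → ℝ)} {v : Fin (m + 1) → ℤ} :
    v ∈ lat (V.comap (iniL m) ⊓ LinearMap.ker (intForm (sn a (-1)))) ↔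
      ini v ∈ lat V ∧ v (Fin.last m) = a ⬝ᵥ ini v := by
  refine and_congr_right fun _ => ?_
  rw [SetLike.mem_coe, LinearMap.mem_ker, intForm_castVec, dotProduct_sn]
  constructor
  · intro h
    have : a ⬝ᵥ ini v + -1 * v (Fin.last m) = 0 := by exact_mod_cast h
    linarith
  · intro h
    rw [h]
    simp

/-- Balancing of the modification at the points of the graph. -/
theorem dv_modification_mem_of_eq (hK : K.IsBalanced)
    (hφ : ∀ σ ∈ K.cells, ∀ x ∈ σ, φ x = intForm (A σ) x + c σ) {x : Fin (m + 1) → ℝ}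
    (hx : x (Fin.last m) = φ (ini x)) {τ : Set (Fin m → ℝ)} (hτ : τ ∈ K.cells)
    (hxτ : ini x ∈ intrinsicInterior ℝ τ) {L : Submodule ℝ (Fin (m + 1) → ℝ)}
    (hL : Module.finrank ℝ L + 1 = k + 1) :
    Chain.dv x L (K.modification φ A c) ∈ lat L := by
  have hyτ := intrinsicInterior_subset hxτ
  set V := vectorSpan ℝ τ with hV
  have hcong : ∀ σ ∈ K.cells, τ ⊆ σ → V.comap (iniL m) ⊓
      LinearMap.ker (intForm (sn (A σ) (-1))) = V.comap (iniL m) ⊓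
      LinearMap.ker (intForm (sn (A τ) (-1))) := fun σ hσ hτσ =>
    comap_inf_ker_congr fun v hv =>
      ((isLinearPart_of_eq hφ hσ).mono hτσ).eqOn (isLinearPart_of_eq hφ hτ) hv
  have hlG : ∀ σ ∈ K.facets, τ ⊆ σ → lineality (graphCell A c σ) x =
      V.comap (iniL m) ⊓ LinearMap.ker (intForm (sn (A τ) (-1))) := by
    intro σ hσ hτσ
    have hσK := (Finset.mem_filter.1 hσ).1
    have hx' : (graphMap (A σ) (c σ)).toFun (ini x) = x := by
      rw [toFun_graphMap, ← hφ σ hσK _ (hτσ hyτ), ← hx, sn_ini]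
    have := IntAffineMap.lineality_image (f := graphMap (A σ) (c σ)) (Q := σ)
      (fun v _ h => graphMap_inj _ _ v h) (hτσ hyτ)
    rw [hx', lineality_eq hτ hσK hxτ hτσ, map_graphMap_eq, hcong σ hσK hτσ] at this
    exact this
  have hlH : ∀ ρ ∈ K.ridges, τ ⊆ ρ → lineality (hypoCell A c ρ) x =
      V.comap (iniL m) ⊓ LinearMap.ker (intForm (sn (A τ) (-1))) := by
    intro ρ hρ hτρ
    have hρK := (Finset.mem_filter.1 hρ).1
    rw [hypoCell, lineality_halfCyl_of_eq (K.isPolyhedron ρ hρK) (hτρ hyτ)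
      (by rw [gap_hypo_eq hφ hρK (hτρ hyτ), hx, sub_self]), lineality_eq hτ hρK hxτ hτρ]
    exact hcong ρ hρK hτρ
  have hdv := linearCombination_modification K φ A c
    (fun Q => if x ∈ Q ∧ lineality Q x = L then pv Q x else 0)
  change Chain.dv x L _ = _ at hdv
  rw [hdv]
  by_cases hLeq : V.comap (iniL m) ⊓ LinearMap.ker (intForm (sn (A τ) (-1))) = L
  · subst hLeq
    rw [finrank_comap_inf_ker _ (sn_neg_one_ne _)] at hL
    have hτr : τ ∈ K.ridges := Finset.mem_filter.2 ⟨hτ, hL⟩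
    have hsumG : ∑ σ ∈ K.facets, K.weight σ • (if x ∈ graphCell A c σ ∧
        lineality (graphCell A c σ) x =
          V.comap (iniL m) ⊓ LinearMap.ker (intForm (sn (A τ) (-1))) then
          pv (graphCell A c σ) x else 0) =
        ∑ σ ∈ K.facetsAround τ, K.weight σ • pv (graphCell A c σ) x := by
      rw [facetsAround, Finset.sum_filter]
      refine Finset.sum_congr rfl fun σ hσ => ?_
      have hσK := (Finset.mem_filter.1 hσ).1
      by_cases hτσ : τ ⊆ σ
      · rw [if_pos hτσ, if_pos ⟨(mem_graphCell hφ hσK).2 ⟨hτσ hyτ, hx⟩, hlG σ hσ hτσ⟩]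
      · rw [if_neg hτσ, if_neg, smul_zero]
        exact fun h => hτσ (subset_of_mem_intrinsicInterior hτ hσK hxτ
          ((mem_graphCell hφ hσK).1 h.1).1)
    have hsumH : ∑ ρ ∈ K.ridges, K.divisorWeight φ ρ • (if x ∈ hypoCell A c ρ ∧
        lineality (hypoCell A c ρ) x =
          V.comap (iniL m) ⊓ LinearMap.ker (intForm (sn (A τ) (-1))) then
          pv (hypoCell A c ρ) x else 0) = K.divisorWeight φ τ • pv (hypoCell A c τ) x := by
      rw [Finset.sum_eq_single_of_mem τ hτr fun ρ hρ hne => ?_,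
        if_pos ⟨(mem_hypoCell hφ hτ).2 ⟨hyτ, hx.le⟩, hlH τ hτr subset_rfl⟩]
      obtain ⟨hρK, hρd⟩ := Finset.mem_filter.1 hρ
      rw [if_neg, smul_zero]
      rintro ⟨h, -⟩
      have hyρ := ((mem_hypoCell hφ hρK).1 h).1
      have hτρ := subset_of_mem_intrinsicInterior hτ hρK hxτ hyρ
      refine hne (eq_of_mem_intrinsicInterior hρK hτ ?_ hxτ)
      refine (mem_intrinsicInterior_iff (K.isPolyhedron ρ hρK)).2 ⟨hyρ, ?_⟩
      refine Submodule.eq_of_le_of_finrank_le (lineality_le_vectorSpan hyρ) ?_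
      rw [lineality_eq hτ hρK hxτ hτρ, ← hV]
      unfold cellDim at hρd
      omega
    rw [hsumG, hsumH]
    have hu : ∑ σ ∈ K.facetsAround τ, K.weight σ • pv σ (ini x) ∈ lat V := by
      rw [← dv_chain_ridge hτr hxτ]
      exact dv_chain_mem hK _ _ hL
    have hw := divisorWeight_eq hK hτr hxτ (A := A) (B := A τ)
      (fun σ hσ => isLinearPart_of_eq hφ (Finset.mem_filter.1 (Finset.mem_filter.1 hσ).1).1)
      (isLinearPart_of_eq hφ hτ)
    -- primitive vectors of the cells of the modification
    have hpG : ∀ σ ∈ K.facetsAround τ, pv (graphCell A c σ) x -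
        sn (pv σ (ini x)) (A σ ⬝ᵥ pv σ (ini x)) ∈
          lat (V.comap (iniL m) ⊓ LinearMap.ker (intForm (sn (A τ) (-1)))) := by
      intro σ hσ
      obtain ⟨hσ1, hτσ⟩ := Finset.mem_filter.1 hσ
      obtain ⟨hσK, hσd⟩ := Finset.mem_filter.1 hσ1
      have hlσ := lineality_eq hτ hσK hxτ hτσ
      have hx' : (graphMap (A σ) (c σ)).toFun (ini x) = x := by
        rw [toFun_graphMap, ← hφ σ hσK _ (hτσ hyτ), ← hx, sn_ini]
      have := IntAffineMap.idx_smul_pv_sub_mem (graphMap (A σ) (c σ))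
        (Q := ⟨σ, K.isPolyhedron σ hσK, hσd⟩) ((cellDim_image_graphMap _ _ σ).trans hσd)
        (hτσ hyτ) (by rw [hlσ]; exact hL)
      simp only [idx_graphMap, Nat.cast_one, one_smul, hlσ] at this
      rwa [hx', mulVec_graphMap, map_graphMap_eq, hcong σ hσK hτσ] at this
    have hpH : pv (hypoCell A c τ) x - sn 0 (-1) ∈
        lat (V.comap (iniL m) ⊓ LinearMap.ker (intForm (sn (A τ) (-1)))) := by
      have := pv_halfCyl_sub_mem (K.isPolyhedron τ hτ) (f := (sn (A τ) (-1), -c τ)) (by simp)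
        hxτ (by rw [gap_hypo_eq hφ hτ hyτ, hx, sub_self])
      dsimp only at this
      rwa [sn_last] at this
    -- the first coordinates balance because `K` does, and the last one by the weight of the divisor
    have hmain : ∑ σ ∈ K.facetsAround τ, K.weight σ • sn (pv σ (ini x)) (A σ ⬝ᵥ pv σ (ini x)) +
        K.divisorWeight φ τ • sn 0 (-1) ∈
          lat (V.comap (iniL m) ⊓ LinearMap.ker (intForm (sn (A τ) (-1)))) := by
      rw [mem_lat_graph]
      have h1 : ini (∑ σ ∈ K.facetsAround τ,
          K.weight σ • sn (pv σ (ini x)) (A σ ⬝ᵥ pv σ (ini x)) +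
          K.divisorWeight φ τ • sn 0 (-1)) =
          ∑ σ ∈ K.facetsAround τ, K.weight σ • pv σ (ini x) := by
        rw [ini_add, ini_smul, ini_sn, smul_zero, add_zero, ini_sum]
        simp only [ini_smul, ini_sn]
      rw [h1]
      refine ⟨hu, ?_⟩
      rw [Pi.add_apply, Finset.sum_apply]
      simp only [Pi.smul_apply, sn_last, smul_eq_mul]
      rw [hw]
      ring
    have h3 := AddSubgroup.add_mem _ (AddSubgroup.sum_mem _ fun σ hσ =>
      AddSubgroup.zsmul_mem _ (hpG σ hσ) (K.weight σ))
      (AddSubgroup.zsmul_mem _ hpH (K.divisorWeight φ τ))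
    have h4 := AddSubgroup.add_mem _ h3 hmain
    simp only [smul_sub, Finset.sum_sub_distrib] at h4
    convert h4 using 1
    abel
  · rw [Finset.sum_eq_zero fun σ hσ => ?_, Finset.sum_eq_zero fun ρ hρ => ?_, add_zero]
    · exact zero_mem _
    · have hρK := (Finset.mem_filter.1 hρ).1
      rw [if_neg, smul_zero]
      rintro ⟨h1, h2⟩
      have hτρ := subset_of_mem_intrinsicInterior hτ hρK hxτ ((mem_hypoCell hφ hρK).1 h1).1
      exact hLeq ((hlH ρ hρ hτρ).symm.trans h2)
    · have hσK := (Finset.mem_filter.1 hσ).1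
      rw [if_neg, smul_zero]
      rintro ⟨h1, h2⟩
      have hτσ := subset_of_mem_intrinsicInterior hτ hσK hxτ ((mem_graphCell hφ hσK).1 h1).1
      exact hLeq ((hlG σ hσ hτσ).symm.trans h2)

/-- Balancing of the modification at the points that are not on the graph. -/
theorem dv_modification_mem_of_ne (hK : K.IsBalanced)
    (hφ : ∀ σ ∈ K.cells, ∀ x ∈ σ, φ x = intForm (A σ) x + c σ) {x : Fin (m + 1) → ℝ}
    (hx : x (Fin.last m) ≠ φ (ini x)) {L : Submodule ℝ (Fin (m + 1) → ℝ)}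
    (hL : Module.finrank ℝ L + 1 = k + 1) :
    Chain.dv x L (K.modification φ A c) ∈ lat L := by
  have hdv := linearCombination_modification K φ A c
    (fun Q => if x ∈ Q ∧ lineality Q x = L then pv Q x else 0)
  change Chain.dv x L _ = _ at hdv
  rw [hdv, Finset.sum_eq_zero fun σ hσ => ?_, zero_add]
  · have hpos : ∀ τ ∈ K.ridges, x ∈ hypoCell A c τ → ini x ∈ τ ∧
        0 < gap (sn (A τ) (-1), -c τ) x := by
      intro τ hτ h
      have hτK := (Finset.mem_filter.1 hτ).1
      obtain ⟨h1, h2⟩ := (mem_hypoCell hφ hτK).1 h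
      refine ⟨h1, ?_⟩
      rw [gap_hypo_eq hφ hτK h1, sub_pos]
      exact lt_of_le_of_ne h2 hx
    have hl : ∀ τ ∈ K.ridges, x ∈ hypoCell A c τ → lineality (hypoCell A c τ) x =
        (lineality τ (ini x)).comap (iniL m) := fun τ hτ h =>
      lineality_halfCyl_of_pos (K.isPolyhedron τ (Finset.mem_filter.1 hτ).1)
        (hpos τ hτ h).1 (hpos τ hτ h).2
    -- below the graph the modification is locally the cylinder over the divisor
    by_cases hex : ∃ L' : Submodule ℝ (Fin m → ℝ), L = L'.comap (iniL m)
    · obtain ⟨L', rfl⟩ := hex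
      rw [finrank_comap_iniL] at hL
      have hr : ∀ σ ∈ K.cells, ∃ A, IsLinearPart φ σ A := fun σ hσ =>
        ⟨_, isLinearPart_of_eq hφ hσ⟩
      have hD := dv_chain_mem (isBalanced_divisor hK hr) (ini x) L' (by omega)
      by_cases hlt : x (Fin.last m) < φ (ini x)
      · rw [dv_chain, facets_divisor, Finset.sum_filter] at hD
        rw [mem_lat_comap, ini_sum, ← sub_add_cancel (∑ τ ∈ K.ridges, _) (∑ τ ∈ K.ridges,
          if ini x ∈ τ ∧ lineality τ (ini x) = L' then
            (K.divisor φ).weight τ • pv τ (ini x) else 0)]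
        refine AddSubgroup.add_mem _ ?_ hD
        rw [← Finset.sum_sub_distrib]
        refine AddSubgroup.sum_mem _ fun τ hτ => ?_
        obtain ⟨hτK, hτd⟩ := Finset.mem_filter.1 hτ
        have hτQ := K.isPolyhedron τ hτK
        by_cases hxτ : ini x ∈ τ ∧ lineality τ (ini x) = L'
        · have hxH : x ∈ hypoCell A c τ := (mem_hypoCell hφ hτK).2 ⟨hxτ.1, hlt.le⟩
          rw [if_pos ⟨hxH, by rw [hl τ hτ hxH, hxτ.2]⟩, if_pos hxτ, ini_smul]
          change K.divisorWeight φ τ • _ - K.divisorWeight φ τ • _ ∈ _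
          rw [← smul_sub]
          refine AddSubgroup.zsmul_mem _ ?_ _
          have hev : ∀ᶠ z in 𝓝 x, ini z ∈ τ → z ∈ hypoCell A c τ := by
            filter_upwards [(continuous_gap (sn (A τ) (-1), -c τ)).continuousAt.eventually
              (lt_mem_nhds (hpos τ hτ hxH).2)] with z hz hzτ
            exact ⟨hzτ, le_of_lt hz⟩
          have := ini_pv_sub_mem hτQ (K.hypoCell_spec A c τ hτ).1 hxτ.1 hev (hl τ hτ hxH)
            (vectorSpan_halfCyl hτQ (sn_neg_one_ne _))
            (by rw [hxτ.2]; omega)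
          rwa [hxτ.2] at this
        · rw [if_neg hxτ, if_neg, smul_zero, sub_zero]
          · exact zero_mem _
          · rintro ⟨h1, h2⟩
            rw [hl τ hτ h1] at h2
            exact hxτ ⟨(hpos τ hτ h1).1, comap_iniL_injective h2⟩
      · rw [Finset.sum_eq_zero fun τ hτ => ?_]
        · exact zero_mem _
        · rw [if_neg, smul_zero]
          exact fun h => hlt (lt_of_le_of_ne
            ((mem_hypoCell hφ (Finset.mem_filter.1 hτ).1).1 h.1).2 hx)
    · rw [Finset.sum_eq_zero fun τ hτ => ?_]
      · exact zero_mem _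
      · rw [if_neg, smul_zero]
        rintro ⟨h1, rfl⟩
        exact hex ⟨_, hl τ hτ h1⟩
  · rw [if_neg, smul_zero]
    exact fun h => hx ((mem_graphCell hφ (Finset.mem_filter.1 hσ).1).1 h.1).2

/-- The modification is balanced: at the graph by the definition of the divisor, below the graph
because the divisor is balanced. -/
theorem bal_modification (hK : K.IsBalanced)
    (hφ : ∀ σ ∈ K.cells, ∀ x ∈ σ, φ x = intForm (A σ) x + c σ) :
    (K.modification φ A c).Bal := by
  refine ⟨∅, thin_empty, fun x _ L hL => ?_⟩
  by_cases hx : x (Fin.last m) = φ (ini x)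
  · by_cases hex : ∃ σ ∈ K.cells, ini x ∈ σ
    · obtain ⟨σ, hσ, hxσ⟩ := hex
      obtain ⟨τ, hτ, hxτ, -⟩ := exists_cell_at hσ hxσ
      exact dv_modification_mem_of_eq hK hφ hx hτ hxτ hL
    · rw [Chain.dv_apply, Finset.sum_eq_zero fun Q hQ => ?_]
      · exact zero_mem _
      · obtain ⟨σ, hσ, hQσ⟩ := exists_of_mem_support_modification hQ
        exact if_neg fun h => hex ⟨σ, hσ, hQσ h.1⟩
  · exact dv_modification_mem_of_ne hK hφ hx hL

end WeightedComplex

/-! ### Products with the identity of the line -/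

/-- The map `f × id`. -/
def IntAffineMap.prodId {m n : ℕ} (f : IntAffineMap m n) : IntAffineMap (m + 1) (n + 1) where
  lin := sn (fun i => sn (f.lin i) 0) (sn 0 1)
  trans := sn f.trans 0

namespace IntAffineMap

variable {m n : ℕ} (f : IntAffineMap m n)

theorem linMap_prodId (x : Fin (m + 1) → ℝ) :
    f.prodId.linMap x = sn (f.linMap (ini x)) (x (Fin.last m)) := by
  refine sn_ext ?_ ?_
  · ext i
    rw [ini_sn, f.linMap_apply, ini, linMap_apply, Fin.sum_univ_castSucc]
    simp [prodId, ini]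
  · rw [linMap_apply, sn_last, Fin.sum_univ_castSucc]
    simp [prodId]

theorem toFun_prodId (x : Fin (m + 1) → ℝ) :
    f.prodId.toFun x = sn (f.toFun (ini x)) (x (Fin.last m)) := by
  rw [toFun_eq, linMap_prodId, toFun_eq]
  exact sn_ext (by rw [ini_add]; simp [prodId]) (by simp [prodId])

theorem mulVec_prodId (v : Fin (m + 1) → ℤ) :
    f.prodId.lin.mulVec v = sn (f.lin.mulVec (ini v)) (v (Fin.last m)) := by
  have h := linMap_castVec f.prodId v
  rw [linMap_prodId, ini_castVec, linMap_castVec, castVec_apply, ← castVec_sn] at h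
  ext i
  have := congrFun h i
  rw [castVec_apply, castVec_apply] at this
  exact_mod_cast this.symm

theorem map_prodId (V : Submodule ℝ (Fin m → ℝ)) :
    (V.comap (iniL m)).map f.prodId.linMap = (V.map f.linMap).comap (iniL n) := by
  ext w
  constructor
  · rintro ⟨v, hv, rfl⟩
    rw [linMap_prodId]
    exact ⟨ini v, hv, by simp⟩
  · rintro ⟨v, hv, hw⟩
    refine ⟨sn v (w (Fin.last n)), by simpa using hv, ?_⟩
    rw [linMap_prodId, ini_sn, sn_last, hw]
    exact sn_ini w

/-- The last coordinate of integral vectors. -/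
def lastZ (n : ℕ) : (Fin (n + 1) → ℤ) →+ ℤ where
  toFun v := v (Fin.last n)
  map_zero' := rfl
  map_add' _ _ := rfl

/-- The inclusion of the horizontal integral vectors. -/
def snZ (n : ℕ) : (Fin n → ℤ) →+ (Fin (n + 1) → ℤ) where
  toFun v := sn v 0
  map_zero' := sn_ext (by simp; rfl) (by simp)
  map_add' _ _ := sn_ext (by simp [ini_add]) (by simp)

/-- The lattice index of `f × id` on a cylinder: the vertical direction contributes the index one. -/
theorem idx_prodId (V : Submodule ℝ (Fin m → ℝ)) : f.prodId.idx (V.comap (iniL m)) = f.idx V := by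
  set A := lat ((V.map f.linMap).comap (iniL n)) with hA
  set B := (lat (V.comap (iniL m))).map f.prodId.lin.mulVecLin.toAddMonoidHom with hB
  have hBA : B ≤ A := by
    rintro _ ⟨v, hv, rfl⟩
    change f.prodId.lin.mulVec v ∈ A
    rw [mulVec_prodId, hA, mem_lat_comap, ini_sn, mem_lat, ← linMap_castVec]
    exact ⟨_, hv, rfl⟩
  have h0 : f.prodId.idx (V.comap (iniL m)) = B.relIndex A := by rw [idx, map_prodId]
  have h1 : A ⊓ (lastZ n).ker = (lat (V.map f.linMap)).map (snZ n) := by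
    ext w
    constructor
    · rintro ⟨h1, h2⟩
      exact ⟨ini w, h1, sn_ext (by simp [snZ]) (by
        have h3 : w (Fin.last n) = 0 := h2
        simp [snZ, h3])⟩
    · rintro ⟨v, hv, rfl⟩
      refine ⟨?_, by simp [snZ, lastZ]⟩
      change ini (sn v 0) ∈ lat (V.map f.linMap)
      rwa [ini_sn]
  have h2 : B ⊓ (lastZ n).ker =
      ((lat V).map f.lin.mulVecLin.toAddMonoidHom).map (snZ n) := by
    ext w
    constructor
    · rintro ⟨⟨v, hv, rfl⟩, h2⟩
      refine ⟨_, ⟨ini v, hv, rfl⟩, ?_⟩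
      change sn (f.lin.mulVec (ini v)) 0 = f.prodId.lin.mulVec v
      have h3 : f.prodId.lin.mulVec v (Fin.last n) = 0 := h2
      rw [mulVec_prodId] at h3 ⊢
      rw [sn_last] at h3
      rw [h3]
    · rintro ⟨_, ⟨v, hv, rfl⟩, rfl⟩
      refine ⟨⟨sn v 0, ?_, ?_⟩, by simp [snZ, lastZ]⟩
      · change ini (sn v 0) ∈ lat V
        rwa [ini_sn]
      · change f.prodId.lin.mulVec (sn v 0) = sn (f.lin.mulVec v) 0
        rw [mulVec_prodId, ini_sn, sn_last]
  have h3 : A.map (lastZ n) ≤ B.map (lastZ n) := by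
    rintro _ ⟨w, -, rfl⟩
    refine ⟨_, ⟨sn 0 (w (Fin.last n)), ?_, rfl⟩, ?_⟩
    · change ini (sn 0 _) ∈ lat V
      rw [ini_sn]; exact zero_mem _
    · change f.prodId.lin.mulVec _ (Fin.last n) = w (Fin.last n)
      rw [mulVec_prodId, sn_last, sn_last]
  have hinj : Function.Injective (snZ n) := fun v w h => by
    have := congrArg ini h
    simpa [snZ] using this
  rw [h0, relIndex_eq_mul_of_le hBA (lastZ n), AddSubgroup.relIndex_eq_one.2 h3, mul_one, h1, h2,
    AddSubgroup.relIndex_map_map_of_injective _ _ hinj]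
  rfl

end IntAffineMap

namespace WeightedComplex

variable {m n k : ℕ} {K : WeightedComplex m (k + 1)} {φ : (Fin m → ℝ) → ℝ}
  {A : Set (Fin m → ℝ) → Fin m → ℤ} {c : Set (Fin m → ℝ) → ℝ}

/-- The weight function of the push-forward of the modification, split into the contributions of the
graph and of the cells below it. -/
theorem fn_push_modification (f : IntAffineMap m n) (x : Fin (n + 1) → ℝ) :
    Chain.fn (f.prodId.push (K.modification φ A c)) x =
      ∑ σ ∈ K.facets, K.weight σ * (if cellDim (f.prodId.toFun '' graphCell A c σ) = k + 1 ∧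
        x ∈ intrinsicInterior ℝ (f.prodId.toFun '' graphCell A c σ) then
          (f.prodId.idx (vectorSpan ℝ (graphCell A c σ)) : ℤ) else 0) +
      ∑ τ ∈ K.ridges, K.divisorWeight φ τ *
        (if cellDim (f.prodId.toFun '' hypoCell A c τ) = k + 1 ∧
          x ∈ intrinsicInterior ℝ (f.prodId.toFun '' hypoCell A c τ) then
          (f.prodId.idx (vectorSpan ℝ (hypoCell A c τ)) : ℤ) else 0) := by
  have h := linearCombination_modification K φ A c (fun Q =>
    if cellDim (f.prodId.toFun '' Q) = k + 1 ∧ x ∈ intrinsicInterior ℝ (f.prodId.toFun '' Q) then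
      (f.prodId.idx (vectorSpan ℝ Q) : ℤ) else 0)
  simp only [smul_eq_mul] at h
  rw [← h, IntAffineMap.fn_push, Finsupp.linearCombination_apply, Finsupp.sum]
  refine Finset.sum_congr rfl fun Q _ => ?_
  split_ifs <;> simp

theorem fn_push_chain (f : IntAffineMap m n) {d : ℕ} (K : WeightedComplex m d)
    (x : Fin n → ℝ) : Chain.fn (f.push K.chain) x = ∑ σ ∈ K.facets, K.weight σ *
      (if cellDim (f.toFun '' σ) = d ∧ x ∈ intrinsicInterior ℝ (f.toFun '' σ) then
        (f.idx (vectorSpan ℝ σ) : ℤ) else 0) := by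
  have h := linearCombination_chain K (fun Q =>
    if cellDim (f.toFun '' Q) = d ∧ x ∈ intrinsicInterior ℝ (f.toFun '' Q) then
      (f.idx (vectorSpan ℝ Q) : ℤ) else 0)
  simp only [smul_eq_mul] at h
  rw [← h, IntAffineMap.fn_push, Finsupp.linearCombination_apply, Finsupp.sum]
  refine Finset.sum_congr rfl fun Q _ => ?_
  split_ifs <;> simp

theorem cellDim_image_hypoCell (f : IntAffineMap m n) {τ : Set (Fin m → ℝ)}
    (hτ : IsRationalPolyhedron τ) : (cellDim (f.prodId.toFun '' hypoCell A c τ) =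
      cellDim (hypoCell A c τ) ↔ cellDim (f.toFun '' τ) = cellDim τ) := by
  rw [IntAffineMap.cellDim_image_eq_iff, IntAffineMap.cellDim_image_eq_iff, hypoCell,
    vectorSpan_halfCyl hτ (sn_neg_one_ne _)]
  constructor
  · intro h v hv h0
    have h1 := h (sn v 0) (by simpa using hv) (by
      rw [IntAffineMap.linMap_prodId, ini_sn, sn_last, h0]
      exact sn_ext (by simp; rfl) (by simp))
    rw [← ini_sn v (0 : ℝ), h1]; rfl
  · intro h v hv h0
    rw [IntAffineMap.linMap_prodId] at h0
    refine sn_ext ?_ ?_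
    · refine h (ini v) hv ?_
      have := congrArg ini h0
      rw [ini_sn] at this
      exact this
    · have := congrFun h0 (Fin.last n)
      simpa using this

theorem mem_intrinsicInterior_hypoCell
    (hφ : ∀ σ ∈ K.cells, ∀ x ∈ σ, φ x = intForm (A σ) x + c σ)
    {τ : Set (Fin m → ℝ)} (hτ : τ ∈ K.cells) {x : Fin (m + 1) → ℝ}
    (hx : ini x ∈ τ → x (Fin.last m) < φ (ini x)) :
    x ∈ intrinsicInterior ℝ (hypoCell A c τ) ↔ ini x ∈ intrinsicInterior ℝ τ := by
  have hQ := K.isPolyhedron τ hτ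
  have hR : IsRationalPolyhedron (hypoCell A c τ) := hQ.halfCyl (sn_neg_one_ne _)
  rw [mem_intrinsicInterior_iff hQ, mem_intrinsicInterior_iff hR, mem_hypoCell hφ hτ]
  by_cases h : ini x ∈ τ
  · have hl : lineality (hypoCell A c τ) x = (lineality τ (ini x)).comap (iniL m) :=
      lineality_halfCyl_of_pos hQ h (by rw [gap_hypo_eq hφ hτ h]; exact sub_pos.2 (hx h))
    have hs : vectorSpan ℝ (hypoCell A c τ) = (vectorSpan ℝ τ).comap (iniL m) :=
      vectorSpan_halfCyl hQ (sn_neg_one_ne _)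
    rw [hl, hs]
    constructor
    · rintro ⟨_, h2⟩
      exact ⟨h, comap_iniL_injective h2⟩
    · rintro ⟨_, h2⟩
      exact ⟨⟨h, (hx h).le⟩, by rw [h2]⟩
  · exact ⟨fun h' => absurd h'.1.1 h, fun h' => absurd h'.1 h⟩

/-- Below the graph, the push-forward of the modification is the cylinder over the push-forward of
the divisor. -/
theorem fn_push_modification_of_lt
    (hφ : ∀ σ ∈ K.cells, ∀ x ∈ σ, φ x = intForm (A σ) x + c σ) (f : IntAffineMap m n)
    {x : Fin (n + 1) → ℝ} (hx : ∀ σ ∈ K.cells, ∀ z ∈ σ, x (Fin.last n) < φ z) :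
    Chain.fn (f.prodId.push (K.modification φ A c)) x =
      Chain.fn (f.push (K.divisor φ).chain) (ini x) := by
  rw [fn_push_modification, fn_push_chain, facets_divisor, Finset.sum_eq_zero, zero_add]
  · refine Finset.sum_congr rfl fun τ hτ => ?_
    obtain ⟨hτK, hτd⟩ := Finset.mem_filter.1 hτ
    have hτQ := K.isPolyhedron τ hτK
    have hdH := (K.hypoCell_spec A c τ hτ).2
    have hs : vectorSpan ℝ (hypoCell A c τ) = (vectorSpan ℝ τ).comap (iniL m) :=
      vectorSpan_halfCyl hτQ (sn_neg_one_ne _)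
    change _ = K.divisorWeight φ τ * _
    congr 1
    rw [hs, IntAffineMap.idx_prodId]
    refine if_congr ?_ rfl rfl
    have hdim := cellDim_image_hypoCell (A := A) (c := c) f hτQ
    rw [hdH] at hdim
    have hτd' : cellDim τ = k := by omega
    rw [hτd'] at hdim
    rw [hdim]
    refine and_congr_right fun hd => ?_
    have hinj := (IntAffineMap.cellDim_image_eq_iff f τ).1 (hd.trans hτd'.symm)
    have hinj' := (IntAffineMap.cellDim_image_eq_iff f.prodId (hypoCell A c τ)).1
      ((hdim.2 hd).trans hdH.symm)
    rw [IntAffineMap.mem_intrinsicInterior_image (K.hypoCell_spec A c τ hτ).1 hinj',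
      IntAffineMap.mem_intrinsicInterior_image hτQ hinj]
    constructor
    · rintro ⟨z, hz, rfl⟩
      rw [IntAffineMap.toFun_prodId, sn_last] at hx
      refine ⟨ini z, (mem_intrinsicInterior_hypoCell hφ hτK fun h => hx τ hτK _ h).1 hz, ?_⟩
      rw [IntAffineMap.toFun_prodId, ini_sn]
    · rintro ⟨z, hz, hzx⟩
      refine ⟨sn z (x (Fin.last n)), (mem_intrinsicInterior_hypoCell hφ hτK fun h => ?_).2
        (by rwa [ini_sn]), ?_⟩
      · rw [ini_sn] at h ⊢
        rw [sn_last]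
        exact hx τ hτK z h
      · rw [IntAffineMap.toFun_prodId, ini_sn, sn_last, hzx, sn_ini]
  · intro σ hσ
    have hσK := (Finset.mem_filter.1 hσ).1
    rw [if_neg, mul_zero]
    rintro ⟨-, h⟩
    obtain ⟨z, hz, rfl⟩ := intrinsicInterior_subset h
    obtain ⟨h1, h2⟩ := (mem_graphCell hφ hσK).1 hz
    have h3 := hx σ hσK _ h1
    rw [IntAffineMap.toFun_prodId, sn_last, h2] at h3
    exact lt_irrefl _ h3

/-- Above the graph, the push-forward of the modification is empty. -/
theorem fn_push_modification_of_gt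
    (hφ : ∀ σ ∈ K.cells, ∀ x ∈ σ, φ x = intForm (A σ) x + c σ) (f : IntAffineMap m n)
    {x : Fin (n + 1) → ℝ} (hx : ∀ σ ∈ K.cells, ∀ z ∈ σ, φ z < x (Fin.last n)) :
    Chain.fn (f.prodId.push (K.modification φ A c)) x = 0 := by
  rw [fn_push_modification, Finset.sum_eq_zero fun σ hσ => ?_,
    Finset.sum_eq_zero fun τ hτ => ?_, add_zero]
  · have hτK := (Finset.mem_filter.1 hτ).1
    rw [if_neg, mul_zero]
    rintro ⟨-, h⟩
    obtain ⟨z, hz, rfl⟩ := intrinsicInterior_subset h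
    obtain ⟨h1, h2⟩ := (mem_hypoCell hφ hτK).1 hz
    have h3 := hx τ hτK _ h1
    rw [IntAffineMap.toFun_prodId, sn_last] at h3
    exact h3.not_ge h2
  · have hσK := (Finset.mem_filter.1 hσ).1
    rw [if_neg, mul_zero]
    rintro ⟨-, h⟩
    obtain ⟨z, hz, rfl⟩ := intrinsicInterior_subset h
    obtain ⟨h1, h2⟩ := (mem_graphCell hφ hσK).1 hz
    have h3 := hx σ hσK _ h1
    rw [IntAffineMap.toFun_prodId, sn_last, h2] at h3
    exact lt_irrefl _ h3

theorem divisorWeight_sub {d : ℕ} {K : WeightedComplex n d} (hK : K.IsBalanced)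
    {φ ψ : (Fin n → ℝ) → ℝ} (hφ : ∀ σ ∈ K.cells, ∃ A, IsLinearPart φ σ A)
    (hψ : ∀ σ ∈ K.cells, ∃ A, IsLinearPart ψ σ A) {τ : Set (Fin n → ℝ)} (hτ : τ ∈ K.ridges) :
    K.divisorWeight (fun x => φ x - ψ x) τ = K.divisorWeight φ τ - K.divisorWeight ψ τ := by
  choose! A hA using hφ
  choose! B hB using hψ
  have hτK := (Finset.mem_filter.1 hτ).1
  have hf : ∀ σ ∈ K.facetsAround τ, σ ∈ K.cells := fun σ hσ =>
    (Finset.mem_filter.1 (Finset.mem_filter.1 hσ).1).1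
  obtain ⟨y, hy⟩ := exists_mem_intrinsicInterior (K.isPolyhedron τ hτK)
  rw [divisorWeight_eq hK hτ hy (A := fun σ => A σ - B σ) (B := A τ - B τ)
    (fun σ hσ => (hA σ (hf σ hσ)).sub (hB σ (hf σ hσ))) ((hA τ hτK).sub (hB τ hτK)),
    divisorWeight_eq hK hτ hy (fun σ hσ => hA σ (hf σ hσ)) (hA τ hτK),
    divisorWeight_eq hK hτ hy (fun σ hσ => hB σ (hf σ hσ)) (hB τ hτK)]
  simp only [sub_dotProduct, mul_sub, Finset.sum_sub_distrib]
  ring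

theorem toClass_divisor_sub {d : ℕ} {K : WeightedComplex n (d + 1)} (hK : K.IsBalanced)
    {φ ψ : (Fin n → ℝ) → ℝ} (hφ : ∀ σ ∈ K.cells, ∃ A, IsLinearPart φ σ A)
    (hψ : ∀ σ ∈ K.cells, ∃ A, IsLinearPart ψ σ A) :
    (K.divisor fun x => φ x - ψ x).toClass = (K.divisor φ).toClass - (K.divisor ψ).toClass := by
  have h : ∀ φ, (K.divisor φ).toClass = QuotientAddGroup.mk fun y =>
      ∑ τ ∈ K.ridges, if y ∈ intrinsicInterior ℝ τ then K.divisorWeight φ τ else 0 := by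
    intro φ
    rw [toClass, facets_divisor]; rfl
  rw [h, h, h, ← QuotientAddGroup.mk_sub]
  congr 1
  funext y
  rw [Pi.sub_apply, ← Finset.sum_sub_distrib]
  refine Finset.sum_congr rfl fun τ hτ => ?_
  rw [divisorWeight_sub hK hφ hψ hτ]
  split_ifs <;> simp

end WeightedComplex

/-! ### Families that connect a class with zero -/

/-- There is a balanced chain in `X × ℝ` that is the cylinder over a chain of class `W` at low
heights and that is empty at great heights. -/
def Bounds {n r k : ℕ} (X : TropicalCycle n r) (W : WeightClass n k) : Prop :=
  ∃ c : Chain (n + 1) (k + 1), c.Bal ∧ (∀ Q ∈ c.support, ∀ x ∈ Q.1, ini x ∈ X.support) ∧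
    ∃ e : Chain n k, e.cls = W ∧
      (∃ a : ℝ, ∀ x, x (Fin.last n) < a → Chain.fn c x = Chain.fn e (ini x)) ∧
      ∃ b : ℝ, ∀ x, b < x (Fin.last n) → Chain.fn c x = 0

namespace Bounds

variable {n r k : ℕ} {X : TropicalCycle n r}

theorem zero : Bounds X (0 : WeightClass n k) :=
  ⟨0, ⟨∅, thin_empty, fun y _ L _ => by rw [map_zero]; exact zero_mem _⟩, by simp, 0, map_zero _,
    ⟨0, fun x _ => by simp⟩, 0, fun x _ => by simp⟩

theorem neg {W : WeightClass n k} (h : Bounds X W) : Bounds X (-W) := by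
  obtain ⟨c, hc, hX, e, rfl, ⟨a, ha⟩, b, hb⟩ := h
  refine ⟨-c, hc.neg, by simpa using hX, -e, map_neg _ _, ⟨a, fun x hx => ?_⟩, b, fun x hx => ?_⟩
  · rw [map_neg, map_neg, Pi.neg_apply, Pi.neg_apply, ha x hx]
  · rw [map_neg, Pi.neg_apply, hb x hx, neg_zero]

theorem add {W W' : WeightClass n k} (h : Bounds X W) (h' : Bounds X W') : Bounds X (W + W') := by
  obtain ⟨c, hc, hX, e, rfl, ⟨a, ha⟩, b, hb⟩ := h
  obtain ⟨c', hc', hX', e', rfl, ⟨a', ha'⟩, b', hb'⟩ := h'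
  refine ⟨c + c', hc.add hc', fun Q hQ => ?_, e + e', map_add _ _ _,
    ⟨min a a', fun x hx => ?_⟩, max b b', fun x hx => ?_⟩
  · rcases Finset.mem_union.1 (Finsupp.support_add hQ) with h | h
    exacts [hX Q h, hX' Q h]
  · rw [map_add, map_add, Pi.add_apply, Pi.add_apply, ha x (hx.trans_le (min_le_left _ _)),
      ha' x (hx.trans_le (min_le_right _ _))]
  · rw [map_add, Pi.add_apply, hb x ((le_max_left _ _).trans_lt hx),
      hb' x ((le_max_right _ _).trans_lt hx), add_zero]

end Bounds

variable {n r k : ℕ} {X : TropicalCycle n r}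

/-- The push-forward of the divisor of a bounded rational function bounds: the modification along
the function is a family that connects it with zero. -/
theorem bounds_of_isBoundedRatEquivZero {W : WeightClass n k}
    (h : IsBoundedRatEquivZero X W) : Bounds X W := by
  obtain ⟨m, Y, f, φ, D, hf, ⟨C, hC⟩, ⟨K, hK, ⟨hred, -, hlin⟩, hKD⟩, K', hK'D, hK'W⟩ := h
  choose! A hA using hlin
  choose! c hc using hA
  have hφ : ∀ σ ∈ K.cells, ∀ x ∈ σ, φ x = intForm (A σ) x + c σ := fun σ hσ x hx => by
    rw [hc σ hσ x hx, intForm_apply]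
  have hY : ∀ σ ∈ K.cells, ∀ z ∈ σ, z ∈ Y.support := fun σ hσ z hz =>
    hK.cell_subset_support hred hσ hz
  refine ⟨f.prodId.push (K.modification φ A c),
    f.prodId.bal_push (WeightedComplex.bal_modification hK.1.2 hφ), fun R hR x hx => ?_,
    f.push (K.divisor φ).chain, ?_, ⟨-C, fun x hx => ?_⟩, C, fun x hx => ?_⟩
  · obtain ⟨Q, hQ, hRQ⟩ := IntAffineMap.exists_of_mem_support_push _ hR
    obtain ⟨σ, hσ, hQσ⟩ := WeightedComplex.exists_of_mem_support_modification hQ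
    rw [hRQ] at hx
    obtain ⟨z, hz, rfl⟩ := hx
    rw [IntAffineMap.toFun_prodId, ini_sn]
    exact hf (hY σ hσ _ (hQσ hz))
  · rw [← hK'W, ← IntAffineMap.cls_push_chain]
    refine IntAffineMap.cls_push_congr f ?_
    rw [WeightedComplex.cls_chain, WeightedComplex.cls_chain, hKD, hK'D]
  · exact WeightedComplex.fn_push_modification_of_lt hφ f fun σ hσ z hz =>
      hx.trans_le (abs_le.1 (hC z (hY σ hσ z hz))).1
  · exact WeightedComplex.fn_push_modification_of_gt hφ f fun σ hσ z hz =>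
      (abs_le.1 (hC z (hY σ hσ z hz))).2.trans_lt hx

/-- If the difference of two cycles bounds, then they are fibers of one family: add the cylinder
over the second cycle. -/
theorem areFibers_of_bounds {Z Z' : Subcycle X k} (h : Bounds X (Z.1.1 - Z'.1.1)) :
    AreFibers X Z Z' := by
  obtain ⟨c, hc, hX, e, he, ⟨a, ha⟩, b, hb⟩ := h
  obtain ⟨K₀, hK₀, hK₀Z⟩ := Z'.1.2
  obtain ⟨S₀, -, hS₀⟩ := Chain.exists_adapted K₀.chain ∅
  have hKt := Chain.isTropical_cpx hS₀ (WeightedComplex.bal_chain hK₀.2)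
  have hKc := (Chain.toClass_cpx hS₀).trans (K₀.cls_chain.trans hK₀Z)
  have hKr := Chain.isReduced_cpx S₀ K₀.chain
  set K := Chain.cpx S₀ K₀.chain with hKdef
  have hKs : K.IsStructureOf Z'.1 := ⟨hKt, hKc⟩
  have hcls : K.chain.cls = Z'.1.1 := K.cls_chain.trans hKc
  have hbal : Chain.Bal (c + Chain.cyl K.chain) :=
    hc.add (Chain.bal_cyl fun y L hL => WeightedComplex.dv_chain_mem hKt.2 y L hL)
  obtain ⟨S, -, hS⟩ := Chain.exists_adapted (c + Chain.cyl K.chain) ∅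
  let F : TropicalCycle (n + 1) (k + 1) := ⟨(c + Chain.cyl K.chain).cls, Chain.cpx S _,
    Chain.isTropical_cpx hS hbal, Chain.toClass_cpx hS⟩
  refine ⟨F, a - 1, b + 1, fun x hx => ?_, ?_, ?_⟩
  · obtain ⟨Q, hQ, hxQ⟩ := TropicalCycle.exists_mem_of_mem_support (X := F) rfl hx
    rcases Finset.mem_union.1 (Finsupp.support_add hQ) with h | h
    · exact hX Q h x hxQ
    · obtain ⟨R, hR, hQR⟩ := Chain.exists_of_mem_support_cyl h
      rw [hQR] at hxQ
      exact Z'.2 (hKs.cell_subset_support hKr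
        (Finset.mem_filter.1 (WeightedComplex.support_chain_subset hR)).1 hxQ)
  · have h1 : (e + K.chain).cls = Z.1.1 := by rw [map_add, he, hcls, sub_add_cancel]
    rw [← h1]
    refine Chain.isFiber_of_fn_eq hbal (U := {x | x (Fin.last n) < a})
      (isOpen_lt (continuous_apply _) continuous_const) (fun x hx => ?_) (fun x hx => ?_) rfl
    · rw [Set.mem_ofPred_eq, hx]; linarith
    · rw [map_add, map_add, Pi.add_apply, Pi.add_apply, ha x hx, Chain.fn_cyl]
  · rw [← hcls]
    refine Chain.isFiber_of_fn_eq hbal (U := {x | b < x (Fin.last n)})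
      (isOpen_lt continuous_const (continuous_apply _)) (fun x hx => ?_) (fun x hx => ?_) rfl
    · rw [Set.mem_ofPred_eq, hx]; linarith
    · rw [map_add, Pi.add_apply, hb x hx, Chain.fn_cyl, zero_add]

/-- Two fibers of a family are bounded rationally equivalent, by the function that clamps the
height to the interval between them. -/
theorem boundedRatEquiv_of_areFibers {Z Z' : Subcycle X k} (h : AreFibers X Z Z') :
    BoundedRatEquiv X Z Z' := by
  obtain ⟨F, p, q, hF, ⟨Dp, ⟨Kp, hKp, ⟨-, -, hlp⟩, hDp⟩, Lp, hLp, hZ⟩,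
    ⟨Dq, ⟨Kq, hKq, ⟨-, -, hlq⟩, hDq⟩, Lq, hLq, hZ'⟩⟩ := h
  obtain ⟨S, hpS, hS⟩ := Chain.exists_adapted Kp.chain {(lastForm n, p), (lastForm n, q)}
  have hK := Chain.isTropical_cpx hS (WeightedComplex.bal_chain hKp.1.2)
  have hKc := (Chain.toClass_cpx hS).trans (Kp.cls_chain.trans hKp.2)
  have hKr := Chain.isReduced_cpx S Kp.chain
  have hrp := isLinearPart_maxLast_cpx (c := Kp.chain) (hpS (by simp : (lastForm n, p) ∈ _))
  have hrq := isLinearPart_maxLast_cpx (c := Kp.chain) (hpS (by simp : (lastForm n, q) ∈ _))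
  set K := Chain.cpx S Kp.chain with hKdef
  -- the divisors of both fibers can be computed in the common structure `K`
  have hdiv : ∀ (L : WeightedComplex (n + 1) (k + 1)) (s : ℝ), L.IsStructureOf F →
      (∀ σ ∈ L.cells, ∃ A, IsLinearPart (maxLast n s) σ A) →
      (∀ σ ∈ K.cells, ∃ A, IsLinearPart (maxLast n s) σ A) →
      (K.divisor (maxLast n s)).toClass = (L.divisor (maxLast n s)).toClass := by
    intro L s hL h1 h2
    rw [WeightedComplex.toClass_divisor_maxLast hK.2 h2,
      WeightedComplex.toClass_divisor_maxLast hL.1.2 h1]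
    refine Chain.mk_ht_trunc_congr isOpen_univ (fun _ _ => Set.mem_univ _) ?_
    have h3 := (K.cls_chain.trans hKc).trans (L.cls_chain.trans hL.2).symm
    rw [Chain.cls_apply, Chain.cls_apply, mk_eq_mk_iff] at h3
    exact h3.mono fun x hx => hx.2
  have hlin : ∀ σ ∈ K.cells, ∃ A, IsLinearPart (fun x => maxLast n p x - maxLast n q x) σ A :=
    fun σ hσ => ⟨_, (hrp σ hσ).choose_spec.sub (hrq σ hσ).choose_spec⟩
  have hcont : Continuous fun x => maxLast n p x - maxLast n q x := by unfold maxLast; fun_prop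
  refine ⟨n + 1, F, projInit n, fun x => maxLast n p x - maxLast n q x, _,
    fun x hx => ?_, ⟨|p - q|, fun x _ => ?_⟩,
    ⟨K, ⟨hK, hKc⟩, ⟨hKr, hcont.continuousOn, hlin⟩, rfl⟩,
    K.divisor fun x => maxLast n p x - maxLast n q x, rfl, ?_⟩
  · rw [toFun_projInit]
    exact hF x hx
  · change |max (x (Fin.last n)) p - max (x (Fin.last n)) q| ≤ |p - q|
    rw [max_comm, max_comm _ q]
    exact abs_max_sub_max_le_abs _ _ _
  · rw [← IntAffineMap.cls_push_chain, ← hZ, ← hZ', ← IntAffineMap.cls_push_chain,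
      ← IntAffineMap.cls_push_chain, ← map_sub, ← map_sub]
    refine IntAffineMap.cls_push_congr _ ?_
    rw [map_sub, WeightedComplex.cls_chain, WeightedComplex.cls_chain, WeightedComplex.cls_chain,
      WeightedComplex.toClass_divisor_sub hK.2 hrp hrq, hdiv Kp p hKp hlp hrp,
      hdiv Kq q hKq hlq hrq, hLp, hLq, ← hDp, ← hDq]
    rfl

end TropCycle

end

theorem mainTheorem7 {n r k : ℕ} (X : TropCycle.TropicalCycle n r)
    (Z Z' : TropCycle.Subcycle X k) :
    TropCycle.RatEquivOverReals X Z Z' ↔ TropCycle.BoundedRatEquiv X Z Z' := by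
  constructor
  · intro h
    have hb : TropCycle.Bounds X (Z.1.1 - Z'.1.1) := by
      induction h with
      | rel Z Z' h =>
        exact TropCycle.bounds_of_isBoundedRatEquivZero
          (TropCycle.boundedRatEquiv_of_areFibers h)
      | refl Z => rw [sub_self]; exact TropCycle.Bounds.zero
      | symm Z Z' _ ih => rw [← neg_sub]; exact ih.neg
      | trans Z Z' Z'' _ _ ih ih' => rw [← sub_add_sub_cancel]; exact ih.add ih'
    exact TropCycle.boundedRatEquiv_of_areFibers (TropCycle.areFibers_of_bounds hb)
  · intro h
    exact Relation.EqvGen.rel _ _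
      (TropCycle.areFibers_of_bounds (TropCycle.bounds_of_isBoundedRatEquivZero h))
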